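/- Everything is smooth ($C^\infty$). A 2-torus is a manifold $S$ diffeomorphic to $\mathbb{R}^2/\mathbb{Z}^2$. Let $X$ be a vector field on $S$. - $X$ is linearisable if there are $a,b\in\mathbb{R}$ and a diffeomorphism $\Phi:S\to\mathbb{R}^2/\mathbb{Z}^2$ with $\Phi_*X=a\,\partial_x+b\,\partial_y$; it is semi-linearisable if $X/f$ is linearisable for some smooth positive function $f$ on $S$. - $X$ is winding if $\{X\neq 0\}$ is dense and there is a closed, nowhere-vanishing 1-form $\omega$ on $S$ with $\omega(X)=0$. - A winding field $X$ has Diophantine winding number if, for homology classes $\gamma_1,\gamma_2$ generating $H_1(S;\mathbb{Z})$ and a closed 1-form $\omega$ with $[\omega]\neq 0$ in $H^1_{\mathrm{dR}}(S)$ and $\omega(X)=0$, the vector $(a,b)=\left(-\int_{\gamma_2}\omega,\int_{\gamma_1}\omega\right)$ is Diophantine, that is, there are $\gamma>0$ and $\tau>1$ with $|ak+bl|\ge\gamma\,\|(k,l)\|^{-\tau}$ for all $(k,l)\in\mathbb{Z}^2\setminus\{0\}$, where $\|\cdot\|$ is the Euclidean norm. (This does not depend on the choice of $\gamma_1,\gamma_2,\omega$.)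 **Theorem.** Let $X$ be a nowhere-vanishing vector field on a 2-torus $S$. Then the following are equivalent: 1. $X$ preserves an area form on $S$, i.e. there is a nowhere-vanishing 2-form $\mu$ on $S$ with $\mathcal{L}_X\mu=0$; 2. $X$ is winding; 3. $X$ is semi-linearisable. Moreover, if $X$ has Diophantine winding number, then $X$ is linearisable. -/

import Mathlib

open scoped Manifold ContDiff Topology

noncomputable section

namespace TorusField

/-! ### Differential forms on a manifold, through charts -/

section Forms

variable {E : Type*} [NormedAddCommGroup E] [NormedSpace ℝ E]
  {H : Type*} [TopologicalSpace H] (I : ModelWithCorners ℝ E H)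
  {S : Type*} [TopologicalSpace S] [ChartedSpace H S]

/-- The vector field `X`, written in the chart around `x₀`. -/
def chartField (X : (x : S) → TangentSpace I x) (x₀ : S) : E → E :=
  VectorField.mpullbackWithin 𝓘(ℝ, E) I (extChartAt I x₀).symm X (Set.range I)

/-- The `k`-form `α`, written in the chart around `x₀`: its pullback under the inverse of the
chart. -/
def chartForm {k : ℕ} (α : (x : S) → TangentSpace I x [⋀^Fin k]→L[ℝ] ℝ) (x₀ : S) :
    E → E [⋀^Fin k]→L[ℝ] ℝ := fun y =>
  (α ((extChartAt I x₀).symm y)).compContinuousLinearMap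
    (mfderivWithin 𝓘(ℝ, E) I (extChartAt I x₀).symm (Set.range I) y)

/-- A vector field is smooth if it is a smooth section of the tangent bundle. -/
def IsSmoothField [IsManifold I ∞ S] (X : (x : S) → TangentSpace I x) : Prop :=
  ContMDiff I I.tangent ∞ (fun x => (⟨x, X x⟩ : TangentBundle I S))

/-- A `k`-form is smooth if it is smooth in every chart. -/
def IsSmoothForm {k : ℕ} (α : (x : S) → TangentSpace I x [⋀^Fin k]→L[ℝ] ℝ) : Prop :=
  ∀ x₀ : S, ContDiffOn ℝ ∞ (chartForm I α x₀) (extChartAt I x₀).target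

/-- A `k`-form is closed if its exterior derivative vanishes in every chart. -/
def IsClosedForm {k : ℕ} (α : (x : S) → TangentSpace I x [⋀^Fin k]→L[ℝ] ℝ) : Prop :=
  ∀ x₀ : S, ∀ y ∈ (extChartAt I x₀).target,
    extDerivWithin (chartForm I α x₀) (Set.range I) y = 0

/-- A `1`-form is exact if it is the differential of a smooth function; a closed `1`-form has
trivial de Rham cohomology class precisely when it is exact. -/
def IsExactForm (α : (x : S) → TangentSpace I x [⋀^Fin 1]→L[ℝ] ℝ) : Prop :=
  ∃ f : S → ℝ, ContMDiff I 𝓘(ℝ, ℝ) ∞ f ∧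
    ∀ (x : S) (v : TangentSpace I x), α x (fun _ => v) = mfderiv I 𝓘(ℝ, ℝ) f x v

/-- The Lie derivative of a `k`-form `μ` along a vector field `X` on the normed space `E`:
`(L_X μ)(v₁, …, v_k) = (D μ · X)(v₁, …, v_k) + ∑ᵢ μ(v₁, …, DX · vᵢ, …, v_k)`. -/
def lieDerivFormWithin {k : ℕ} (X : E → E) (μ : E → E [⋀^Fin k]→L[ℝ] ℝ) (s : Set E)
    (y : E) (v : Fin k → E) : ℝ :=
  fderivWithin ℝ μ s y (X y) v +
    ∑ i : Fin k, μ y (Function.update v i (fderivWithin ℝ X s y (v i)))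

/-- The vector field `X` preserves the `k`-form `μ`: the Lie derivative `L_X μ` vanishes. -/
def Preserves {k : ℕ} (X : (x : S) → TangentSpace I x)
    (μ : (x : S) → TangentSpace I x [⋀^Fin k]→L[ℝ] ℝ) : Prop :=
  ∀ x₀ : S, ∀ y ∈ (extChartAt I x₀).target, ∀ v : Fin k → E,
    lieDerivFormWithin (chartField I X x₀) (chartForm I μ x₀) (Set.range I) y v = 0

/-- `X` preserves an area form, i.e. a smooth nowhere-vanishing `2`-form
(`S` being a surface). -/
def PreservesAreaForm (X : (x : S) → TangentSpace I x) : Prop :=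
  ∃ μ : (x : S) → TangentSpace I x [⋀^Fin 2]→L[ℝ] ℝ,
    IsSmoothForm I μ ∧ (∀ x, μ x ≠ 0) ∧ Preserves I X μ

/-- A vector field is winding if it is densely non-vanishing and annihilated by a smooth, closed,
nowhere-vanishing `1`-form. -/
def IsWinding (X : (x : S) → TangentSpace I x) : Prop :=
  Dense {x : S | X x ≠ 0} ∧
  ∃ α : (x : S) → TangentSpace I x [⋀^Fin 1]→L[ℝ] ℝ,
    IsSmoothForm I α ∧ IsClosedForm I α ∧ (∀ x, α x ≠ 0) ∧ ∀ x, α x (fun _ => X x) = 0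

/-! ### Winding numbers -/

/-- A closed curve `[0, 1] → S` is smooth. -/
def IsSmoothLoop {p : S} (c : Path p p) : Prop :=
  ContMDiffOn 𝓘(ℝ, ℝ) I ∞ c.extend (Set.Icc 0 1)

/-- The integral of a `1`-form along a curve `[0, 1] → S`. -/
def loopIntegral (α : (x : S) → TangentSpace I x [⋀^Fin 1]→L[ℝ] ℝ) {p : S} (c : Path p p) : ℝ :=
  ∫ t in (0 : ℝ)..1, α (c.extend t)
    (fun _ => mfderivWithin 𝓘(ℝ, ℝ) I c.extend (Set.Icc 0 1) t (1 : ℝ))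

end Forms

/-- The first homology group of a path-connected space, as the abelianised fundamental group. -/
abbrev FirstHomology (S : Type*) [TopologicalSpace S] (p : S) : Type _ :=
  Abelianization (FundamentalGroup S p)

/-- The homology class of a loop. -/
def homologyClass {S : Type*} [TopologicalSpace S] {p : S} (c : Path p p) : FirstHomology S p :=
  Abelianization.of (FundamentalGroup.fromPath (Path.Homotopic.Quotient.mk c))

/-- The homology classes of the loops `c₁`, `c₂` generate the first homology. -/
def GenerateHomology {S : Type*} [TopologicalSpace S] {p : S} (c₁ c₂ : Path p p) : Prop :=
  Subgroup.closure {homologyClass c₁, homologyClass c₂} = (⊤ : Subgroup (FirstHomology S p))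

/-- The vector `(a, b)` is Diophantine. -/
def IsDiophantine (a b : ℝ) : Prop :=
  ∃ γ : ℝ, 0 < γ ∧ ∃ τ : ℝ, 1 < τ ∧ ∀ k l : ℤ, (k, l) ≠ (0, 0) →
    γ * (Real.sqrt ((k : ℝ) ^ 2 + (l : ℝ) ^ 2)) ^ (-τ) ≤ |a * k + b * l|

section Winding

variable {E : Type*} [NormedAddCommGroup E] [NormedSpace ℝ E]
  {H : Type*} [TopologicalSpace H] (I : ModelWithCorners ℝ E H)
  {S : Type*} [TopologicalSpace S] [ChartedSpace H S]

/-- The winding vector field `X` has Diophantine winding number: for generators `γ₁`, `γ₂` of the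
first homology, and a closed `1`-form `α` with non-trivial cohomology class and `α(X) = 0`, the
vector `(-∫_{γ₂} α, ∫_{γ₁} α)` is Diophantine. -/
def HasDiophantineWindingNumber (X : (x : S) → TangentSpace I x) : Prop :=
  IsWinding I X ∧
  ∃ (p : S) (c₁ c₂ : Path p p) (α : (x : S) → TangentSpace I x [⋀^Fin 1]→L[ℝ] ℝ),
    IsSmoothLoop I c₁ ∧ IsSmoothLoop I c₂ ∧ GenerateHomology c₁ c₂ ∧
    IsSmoothForm I α ∧ IsClosedForm I α ∧ ¬ IsExactForm I α ∧ (∀ x, α x (fun _ => X x) = 0) ∧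
    IsDiophantine (-loopIntegral I α c₂) (loopIntegral I α c₁)

end Winding

/-! ### The standard torus and linearisability -/

/-- The smooth structure of the standard torus `ℝ² / ℤ²`, realised as `Circle × Circle`. -/
abbrev torusModel : ModelWithCorners ℝ (EuclideanSpace ℝ (Fin 1) × EuclideanSpace ℝ (Fin 1))
    (ModelProd (EuclideanSpace ℝ (Fin 1)) (EuclideanSpace ℝ (Fin 1))) :=
  (𝓡 1).prod (𝓡 1)

/-- The quotient map `ℝ² → ℝ² / ℤ²`, `(x, y) ↦ (exp (2πix), exp (2πiy))`. -/
def torusProj (u : ℝ × ℝ) : Circle × Circle :=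
  (Circle.exp (2 * Real.pi * u.1), Circle.exp (2 * Real.pi * u.2))

section Linearisable

variable {E : Type*} [NormedAddCommGroup E] [NormedSpace ℝ E]
  {H : Type*} [TopologicalSpace H] (I : ModelWithCorners ℝ E H)
  {S : Type*} [TopologicalSpace S] [ChartedSpace H S]

/-- `S` is a 2-torus: it is diffeomorphic to `ℝ² / ℤ²`. -/
def IsTwoTorus (S : Type*) [TopologicalSpace S] [ChartedSpace H S] : Prop :=
  Nonempty (S ≃ₘ⟮I, torusModel⟯ (Circle × Circle))

/-- `X` is linearisable: for some diffeomorphism `Φ : S → ℝ² / ℤ²`, the field `Φ_* X` is the constant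
vector field `a ∂/∂x + b ∂/∂y` of `ℝ²` lowered to `ℝ² / ℤ²`. -/
def IsLinearisable (X : (x : S) → TangentSpace I x) : Prop :=
  ∃ (a b : ℝ) (Φ : S ≃ₘ⟮I, torusModel⟯ (Circle × Circle)),
    ∀ (x : S) (u : ℝ × ℝ), Φ x = torusProj u →
      mfderiv I torusModel Φ x (X x) =
        mfderiv 𝓘(ℝ, ℝ × ℝ) torusModel torusProj u ((a, b) : ℝ × ℝ)

/-- `X` is semi-linearisable: `X / f` is linearisable for some smooth positive function `f`. -/
def IsSemiLinearisable (X : (x : S) → TangentSpace I x) : Prop :=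
  ∃ f : S → ℝ, ContMDiff I 𝓘(ℝ, ℝ) ∞ f ∧ (∀ x, 0 < f x) ∧
    IsLinearisable I (fun x => (f x)⁻¹ • X x)

end Linearisable

end TorusField

end

/-! Everything is done on the plane, which covers `S` with deck group ℤ² (`IsTorusCover`): fields
and forms on `S` become periodic ones, and a change of coordinates on `S` becomes a diffeomorphism
of the plane commuting with ℤ² (`IsLatticeDiffeo`).

(1 ⇒ 2) Every 2-form on a surface is closed, so Cartan's formula reads L_X μ = d(ι_X μ), and ι_X μ
is the required 1-form (`extDeriv_interior`). (3 ⇒ 1) On a cover where X = f e with e constant, the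
area form f⁻¹ dx∧dy contracts with X to a constant, hence closed, form.

(2 ⇒ 3) The closed form lifts to dF with F(z + m) = F(z) + c·m. It suffices to find
lattice-equivariant coordinates in which F is the linear function c·z
(`exists_isLatticeDiffeo_of_submersion`): X is tangent to the levels of F, so there it is a
nowhere-zero multiple of a fixed vector. Let Y be a periodic field spanning the tangents to the
levels. Each level is a single orbit of Y, and no orbit closes up, because a level comes within
bounded distance of arbitrarily far lattice points. By compactness there is a time T after which
every point has moved far; since F - c·z is bounded, this displacement has a component transverse to
c, of constant sign and bounded away from zero. Averaging the corresponding linear form over [0, T]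
gives a function increasing along Y at a definite rate, and mollifying it gives a smooth G with G(z
+ m) = G(z) + d·m, where d is independent of c. Up to a linear change, (F, G) is the coordinate
system.

(Diophantine case) On a cover where X = f e, the map z ↦ z + w(z) e carries X to κ e exactly when
∂_e w = κ/f - 1. The constant κ makes the right side of mean zero, and w is found by Fourier series:
the divisors e·k are bounded below by a power of |k|, so rapid decay of coefficients survives
division (`exists_cohomological_solution`). The vector e is Diophantine because it is orthogonal to
the period c of the given form, whose integrals over the two loops are c·m₁ and c·m₂ with m₁, m₂
generating ℤ² (`IsTorusCover.exists_generators`, `IsDiophantine.of_generators`). -/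

noncomputable section

namespace TorusField

/-! ### Global flows of bounded Lipschitz vector fields -/

section Flow

open Set Metric

variable {E : Type*} [NormedAddCommGroup E] [NormedSpace ℝ E]

/-- `φ` is the global flow of the vector field `V`. -/
structure IsFlow (V : E → E) (φ : ℝ → E → E) : Prop where
  map_zero : ∀ z, φ 0 z = z
  hasDerivAt : ∀ z t, HasDerivAt (fun s => φ s z) (V (φ t z)) t

theorem exists_integralCurve_Icc [CompleteSpace E] {V : E → E} {K M : NNReal}
    (hV : LipschitzWith K V) (hM : ∀ x, ‖V x‖ ≤ M) (z : E) (T : ℝ) (hT : 0 < T) :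
    ∃ γ : ℝ → E, γ 0 = z ∧ ∀ t ∈ Ioo (-T) T, HasDerivAt γ (V (γ t)) t := by
  have h0 : (0 : ℝ) ∈ Icc (-T) T := ⟨by linarith, hT.le⟩
  -- A curve of speed at most `M` stays in the ball of radius `M * T` during time `T`, so
  -- boundedness of `V` lets Picard–Lindelöf work on an interval of any length.
  have hP : IsPicardLindelof (fun _ => V) (⟨0, h0⟩ : Icc (-T) T) z (M * ⟨T, hT.le⟩) 0 M K := by
    refine IsPicardLindelof.of_time_independent (fun x _ => hM x) hV.lipschitzOnWith ?_
    simp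
    exact le_rfl
  obtain ⟨γ, h1, h2⟩ := hP.exists_eq_forall_mem_Icc_hasDerivWithinAt₀
  exact ⟨γ, h1, fun t ht => (h2 t (Ioo_subset_Icc_self ht)).hasDerivAt
    (Icc_mem_nhds ht.1 ht.2)⟩

theorem exists_isFlow [CompleteSpace E] {V : E → E} {K M : NNReal}
    (hV : LipschitzWith K V) (hM : ∀ x, ‖V x‖ ≤ M) : ∃ φ, IsFlow V φ := by
  have key : ∀ (z : E) (n : ℕ), ∃ γ : ℝ → E, γ 0 = z ∧
      ∀ t ∈ Ioo (-(n + 1 : ℝ)) (n + 1), HasDerivAt γ (V (γ t)) t := fun z n =>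
    exists_integralCurve_Icc hV hM z _ (by positivity)
  choose γ h0 hγ using key
  have huniq : ∀ z (m n : ℕ), m ≤ n → EqOn (γ z m) (γ z n) (Ioo (-(m + 1 : ℝ)) (m + 1)) := by
    intro z m n hmn
    have hmn' : (m : ℝ) ≤ n := by exact_mod_cast hmn
    refine ODE_solution_unique_of_mem_Ioo (v := fun _ => V) (s := fun _ => univ) (t₀ := 0)
      (fun t _ => hV.lipschitzOnWith) ⟨by linarith [m.cast_nonneg (α := ℝ)], by positivity⟩
      (fun t ht => ⟨hγ z m t ht, trivial⟩)
      (fun t ht => ⟨hγ z n t ⟨by linarith [ht.1], by linarith [ht.2]⟩, trivial⟩) ?_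
    rw [h0, h0]
  have hfloor : ∀ t : ℝ, t ∈ Ioo (-((⌊|t|⌋₊ : ℝ) + 1)) (⌊|t|⌋₊ + 1) := by
    intro t
    rw [mem_Ioo, ← abs_lt]
    exact Nat.lt_floor_add_one _
  have heq : ∀ z (n : ℕ), EqOn (fun t => γ z ⌊|t|⌋₊ t) (γ z n) (Ioo (-(n + 1 : ℝ)) (n + 1)) := by
    intro z n t ht
    rcases le_total ⌊|t|⌋₊ n with h | h
    · exact huniq z _ _ h (hfloor t)
    · exact (huniq z _ _ h ht).symm
  -- At time `t` the local solution of index `⌊|t|⌋₊` is used, whose interval contains `t`; by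
  -- uniqueness the solutions agree wherever they overlap.
  refine ⟨fun t z => γ z ⌊|t|⌋₊ t, fun z => by simpa using h0 z 0, fun z t => ?_⟩
  have := hγ z _ t (hfloor t)
  refine this.congr_of_eventuallyEq ?_
  filter_upwards [isOpen_Ioo.mem_nhds (hfloor t)] with s hs using heq z _ hs

namespace IsFlow

variable {V : E → E} {φ : ℝ → E → E}

theorem continuous_left (h : IsFlow V φ) (z : E) : Continuous fun t => φ t z :=
  continuous_iff_continuousAt.2 fun t => (h.hasDerivAt z t).continuousAt

theorem eq_of_hasDerivAt (h : IsFlow V φ) {K : NNReal} (hV : LipschitzWith K V) {γ : ℝ → E}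
    (hγ : ∀ t, HasDerivAt γ (V (γ t)) t) (t : ℝ) : γ t = φ t (γ 0) := by
  have := ODE_solution_unique_univ (v := fun _ => V) (s := fun _ => univ) (t₀ := 0)
    (fun t => hV.lipschitzOnWith) (fun t => ⟨hγ t, trivial⟩)
    (fun t => ⟨h.hasDerivAt (γ 0) t, trivial⟩) (h.map_zero _).symm
  exact congrFun this t

theorem map_add (h : IsFlow V φ) {K : NNReal} (hV : LipschitzWith K V) (s t : ℝ) (z : E) :
    φ (s + t) z = φ s (φ t z) := by
  have := h.eq_of_hasDerivAt hV (γ := fun s => φ (s + t) z)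
    (fun s => (h.hasDerivAt z (s + t)).comp_add_const s t) s
  simpa using this

theorem translate (h : IsFlow V φ) {K : NNReal} (hV : LipschitzWith K V) {v : E}
    (hv : ∀ z, V (z + v) = V z) (t : ℝ) (z : E) : φ t (z + v) = φ t z + v := by
  have := h.eq_of_hasDerivAt hV (γ := fun s => φ s z + v)
    (fun s => by simpa [hv] using (h.hasDerivAt z s).add_const v) t
  simpa [h.map_zero] using this.symm

theorem neg (h : IsFlow V φ) : IsFlow (fun z => -V z) (fun t z => φ (-t) z) where
  map_zero z := by simpa using h.map_zero z
  hasDerivAt z t := by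
    simpa [Function.comp_def] using (h.hasDerivAt z (-t)).scomp t (hasDerivAt_neg t)

theorem dist_le_of_nonneg (h : IsFlow V φ) {K : NNReal} (hV : LipschitzWith K V) {t : ℝ}
    (ht : 0 ≤ t) (z w : E) : dist (φ t z) (φ t w) ≤ dist z w * Real.exp (K * t) := by
  have := dist_le_of_trajectories_ODE (v := fun _ => V) (a := 0) (b := t) (δ := dist z w)
    (fun _ => hV) (h.continuous_left z).continuousOn
    (fun s _ => (h.hasDerivAt z s).hasDerivWithinAt) (h.continuous_left w).continuousOn
    (fun s _ => (h.hasDerivAt w s).hasDerivWithinAt) (by simp [h.map_zero]) t ⟨ht, le_rfl⟩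
  simpa using this

theorem dist_le (h : IsFlow V φ) {K : NNReal} (hV : LipschitzWith K V) (t : ℝ) (z w : E) :
    dist (φ t z) (φ t w) ≤ dist z w * Real.exp (K * |t|) := by
  rcases le_total 0 t with ht | ht
  · rw [abs_of_nonneg ht]; exact h.dist_le_of_nonneg hV ht z w
  · rw [abs_of_nonpos ht]
    simpa using h.neg.dist_le_of_nonneg hV.neg (neg_nonneg.2 ht) z w

theorem dist_time_le (h : IsFlow V φ) {M : NNReal} (hM : ∀ x, ‖V x‖ ≤ M) (z : E) (s t : ℝ) :
    ‖φ t z - φ s z‖ ≤ M * |t - s| :=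
  convex_univ.norm_image_sub_le_of_norm_hasDerivWithin_le
    (fun x _ => (h.hasDerivAt z x).hasDerivWithinAt) (fun _ _ => hM _) trivial trivial

theorem norm_sub_le (h : IsFlow V φ) {M : NNReal} (hM : ∀ x, ‖V x‖ ≤ M) (z : E) (t : ℝ) :
    ‖φ t z - z‖ ≤ M * |t| := by
  simpa [h.map_zero] using h.dist_time_le hM z 0 t

theorem continuous_uncurry (h : IsFlow V φ) {K M : NNReal} (hV : LipschitzWith K V)
    (hM : ∀ x, ‖V x‖ ≤ M) : Continuous fun p : ℝ × E => φ p.1 p.2 := by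
  rw [continuous_iff_continuousAt]
  rintro ⟨t, z⟩
  rw [ContinuousAt, tendsto_iff_dist_tendsto_zero]
  have hb : ∀ p : ℝ × E, dist (φ p.1 p.2) (φ t z) ≤
      dist p.2 z * Real.exp (K * |p.1|) + M * |p.1 - t| := fun p =>
    (dist_triangle _ (φ p.1 z) _).trans (add_le_add (h.dist_le hV _ _ _)
      ((dist_eq_norm _ _).trans_le (h.dist_time_le hM z t p.1)))
  refine squeeze_zero (fun _ => dist_nonneg) hb ?_
  have : Continuous fun p : ℝ × E =>
    dist p.2 z * Real.exp (K * |p.1|) + M * |p.1 - t| := by fun_prop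
  simpa using this.tendsto (t, z)

/-- Along the flow the field differs from its initial value by at most `K * M * t`. This
second-order error lets the flow be replaced by a straight segment in a difference quotient. -/
theorem norm_sub_sub_smul_le (h : IsFlow V φ) {K M : NNReal} (hV : LipschitzWith K V)
    (hM : ∀ x, ‖V x‖ ≤ M) (z : E) {t : ℝ} (ht : 0 ≤ t) :
    ‖φ t z - z - t • V z‖ ≤ K * M * t * t := by
  have hd : ∀ s ∈ Icc 0 t, HasDerivWithinAt (fun s => φ s z - s • V z)
      (V (φ s z) - V z) (Icc 0 t) s := fun s _ => by
    have := (h.hasDerivAt z s).fun_sub ((hasDerivAt_id s).smul_const (V z))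
    simpa using this.hasDerivWithinAt
  have hb : ∀ s ∈ Icc 0 t, ‖V (φ s z) - V z‖ ≤ K * M * t := fun s hs => by
    rw [← dist_eq_norm]
    refine (hV.dist_le_mul _ _).trans ?_
    rw [mul_assoc, dist_eq_norm]
    gcongr
    refine (h.norm_sub_le hM z s).trans ?_
    rw [abs_of_nonneg hs.1]
    gcongr
    exact hs.2
  have := (convex_Icc 0 t).norm_image_sub_le_of_norm_hasDerivWithin_le hd hb
    (left_mem_Icc.2 ht) (right_mem_Icc.2 ht)
  simp only [h.map_zero, zero_smul, sub_zero, Real.norm_of_nonneg ht] at this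
  rwa [sub_right_comm] at this

end IsFlow

end Flow

end TorusField

namespace TorusField

open Set Metric Filter

/-! ### Periodic functions on the plane -/

/-- The inclusion of the lattice `ℤ²` in the plane. -/
def lat : ℤ × ℤ →+ ℝ × ℝ := (Int.castAddHom ℝ).prodMap (Int.castAddHom ℝ)

@[simp] theorem lat_fst (m : ℤ × ℤ) : (lat m).1 = m.1 := rfl

@[simp] theorem lat_snd (m : ℤ × ℤ) : (lat m).2 = m.2 := rfl

theorem exists_add_lat_mem_box (z : ℝ × ℝ) :
    ∃ m, z + lat m ∈ (Icc 0 1 ×ˢ Icc 0 1 : Set (ℝ × ℝ)) := by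
  refine ⟨(-⌊z.1⌋, -⌊z.2⌋), ?_⟩
  simp only [mem_prod, mem_Icc, Prod.fst_add, Prod.snd_add, lat_fst, lat_snd, Int.cast_neg]
  have h1 := Int.floor_le z.1
  have h2 := Int.floor_le z.2
  have h3 := Int.lt_floor_add_one z.1
  have h4 := Int.lt_floor_add_one z.2
  refine ⟨⟨?_, ?_⟩, ⟨?_, ?_⟩⟩ <;> linarith

theorem isCompact_box : IsCompact (Icc 0 1 ×ˢ Icc 0 1 : Set (ℝ × ℝ)) :=
  isCompact_Icc.prod isCompact_Icc

theorem exists_bound_of_periodic {E : Type*} [NormedAddCommGroup E] {f : ℝ × ℝ → E}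
    (hf : Continuous f) (hper : ∀ z m, f (z + lat m) = f z) :
    ∃ C : NNReal, ∀ z, ‖f z‖ ≤ C := by
  obtain ⟨C, hC⟩ := isCompact_box.exists_bound_of_continuousOn hf.continuousOn
  refine ⟨C.toNNReal, fun z => ?_⟩
  obtain ⟨m, hm⟩ := exists_add_lat_mem_box z
  rw [← hper z m]
  exact (hC _ hm).trans (Real.le_coe_toNNReal C)

theorem exists_pos_le_of_periodic {f : ℝ × ℝ → ℝ} (hf : Continuous f)
    (hper : ∀ z m, f (z + lat m) = f z) (hpos : ∀ z, 0 < f z) : ∃ δ, 0 < δ ∧ ∀ z, δ ≤ f z := by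
  obtain ⟨w, -, hw⟩ := isCompact_box.exists_isMinOn
    ⟨(0, 0), ⟨⟨le_rfl, zero_le_one⟩, ⟨le_rfl, zero_le_one⟩⟩⟩ hf.continuousOn
  refine ⟨f w, hpos w, fun z => ?_⟩
  obtain ⟨m, hm⟩ := exists_add_lat_mem_box z
  rw [← hper z m]
  exact hw hm

theorem fderiv_periodic {E : Type*} [NormedAddCommGroup E] [NormedSpace ℝ E] {f : ℝ × ℝ → E}
    {m : ℤ × ℤ} {v : E} (hper : ∀ z, f (z + lat m) = f z + v) (z : ℝ × ℝ) :
    fderiv ℝ f (z + lat m) = fderiv ℝ f z := by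
  rw [← fderiv_comp_add_right, show (fun x => f (x + lat m)) = fun x => f x + v from funext hper,
    fderiv_add_const]

theorem exists_lipschitzWith_of_periodic {E : Type*} [NormedAddCommGroup E] [NormedSpace ℝ E]
    {f : ℝ × ℝ → E} (hf : ContDiff ℝ 1 f) (hper : ∀ z m, f (z + lat m) = f z) :
    ∃ K, LipschitzWith K f := by
  obtain ⟨C, hC⟩ := exists_bound_of_periodic (hf.continuous_fderiv one_ne_zero)
    (fun z m => fderiv_periodic (v := 0) (fun z => by rw [hper, add_zero]) z)
  exact ⟨C, lipschitzWith_of_nnnorm_fderiv_le (hf.differentiable one_ne_zero) hC⟩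

/-- Lattice points stay close to the line orthogonal to `c` arbitrarily far out: rounding a point of
that line leaves a value `c.2` times a fractional part. These points show later that the levels of
`F` are unbounded. -/
theorem exists_lat_large (c : ℝ × ℝ) (R : ℝ) :
    ∃ m, R ≤ ‖lat m‖ ∧ |c.1 * m.1 + c.2 * m.2| ≤ |c.2| := by
  obtain ⟨n, hn⟩ := exists_nat_ge R
  by_cases h : c.2 = 0
  · refine ⟨(0, n), ?_, by simp [h]⟩
    refine hn.trans (le_trans ?_ (norm_snd_le _))
    simp
  · refine ⟨(n, -⌊c.1 * n / c.2⌋), ?_, ?_⟩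
    · refine hn.trans (le_trans ?_ (norm_fst_le _))
      simp
    · have h1 := Int.fract_nonneg (c.1 * n / c.2)
      have h2 := (Int.fract_lt_one (c.1 * n / c.2)).le
      have : c.1 * ((n : ℤ) : ℝ) + c.2 * ((-⌊c.1 * n / c.2⌋ : ℤ) : ℝ)
          = c.2 * Int.fract (c.1 * n / c.2) := by
        rw [Int.fract]; push_cast; field_simp; ring
      simp only [this, abs_mul]
      rw [abs_of_nonneg h1]
      exact mul_le_of_le_one_right (abs_nonneg _) h2

theorem clm_prod_apply {E : Type*} [NormedAddCommGroup E] [NormedSpace ℝ E]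
    (L : ℝ × ℝ →L[ℝ] E) (v : ℝ × ℝ) : L v = v.1 • L (1, 0) + v.2 • L (0, 1) := by
  rw [← map_smul, ← map_smul, ← map_add]
  simp

/-! ### Level sets of a submersion of the plane that is linear up to a periodic function -/

/-- Data attached to a submersion `F` of the plane with periodic differential: a vector field `Y`
tangent to the levels of `F`, a vector field `Z` raising `F` at unit speed, and their flows. -/
structure LevelFlow (F : ℝ × ℝ → ℝ) (c : ℝ × ℝ) (Y Z : ℝ × ℝ → ℝ × ℝ)
    (φ ψ : ℝ → ℝ × ℝ → ℝ × ℝ) (K M : NNReal) : Prop where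
  smooth : ContDiff ℝ ∞ F
  quasiPeriodic : ∀ z (m : ℤ × ℤ), F (z + lat m) = F z + (c.1 * m.1 + c.2 * m.2)
  map_Y : ∀ z, fderiv ℝ F z (Y z) = 0
  map_Z : ∀ z, fderiv ℝ F z (Z z) = 1
  Y_ne : ∀ z, Y z ≠ 0
  lip_Y : LipschitzWith K Y
  lip_Z : LipschitzWith K Z
  bound_Y : ∀ z, ‖Y z‖ ≤ M
  bound_Z : ∀ z, ‖Z z‖ ≤ M
  periodic_Y : ∀ z m, Y (z + lat m) = Y z
  flow_Y : IsFlow Y φ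
  flow_Z : IsFlow Z ψ

/-- Two vectors of the plane in the kernel of a non-zero linear form are proportional. -/
theorem det_eq_zero_of_ker {L : ℝ × ℝ →L[ℝ] ℝ} (hL : L ≠ 0) {v w : ℝ × ℝ} (hv : L v = 0)
    (hw : L w = 0) : v.1 * w.2 - v.2 * w.1 = 0 := by
  rw [clm_prod_apply] at hv hw
  simp only [smul_eq_mul] at hv hw
  by_contra h
  apply hL
  have h1 : L (1, 0) = 0 := by
    have : (v.1 * w.2 - v.2 * w.1) * L (1, 0) = 0 := by linear_combination w.2 * hv - v.2 * hw
    exact (mul_eq_zero.1 this).resolve_left h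
  have h2 : L (0, 1) = 0 := by
    have : (v.1 * w.2 - v.2 * w.1) * L (0, 1) = 0 := by linear_combination v.1 * hw - w.1 * hv
    exact (mul_eq_zero.1 this).resolve_left h
  ext <;> simp [h1, h2]

theorem sq_add_sq_pos {v : ℝ × ℝ} (h : v ≠ 0) : 0 < v.1 * v.1 + v.2 * v.2 := by
  rcases eq_or_ne v.1 0 with h1 | h1
  · have h2 : v.2 ≠ 0 := fun h2 => h (Prod.ext h1 h2)
    have := mul_self_pos.2 h2
    have := mul_self_nonneg v.1
    linarith
  · have := mul_self_pos.2 h1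
    have := mul_self_nonneg v.2
    linarith

/-- The linear form `⟨v, ·⟩` on the plane. -/
def dotCLM (v : ℝ × ℝ) : ℝ × ℝ →L[ℝ] ℝ :=
  v.1 • ContinuousLinearMap.fst ℝ ℝ ℝ + v.2 • ContinuousLinearMap.snd ℝ ℝ ℝ

@[simp] theorem dotCLM_apply (v w : ℝ × ℝ) : dotCLM v w = v.1 * w.1 + v.2 * w.2 := by
  simp [dotCLM]

/-- A map of the plane with injective strict derivative is locally injective. -/
theorem exists_injOn_of_hasStrictFDerivAt {P : ℝ × ℝ → ℝ × ℝ} {P' : ℝ × ℝ →L[ℝ] ℝ × ℝ} {w : ℝ × ℝ}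
    (hP : HasStrictFDerivAt P P' w) (hinj : Function.Injective P') : ∃ W ∈ 𝓝 w, InjOn P W := by
  let e : (ℝ × ℝ) ≃L[ℝ] ℝ × ℝ :=
    (LinearEquiv.ofInjectiveEndo (P' : ℝ × ℝ →ₗ[ℝ] ℝ × ℝ) hinj).toContinuousLinearEquiv
  have he : (e : ℝ × ℝ →L[ℝ] ℝ × ℝ) = P' := by ext <;> rfl
  rw [← he] at hP
  exact ⟨_, (hP.toOpenPartialHomeomorph P).open_source.mem_nhds
    hP.mem_toOpenPartialHomeomorph_source, (hP.toOpenPartialHomeomorph P).injOn⟩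

namespace LevelFlow

variable {F : ℝ × ℝ → ℝ} {c : ℝ × ℝ} {Y Z : ℝ × ℝ → ℝ × ℝ} {φ ψ : ℝ → ℝ × ℝ → ℝ × ℝ} {K M : NNReal}

theorem differentiable (h : LevelFlow F c Y Z φ ψ K M) : Differentiable ℝ F :=
  h.smooth.differentiable (by simp)

theorem fderiv_ne_zero (h : LevelFlow F c Y Z φ ψ K M) (z : ℝ × ℝ) : fderiv ℝ F z ≠ 0 :=
  fun h0 => by simpa [h0] using h.map_Z z

theorem map_flow_Y (h : LevelFlow F c Y Z φ ψ K M) (t : ℝ) (z : ℝ × ℝ) : F (φ t z) = F z := by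
  have hd : ∀ t, HasDerivAt (fun t => F (φ t z)) 0 t := fun t => by
    have := (h.differentiable (φ t z)).hasFDerivAt.comp_hasDerivAt t (h.flow_Y.hasDerivAt z t)
    rwa [h.map_Y] at this
  have := is_const_of_deriv_eq_zero (fun t => (hd t).differentiableAt) (fun t => (hd t).deriv) t 0
  simpa [h.flow_Y.map_zero] using this

theorem map_flow_Z (h : LevelFlow F c Y Z φ ψ K M) (t : ℝ) (z : ℝ × ℝ) :
    F (ψ t z) = F z + t := by
  have hd : ∀ t, HasDerivAt (fun t => F (ψ t z) - t) 0 t := fun t => by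
    have := (h.differentiable (ψ t z)).hasFDerivAt.comp_hasDerivAt t (h.flow_Z.hasDerivAt z t)
    rw [h.map_Z] at this
    simpa using this.fun_sub (hasDerivAt_id t)
  have := is_const_of_deriv_eq_zero (fun t => (hd t).differentiableAt) (fun t => (hd t).deriv) t 0
  simp [h.flow_Z.map_zero] at this
  linarith

/-- Near `w`, the function `F` and the linear form `q = ⟨Y w, ·⟩` are coordinates, since `Y w` spans
the kernel of dF and `q (Y w) > 0`. Along the flow `F` is constant and `q` increases at rate at
least `η`, so the intermediate value theorem finds a time at which both coordinates agree with those
of `v`. -/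
theorem exists_nhds_flow_eq (h : LevelFlow F c Y Z φ ψ K M) (w : ℝ × ℝ) {ε : ℝ} (hε : 0 < ε) :
    ∃ U ∈ 𝓝 w, ∀ u ∈ U, ∀ v ∈ U, F u = F v → ∃ r, |r| < ε ∧ φ r u = v := by
  set q := dotCLM (Y w) with hq
  have hqw : 0 < q (Y w) := by simpa [hq] using sq_add_sq_pos (h.Y_ne w)
  have hP : HasStrictFDerivAt (fun z => (F z, q z)) ((fderiv ℝ F w).prod q) w :=
    (h.smooth.contDiffAt.hasStrictFDerivAt (by simp)).prodMk q.hasStrictFDerivAt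
  have hinj : Function.Injective ((fderiv ℝ F w).prod q) := by
    rw [injective_iff_map_eq_zero]
    intro v hv
    simp only [ContinuousLinearMap.prod_apply, Prod.mk_eq_zero] at hv
    have h1 := det_eq_zero_of_ker (h.fderiv_ne_zero w) hv.1 (h.map_Y w)
    have h2 : (Y w).1 * v.1 + (Y w).2 * v.2 = 0 := by simpa [hq] using hv.2
    by_contra h0
    have h3 := mul_pos (sq_add_sq_pos h0) (sq_add_sq_pos (h.Y_ne w))
    have h4 : (v.1 * v.1 + v.2 * v.2) * ((Y w).1 * (Y w).1 + (Y w).2 * (Y w).2) = 0 := by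
      linear_combination (v.1 * (Y w).2 - v.2 * (Y w).1) * h1 +
        ((Y w).1 * v.1 + (Y w).2 * v.2) * h2
    exact h3.ne' h4
  obtain ⟨W, hW, hWinj⟩ := exists_injOn_of_hasStrictFDerivAt hP hinj
  set η := q (Y w) / 2 with hη
  have hη0 : 0 < η := by positivity
  have hW' : {u | η < q (Y u)} ∈ 𝓝 w := by
    have : Continuous fun u => q (Y u) := q.continuous.comp h.lip_Y.continuous
    exact this.continuousAt.eventually_const_lt (by rw [hη]; linarith)
  obtain ⟨ρ, hρ, hball⟩ := Metric.mem_nhds_iff.1 (inter_mem hW hW')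
  -- The first bound keeps the time below `ε`; the second keeps orbits from the half ball inside the
  -- ball of radius `ρ`. The `+ 1` guards against `M = 0`.
  set r₀ := min (ε / 2) (ρ / 2 / (M + 1)) with hr₀
  have hr0 : 0 < r₀ := by positivity
  have hstay : ∀ u ∈ ball w (ρ / 2), ∀ r ∈ Icc (-r₀) r₀, φ r u ∈ ball w ρ := by
    intro u hu r hr
    rw [mem_ball] at *
    have h1 : dist (φ r u) u ≤ M * |r| := (dist_eq_norm _ _).trans_le (h.flow_Y.norm_sub_le h.bound_Y u r)
    have h2 : M * |r| ≤ ρ / 2 := by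
      calc (M : ℝ) * |r| ≤ (M + 1) * (ρ / 2 / (M + 1)) := by
            gcongr
            · linarith
            · exact (abs_le.2 hr).trans (min_le_right _ _)
        _ = ρ / 2 := by field_simp
    have := dist_triangle (φ r u) u w
    linarith
  have hder : ∀ u r, HasDerivAt (fun r => q (φ r u)) (q (Y (φ r u))) r := fun u r =>
    q.hasFDerivAt.comp_hasDerivAt r (h.flow_Y.hasDerivAt u r)
  have hgrow : ∀ u ∈ ball w (ρ / 2), ∀ s ∈ Icc (-r₀) r₀, ∀ t ∈ Icc (-r₀) r₀, s ≤ t →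
      η * (t - s) ≤ q (φ t u) - q (φ s u) := by
    intro u hu
    refine (convex_Icc (-r₀) r₀).mul_sub_le_image_sub_of_le_deriv
      (fun r _ => (hder u r).continuousAt.continuousWithinAt)
      (fun r _ => (hder u r).differentiableAt.differentiableWithinAt) ?_
    intro r hr
    rw [(hder u r).deriv]
    exact (hball (hstay u hu r (interior_subset hr))).2.le
  -- Both `q u` and `q v` are within `η * r₀ / 2` of `q w`, so their difference is less than `η *
  -- r₀`, the range guaranteed by flowing for time `r₀` either way.
  refine ⟨ball w (ρ / 2) ∩ {u | |q u - q w| < η * r₀ / 2}, inter_mem (ball_mem_nhds _ (by positivity))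
    ?_, ?_⟩
  · have : Continuous fun u => |q u - q w| := by fun_prop
    exact this.continuousAt.eventually_lt_const (by simpa using by positivity)
  · rintro u ⟨hu, hu'⟩ v ⟨hv, hv'⟩ huv
    rw [mem_ofPred_eq, abs_lt] at hu' hv'
    have m0 : (0 : ℝ) ∈ Icc (-r₀) r₀ := ⟨by linarith, hr0.le⟩
    have m1 : r₀ ∈ Icc (-r₀) r₀ := ⟨by linarith, le_rfl⟩
    have m2 : -r₀ ∈ Icc (-r₀) r₀ := ⟨le_rfl, by linarith⟩
    have g1 := hgrow u hu _ m0 _ m1 hr0.le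
    have g2 := hgrow u hu _ m2 _ m0 (by linarith)
    rw [h.flow_Y.map_zero] at g1 g2
    obtain ⟨r, hr, hrv⟩ := intermediate_value_Icc (f := fun r => q (φ r u)) (by linarith : -r₀ ≤ r₀)
      (fun r _ => (hder u r).continuousAt.continuousWithinAt)
      (show q v ∈ Icc (q (φ (-r₀) u)) (q (φ r₀ u)) from ⟨by linarith, by linarith⟩)
    refine ⟨r, ?_, ?_⟩
    · have : |r| ≤ ε / 2 := (abs_le.2 hr).trans (min_le_left _ _)
      linarith
    · refine hWinj (hball (hstay u hu r hr)).1
        (hball (ball_subset_ball (by linarith) hv)).1 ?_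
      simp only [Prod.mk.injEq]
      exact ⟨(h.map_flow_Y r u).trans huv, hrv⟩

/-- The flow `ψ` retracts the plane onto the level of `z` through `π`. By the local statement,
whether `π x` lies on the orbit of `z` is locally constant in `x`, hence constant on the connected
plane. -/
theorem exists_flow_eq (h : LevelFlow F c Y Z φ ψ K M) {z w : ℝ × ℝ} (hzw : F z = F w) :
    ∃ t, φ t z = w := by
  set π : ℝ × ℝ → ℝ × ℝ := fun x => ψ (F z - F x) x with hπ
  have hπF : ∀ x, F (π x) = F z := fun x => by simp [hπ, h.map_flow_Z]
  have hπc : Continuous π := (h.flow_Z.continuous_uncurry h.lip_Z h.bound_Z).comp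
    ((continuous_const.sub h.smooth.continuous).prodMk continuous_id)
  have hloc : IsLocallyConstant fun x => ∃ t, φ t z = π x := by
    rw [IsLocallyConstant.iff_eventually_eq]
    intro x
    obtain ⟨U, hU, hUφ⟩ := h.exists_nhds_flow_eq (π x) one_pos
    filter_upwards [hπc.continuousAt hU] with y hy
    refine propext ⟨?_, ?_⟩
    · rintro ⟨t, ht⟩
      obtain ⟨r, -, hr⟩ := hUφ _ hy _ (mem_of_mem_nhds hU) (by rw [hπF, hπF])
      exact ⟨r + t, by rw [h.flow_Y.map_add h.lip_Y, ht, hr]⟩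
    · rintro ⟨t, ht⟩
      obtain ⟨r, -, hr⟩ := hUφ _ (mem_of_mem_nhds hU) _ hy (by rw [hπF, hπF])
      exact ⟨r + t, by rw [h.flow_Y.map_add h.lip_Y, ht, hr]⟩
  have := hloc.apply_eq_of_preconnectedSpace z w
  simp only [hπ, hzw, sub_self, h.flow_Z.map_zero] at this
  rw [← this]
  exact ⟨0, h.flow_Y.map_zero z⟩

/-- A periodic orbit is bounded, and it fills its whole level. But the level of `z` contains points
near `z + lat m` for arbitrarily large `m`: choose `m` with `c·m` bounded and return to the level by
`ψ` in bounded time. -/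
theorem flow_eq_self (h : LevelFlow F c Y Z φ ψ K M) {z : ℝ × ℝ} {t : ℝ} (ht : φ t z = z) :
    t = 0 := by
  by_contra h0
  have hper : Function.Periodic (fun s => φ s z) t := fun s => by
    simp only [h.flow_Y.map_add h.lip_Y, ht]
  obtain ⟨B, hB⟩ := (hper.isBounded_of_continuous h0 (h.flow_Y.continuous_left z)).exists_norm_le
  obtain ⟨m, hm, hc⟩ := exists_lat_large c (B + ‖z‖ + M * |c.2| + 1)
  obtain ⟨s, hs⟩ := h.exists_flow_eq (z := z) (w := ψ (-(c.1 * m.1 + c.2 * m.2)) (z + lat m))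
    (by rw [h.map_flow_Z, h.quasiPeriodic]; ring)
  have h1 := hB _ ⟨s, hs⟩
  have h2 := h.flow_Z.norm_sub_le h.bound_Z (z + lat m) (-(c.1 * m.1 + c.2 * m.2))
  rw [abs_neg] at h2
  have h3 : (M : ℝ) * |c.1 * m.1 + c.2 * m.2| ≤ M * |c.2| := by gcongr
  set x := ψ (-(c.1 * m.1 + c.2 * m.2)) (z + lat m)
  have h4 : lat m = x - z - (x - (z + lat m)) := by abel
  have h5 : ‖lat m‖ ≤ ‖x‖ + ‖z‖ + ‖x - (z + lat m)‖ := by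
    conv_lhs => rw [h4]
    exact (norm_sub_le _ _).trans (add_le_add_left (norm_sub_le _ _) _)
  linarith

/-- With zero period `F` would be bounded, while `ψ` raises it indefinitely. -/
theorem period_ne_zero (h : LevelFlow F c Y Z φ ψ K M) : c ≠ 0 := by
  rintro rfl
  obtain ⟨C, hC⟩ := exists_bound_of_periodic h.smooth.continuous
    (fun z m => by simpa using h.quasiPeriodic z m)
  have h1 := hC (ψ (2 * C + 1) 0)
  have h2 := hC 0
  rw [h.map_flow_Z, Real.norm_eq_abs, abs_le] at h1
  rw [Real.norm_eq_abs, abs_le] at h2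
  linarith [h1.2, h2.1]

/-- Otherwise there are points of the unit box that are within `R` of their start at times tending
to infinity. In the limit, the starts tend to `z` and the ends to `w` on the same level, so `w = φ τ
z`. Then `φ (θ n + 1)` and `φ τ` send the same start to nearby points of one level, which differ by
a flow time below 1; as orbits do not close up, `θ n + 1 < τ + 1`, which fails for large `n`. -/
theorem exists_time_escape (h : LevelFlow F c Y Z φ ψ K M) (R : ℝ) :
    ∃ T, 0 < T ∧ ∀ z, R < ‖φ T z - z‖ := by
  by_contra! hcon
  have hbox : ∀ n : ℕ, ∃ z ∈ (Icc 0 1 ×ˢ Icc 0 1 : Set (ℝ × ℝ)), ‖φ (n + 1) z - z‖ ≤ R := by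
    intro n
    obtain ⟨z, hz⟩ := hcon (n + 1) (by positivity)
    obtain ⟨m, hm⟩ := exists_add_lat_mem_box z
    refine ⟨_, hm, ?_⟩
    rw [h.flow_Y.translate h.lip_Y (fun z => h.periodic_Y z m)]
    simpa using hz
  choose x hx hxR using hbox
  obtain ⟨B, hB⟩ := isCompact_box.isBounded.exists_norm_le
  have hmem : ∀ n, (x n, φ (n + 1) (x n)) ∈
      (closedBall 0 B ×ˢ closedBall 0 (B + R) : Set ((ℝ × ℝ) × (ℝ × ℝ))) := by
    intro n
    simp only [mem_prod, mem_closedBall_zero_iff]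
    refine ⟨hB _ (hx n), ?_⟩
    have := norm_add_le (x n) (φ (n + 1) (x n) - x n)
    rw [add_sub_cancel] at this
    linarith [hB _ (hx n), hxR n]
  obtain ⟨⟨z, w⟩, -, θ, hθ, hlim⟩ :=
    ((isCompact_closedBall _ _).prod (isCompact_closedBall _ _)).tendsto_subseq hmem
  rw [nhds_prod_eq] at hlim
  have hz : Tendsto (fun n => x (θ n)) atTop (𝓝 z) := tendsto_fst.comp hlim
  have hw : Tendsto (fun n => φ ((θ n : ℝ) + 1) (x (θ n))) atTop (𝓝 w) := tendsto_snd.comp hlim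
  have hFc := h.smooth.continuous
  have hF : F z = F w := by
    refine tendsto_nhds_unique ((hFc.tendsto z).comp hz) ?_
    refine ((hFc.tendsto w).comp hw).congr fun n => ?_
    simp [h.map_flow_Y]
  obtain ⟨τ, hτ⟩ := h.exists_flow_eq hF
  have hzτ : Tendsto (fun n => φ τ (x (θ n))) atTop (𝓝 w) := by
    rw [← hτ]
    have : Continuous (φ τ) := (h.flow_Y.continuous_uncurry h.lip_Y h.bound_Y).comp
      (Continuous.prodMk_right τ)
    exact (this.tendsto z).comp hz
  obtain ⟨U, hU, hUφ⟩ := h.exists_nhds_flow_eq w one_pos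
  obtain ⟨n, ⟨h1, h2⟩, h3⟩ := (((hw.eventually hU).and (hzτ.eventually hU)).and
    (eventually_ge_atTop ⌈τ + 1⌉₊)).exists
  obtain ⟨r, hr, hreq⟩ := hUφ _ h2 _ h1 (by rw [h.map_flow_Y, h.map_flow_Y])
  have h4 : φ ((θ n : ℝ) + 1 - (r + τ)) (φ (r + τ) (x (θ n))) = φ (r + τ) (x (θ n)) := by
    rw [← h.flow_Y.map_add h.lip_Y, sub_add_cancel, ← hreq, ← h.flow_Y.map_add h.lip_Y]
  have h5 := h.flow_eq_self h4
  have h6 : (⌈τ + 1⌉₊ : ℝ) ≤ θ n := by exact_mod_cast h3.trans (hθ.id_le n)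
  have h7 := Nat.le_ceil (τ + 1)
  linarith [(abs_lt.1 hr).2]

end LevelFlow

end TorusField

namespace TorusField

open Set Metric Filter MeasureTheory

/-! ### Straightening a quasi-periodic submersion of the plane -/

/-- `H` is a diffeomorphism of the plane that commutes with the translations by lattice vectors. -/
structure IsLatticeDiffeo (H : ℝ × ℝ → ℝ × ℝ) : Prop where
  smooth : ContDiff ℝ ∞ H
  bijective : Function.Bijective H
  map_add : ∀ z m, H (z + lat m) = H z + lat m
  ker_fderiv : ∀ z v, fderiv ℝ H z v = 0 → v = 0

namespace LevelFlow

variable {F : ℝ × ℝ → ℝ} {c : ℝ × ℝ} {Y Z : ℝ × ℝ → ℝ × ℝ} {φ ψ : ℝ → ℝ × ℝ → ℝ × ℝ} {K M : NNReal}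

/-- The points of a level of `F` drift, uniformly, in a direction transverse to the period of `F`
under the flow of `Y`. -/
theorem exists_uniform_drift (h : LevelFlow F c Y Z φ ψ K M) :
    ∃ d : ℝ × ℝ, c.1 * d.2 - c.2 * d.1 ≠ 0 ∧ ∃ T δ : ℝ, 0 < T ∧ 0 < δ ∧
      ∀ z, δ ≤ dotCLM d (φ T z) - dotCLM d z := by
  have hc := sq_add_sq_pos h.period_ne_zero
  set N := c.1 * c.1 + c.2 * c.2 with hN
  obtain ⟨B, hB⟩ := exists_bound_of_periodic (f := fun z => F z - dotCLM c z)
    (h.smooth.continuous.sub (dotCLM c).continuous)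
    (fun z m => by simp only [h.quasiPeriodic, map_add, dotCLM_apply, lat_fst, lat_snd]; ring)
  -- `F` is constant on orbits and within `B` of `c·z`, so displacements satisfy |c·v| ≤ 2B. One
  -- parallel to `c` thus has norm at most `2 * B / N * ‖c‖`; a longer one must have a transverse
  -- component.
  obtain ⟨T, hT, hesc⟩ := h.exists_time_escape (2 * B / N * ‖c‖)
  set ℓ := dotCLM (-c.2, c.1) with hℓ
  have hne : ∀ z, ℓ (φ T z) - ℓ z ≠ 0 := by
    intro z h0
    refine (hesc z).not_ge ?_
    set v := φ T z - z with hv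
    have h1 : -c.2 * v.1 + c.1 * v.2 = 0 := by
      rw [← map_sub] at h0
      simpa [hℓ, hv] using h0
    have h2 : |c.1 * v.1 + c.2 * v.2| ≤ 2 * B := by
      have e : c.1 * v.1 + c.2 * v.2
          = (F z - dotCLM c z) - (F (φ T z) - dotCLM c (φ T z)) := by
        simp only [h.map_flow_Y, dotCLM_apply, hv, Prod.fst_sub, Prod.snd_sub]; ring
      rw [e]
      refine (abs_sub _ _).trans ?_
      have h3 := hB z
      have h4 := hB (φ T z)
      rw [Real.norm_eq_abs] at h3 h4
      linarith
    have h3 : v = ((c.1 * v.1 + c.2 * v.2) / N) • c := by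
      ext
      · simp only [Prod.smul_fst, smul_eq_mul]; field_simp; rw [hN]
        linear_combination (-c.2) * h1
      · simp only [Prod.smul_snd, smul_eq_mul]; field_simp; rw [hN]
        linear_combination (c.1) * h1
    rw [h3, norm_smul, Real.norm_eq_abs, abs_div, abs_of_pos hc]
    gcongr
  have hcont : Continuous fun z => ℓ (φ T z) - ℓ z := by
    have : Continuous (φ T) := (h.flow_Y.continuous_uncurry h.lip_Y h.bound_Y).comp
      (Continuous.prodMk_right T)
    fun_prop
  have hper : ∀ z m, ℓ (φ T (z + lat m)) - ℓ (z + lat m) = ℓ (φ T z) - ℓ z := by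
    intro z m
    rw [h.flow_Y.translate h.lip_Y (fun z => h.periodic_Y z m), map_add, map_add]
    ring
  -- The drift never vanishes on the connected plane, so its sign is constant; periodicity then
  -- bounds it away from zero.
  have hsign : (∀ z, 0 < ℓ (φ T z) - ℓ z) ∨ ∀ z, 0 < -(ℓ (φ T z) - ℓ z) := by
    by_contra! hcon
    obtain ⟨⟨x, hx⟩, y, hy⟩ := hcon
    obtain ⟨z, hz⟩ := intermediate_value_univ x y hcont ⟨hx, by linarith⟩
    exact hne z hz
  rcases hsign with hs | hs
  · obtain ⟨δ, hδ, hle⟩ := exists_pos_le_of_periodic hcont hper hs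
    refine ⟨(-c.2, c.1), ?_, T, δ, hT, hδ, hle⟩
    simp only; nlinarith
  · obtain ⟨δ, hδ, hle⟩ := exists_pos_le_of_periodic hcont.neg
      (fun z m => congrArg Neg.neg (hper z m)) hs
    refine ⟨(c.2, -c.1), ?_, T, δ, hT, hδ, fun z => (hle z).trans_eq ?_⟩
    · simp only; nlinarith
    · simp only [hℓ, dotCLM_apply, Pi.neg_apply]; ring

/-- Averaging a linear form along the flow of `Y`. -/
theorem exists_lipschitz_increasing (h : LevelFlow F c Y Z φ ψ K M) :
    ∃ (d : ℝ × ℝ) (G : ℝ × ℝ → ℝ) (Λ : NNReal) (δ : ℝ), c.1 * d.2 - c.2 * d.1 ≠ 0 ∧ 0 < δ ∧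
      LipschitzWith Λ G ∧ (∀ z m, G (z + lat m) = G z + dotCLM d (lat m)) ∧
      ∀ z t, 0 ≤ t → δ * t ≤ G (φ t z) - G z := by
  obtain ⟨d, hd, T, δ, hT, hδ, hle⟩ := h.exists_uniform_drift
  set L := dotCLM d with hL
  have hcont : ∀ z, Continuous fun t => L (φ t z) := fun z =>
    L.continuous.comp (h.flow_Y.continuous_left z)
  have hint : ∀ z a b, IntervalIntegrable (fun t => L (φ t z)) volume a b := fun z a b =>
    (hcont z).intervalIntegrable a b
  -- The function is G(z) = ∫₀ᵀ L(φ_t z) dt. Shifting the time window gives G(φ_t z) - G(z) = ∫₀ᵗ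
  -- (L(φ_T φ_s z) - L(φ_s z)) ds ≥ δt. Integrating the constant `d·m` over a time `T` multiplies
  -- the period by `T`, and the Lipschitz constant comes from Grönwall's bound.
  refine ⟨(T * d.1, T * d.2), fun z => ∫ t in (0 : ℝ)..T, L (φ t z),
    (‖L‖ * Real.exp (K * T) * T).toNNReal, δ, ?_, hδ, ?_, ?_, ?_⟩
  · have : c.1 * (T * d.2) - c.2 * (T * d.1) = T * (c.1 * d.2 - c.2 * d.1) := by ring
    simp only [this]
    exact mul_ne_zero hT.ne' hd
  · refine LipschitzWith.of_dist_le_mul fun z w => ?_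
    rw [dist_eq_norm, ← intervalIntegral.integral_sub (hint _ _ _) (hint _ _ _)]
    have hb : ∀ t ∈ uIoc 0 T, ‖L (φ t z) - L (φ t w)‖ ≤ ‖L‖ * (dist z w * Real.exp (K * T)) := by
      intro t ht
      rw [uIoc_of_le hT.le] at ht
      rw [← map_sub]
      refine (L.le_opNorm _).trans ?_
      rw [← dist_eq_norm]
      gcongr
      refine (h.flow_Y.dist_le_of_nonneg h.lip_Y ht.1.le z w).trans ?_
      gcongr
      exact ht.2
    refine (intervalIntegral.norm_integral_le_of_norm_le_const hb).trans_eq ?_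
    rw [sub_zero, abs_of_pos hT]
    rw [Real.coe_toNNReal _ (by positivity)]
    ring
  · intro z m
    simp only [h.flow_Y.translate h.lip_Y (fun z => h.periodic_Y z m), map_add]
    rw [intervalIntegral.integral_add (hint _ _ _) (by simp)]
    simp [hL]
    ring
  · intro z t ht
    have e1 : ∫ s in (0 : ℝ)..T, L (φ s (φ t z)) = ∫ s in t..(T + t), L (φ s z) := by
      simp only [← h.flow_Y.map_add h.lip_Y]
      rw [intervalIntegral.integral_comp_add_right (fun s => L (φ s z)), zero_add]
    have e2 : ∫ s in (0 : ℝ)..t, L (φ T (φ s z)) = ∫ s in T..(T + t), L (φ s z) := by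
      simp only [← h.flow_Y.map_add h.lip_Y]
      rw [intervalIntegral.integral_comp_add_left (fun s => L (φ s z)), add_zero]
    have e3 := intervalIntegral.integral_add_adjacent_intervals (hint z 0 t) (hint z t (T + t))
    have e4 := intervalIntegral.integral_add_adjacent_intervals (hint z 0 T) (hint z T (T + t))
    have hint' : IntervalIntegrable (fun s => L (φ T (φ s z))) volume 0 t := by
      simp only [← h.flow_Y.map_add h.lip_Y]
      exact ((hcont z).comp (continuous_const_add T)).intervalIntegrable _ _
    have e5 : ∫ s in (0 : ℝ)..t, δ ≤ ∫ s in (0 : ℝ)..t, (L (φ T (φ s z)) - L (φ s z)) :=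
      intervalIntegral.integral_mono_on ht (by simp) (hint'.sub (hint z 0 t))
        (fun s _ => hle (φ s z))
    rw [intervalIntegral.integral_sub hint' (hint z 0 t), e2] at e5
    simp only [intervalIntegral.integral_const, sub_zero, smul_eq_mul] at e5
    simp only [e1]
    linarith

/-- There is a smooth quasi-periodic function strictly increasing along the flow of `Y`. -/
theorem exists_smooth_increasing (h : LevelFlow F c Y Z φ ψ K M) :
    ∃ (d : ℝ × ℝ) (G : ℝ × ℝ → ℝ) (δ : ℝ), c.1 * d.2 - c.2 * d.1 ≠ 0 ∧ 0 < δ ∧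
      ContDiff ℝ ∞ G ∧ (∀ z m, G (z + lat m) = G z + dotCLM d (lat m)) ∧
      ∀ z, δ ≤ fderiv ℝ G z (Y z) := by
  obtain ⟨d, G, Λ, δ, hd, hδ, hLip, hper, hinc⟩ := h.exists_lipschitz_increasing
  -- The flow, hence `G`, is only known to be Lipschitz, so `G` is mollified. At radius `ε`,
  -- replacing `Y (z - w)` by `Y z` costs at most `Λ * K * ε ≤ δ / 2` in the rate of increase.
  set ε := δ / 2 / (Λ * K + 1) with hε
  have hε0 : 0 < ε := by positivity
  let b : ContDiffBump (0 : ℝ × ℝ) := ⟨ε / 2, ε, by positivity, by linarith⟩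
  set ρ := b.normed volume with hρ
  have hρc : Continuous ρ := b.continuous_normed
  have hρcs : HasCompactSupport ρ := b.hasCompactSupport_normed
  have hρ0 : ∀ w, 0 ≤ ρ w := b.nonneg_normed
  have hρ1 : ∫ w, ρ w = 1 := b.integral_normed
  have hρs : ∀ w, ρ w ≠ 0 → ‖w‖ < ε := fun w hw => by
    have : w ∈ Function.support ρ := hw
    rw [hρ, b.support_normed_eq] at this
    simpa using this
  set G' : ℝ × ℝ → ℝ := MeasureTheory.convolution ρ G (ContinuousLinearMap.lsmul ℝ ℝ) volume with hG'
  have hG's : ContDiff ℝ ∞ G' := hρcs.contDiff_convolution_left _ b.contDiff_normed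
    hLip.continuous.locallyIntegrable
  have hG'e : ∀ z, G' z = ∫ w, ρ w * G (z - w) := fun z => by
    simp [hG', MeasureTheory.convolution]
  have hi : ∀ f : ℝ × ℝ → ℝ, Continuous f → Integrable (fun w => ρ w * f w) := fun f hf =>
    (hρc.mul hf).integrable_of_hasCompactSupport hρcs.mul_right
  have hGc : ∀ z, Continuous fun w => G (z - w) := fun z =>
    hLip.continuous.comp (continuous_const.sub continuous_id)
  refine ⟨d, G', δ / 2, hd, by positivity, hG's, fun z m => ?_, fun z => ?_⟩
  · rw [hG'e, hG'e]
    have : ∀ w, ρ w * G (z + lat m - w) = ρ w * G (z - w) + ρ w * dotCLM d (lat m) := fun w => by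
      rw [add_sub_right_comm, hper]; ring
    simp only [this]
    rw [integral_add (hi _ (hGc z)) (hi _ continuous_const), integral_mul_const, hρ1, one_mul]
  -- The straight step `t • Y z` is compared, for each shift `w`, with the flow from `z - w`. The
  -- second-order error adds only the term `Λ * K * M * t`, which disappears as `t → 0⁺`.
  · have hquot : ∀ t : ℝ, 0 < t →
        δ / 2 - Λ * K * M * t ≤ t⁻¹ • (G' (z + t • Y z) - G' z) := by
      intro t ht
      have hpt : ∀ w, ρ w * ((δ / 2 - Λ * K * M * t) * t) ≤
          ρ w * G (z + t • Y z - w) - ρ w * G (z - w) := by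
        intro w
        by_cases hw : ρ w = 0
        · simp [hw]
        rw [← mul_sub]
        refine mul_le_mul_of_nonneg_left ?_ (hρ0 w)
        have h1 := hinc (z - w) t ht.le
        have h2 := hLip.dist_le_mul (φ t (z - w)) (z + t • Y z - w)
        have h3 : dist (φ t (z - w)) (z + t • Y z - w) ≤ K * M * t * t + t * (K * ε) := by
          rw [dist_eq_norm]
          have e : φ t (z - w) - (z + t • Y z - w) = (φ t (z - w) - (z - w) - t • Y (z - w))
              + t • (Y (z - w) - Y z) := by
            rw [smul_sub]; abel
          rw [e]
          refine (norm_add_le _ _).trans (add_le_add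
            (h.flow_Y.norm_sub_sub_smul_le h.lip_Y h.bound_Y _ ht.le) ?_)
          rw [norm_smul, Real.norm_of_nonneg ht.le, ← dist_eq_norm]
          gcongr
          refine (h.lip_Y.dist_le_mul _ _).trans ?_
          gcongr
          rw [dist_eq_norm, sub_sub_cancel_left, norm_neg]
          exact (hρs w hw).le
        have h4 : (Λ : ℝ) * K * ε ≤ δ / 2 := by
          rw [hε, mul_div_assoc', div_le_iff₀ (by positivity)]
          nlinarith
        have h5 : dist (G (φ t (z - w))) (G (z + t • Y z - w)) ≤
            Λ * (K * M * t * t + t * (K * ε)) := h2.trans (by gcongr)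
        rw [Real.dist_eq] at h5
        have h6 := (abs_le.1 h5).2
        have h7 : (Λ : ℝ) * K * ε * t ≤ δ / 2 * t := by gcongr
        nlinarith
      have hI : (δ / 2 - Λ * K * M * t) * t ≤ G' (z + t • Y z) - G' z := by
        rw [hG'e, hG'e, ← integral_sub (hi _ (hGc _)) (hi _ (hGc _))]
        have := integral_mono (hi _ continuous_const) ((hi _ (hGc _)).sub (hi _ (hGc _))) hpt
        rwa [integral_mul_const, hρ1, one_mul] at this
      rw [smul_eq_mul, inv_mul_eq_div, le_div_iff₀ ht]
      exact hI
    have hder : HasDerivAt (fun t : ℝ => G' (z + t • Y z)) (fderiv ℝ G' z (Y z)) 0 := by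
      have h1 : HasDerivAt (fun t : ℝ => z + t • Y z) (Y z) 0 := by
        simpa using ((hasDerivAt_id (0 : ℝ)).smul_const (Y z)).const_add z
      have h2 : HasFDerivAt G' (fderiv ℝ G' z) (z + (0 : ℝ) • Y z) := by
        simpa using (hG's.differentiable (by simp) z).hasFDerivAt
      exact h2.comp_hasDerivAt 0 h1
    have hlim := hder.tendsto_slope_zero_right
    simp only [zero_add, zero_smul, add_zero] at hlim
    have hlim' : Tendsto (fun t : ℝ => δ / 2 - Λ * K * M * t) (𝓝[>] 0) (𝓝 (δ / 2)) := by
      have : Continuous fun t : ℝ => δ / 2 - Λ * K * M * t := by fun_prop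
      simpa using (this.tendsto 0).mono_left nhdsWithin_le_nhds
    refine le_of_tendsto_of_tendsto hlim' hlim ?_
    filter_upwards [self_mem_nhdsWithin] with t ht using hquot t ht

/-- `F` labels the levels and `G` increases along each of them at rate at least `δ`, so (F, G) is a
bijection of the plane with injective differential. Cramer's rule gives `H` with c·H = F and d·H =
G; since the periods of `F` and `G` are `c·m` and `d·m`, this `H` commutes with the lattice. -/
theorem exists_isLatticeDiffeo (h : LevelFlow F c Y Z φ ψ K M) :
    ∃ H, IsLatticeDiffeo H ∧ ∀ z, F z = dotCLM c (H z) := by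
  obtain ⟨d, G, δ, hd, hδ, hGs, hGper, hGY⟩ := h.exists_smooth_increasing
  set D := c.1 * d.2 - c.2 * d.1 with hD
  have hGd : Differentiable ℝ G := hGs.differentiable (by simp)
  set H : ℝ × ℝ → ℝ × ℝ := fun z => ((F z * d.2 - c.2 * G z) / D, (c.1 * G z - d.1 * F z) / D)
    with hH
  have hFH : ∀ z, F z = dotCLM c (H z) := fun z => by
    simp only [hH, dotCLM_apply]; field_simp; rw [hD]; ring
  have hGH : ∀ z, G z = dotCLM d (H z) := fun z => by
    simp only [hH, dotCLM_apply]; field_simp; rw [hD]; ring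
  have hHs : ContDiff ℝ ∞ H := by
    have := h.smooth
    fun_prop
  have hgrow : ∀ z s t, s ≤ t → δ * (t - s) ≤ G (φ t z) - G (φ s z) := by
    intro z s t hst
    have hd' : ∀ r, HasDerivAt (fun r => G (φ r z)) (fderiv ℝ G (φ r z) (Y (φ r z))) r := fun r =>
      (hGd _).hasFDerivAt.comp_hasDerivAt r (h.flow_Y.hasDerivAt z r)
    exact mul_sub_le_image_sub_of_le_deriv (f := fun r => G (φ r z))
      (fun r => (hd' r).differentiableAt) (fun r => by rw [(hd' r).deriv]; exact hGY _) hst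
  refine ⟨H, ⟨hHs, ⟨?_, ?_⟩, ?_, ?_⟩, hFH⟩
  · intro z w hzw
    have hF : F z = F w := by rw [hFH, hFH, hzw]
    have hG : G z = G w := by rw [hGH, hGH, hzw]
    obtain ⟨t, rfl⟩ := h.exists_flow_eq hF
    rcases le_total 0 t with ht | ht
    · have := hgrow z 0 t ht
      rw [h.flow_Y.map_zero, ← hG] at this
      have : t = 0 := le_antisymm (by nlinarith) ht
      rw [this, h.flow_Y.map_zero]
    · have := hgrow z t 0 ht
      rw [h.flow_Y.map_zero, ← hG] at this
      have : t = 0 := le_antisymm ht (by nlinarith)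
      rw [this, h.flow_Y.map_zero]
  · intro p
    set z := ψ (dotCLM c p - F 0) 0 with hz
    have hFz : F z = dotCLM c p := by rw [hz, h.map_flow_Z]; ring
    -- Within this time, forwards or backwards, `G` is sure to pass the target value.
    set R := |dotCLM d p - G z| / δ with hR
    have hR0 : 0 ≤ R := by positivity
    have g1 := hgrow z 0 R hR0
    have g2 := hgrow z (-R) 0 (by linarith)
    have hRδ : δ * R = |dotCLM d p - G z| := by rw [hR]; field_simp
    rw [h.flow_Y.map_zero, sub_zero, hRδ] at g1
    rw [h.flow_Y.map_zero, sub_neg_eq_add, zero_add, hRδ] at g2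
    have i1 := le_abs_self (dotCLM d p - G z)
    have i2 := neg_abs_le (dotCLM d p - G z)
    obtain ⟨t, -, ht⟩ := intermediate_value_Icc (f := fun r => G (φ r z)) (by linarith : -R ≤ R)
      (hGs.continuous.comp (h.flow_Y.continuous_left z)).continuousOn
      (show dotCLM d p ∈ Icc (G (φ (-R) z)) (G (φ R z)) from ⟨by linarith, by linarith⟩)
    refine ⟨φ t z, ?_⟩
    simp only at ht
    simp only [hH, ht, h.map_flow_Y, hFz, dotCLM_apply]
    ext
    · simp only; field_simp; rw [hD]; ring
    · simp only; field_simp; rw [hD]; ring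
  · intro z m
    simp only [hH, h.quasiPeriodic, hGper, dotCLM_apply, lat_fst, lat_snd]
    ext
    · simp only [Prod.fst_add, lat_fst]; field_simp; rw [hD]; ring
    · simp only [Prod.snd_add, lat_snd]; field_simp; rw [hD]; ring
  · intro z v hv
    have hHd := (hHs.differentiable (by simp) z).hasFDerivAt
    have hL : ∀ L : ℝ × ℝ →L[ℝ] ℝ, fderiv ℝ (fun z => L (H z)) z = L.comp (fderiv ℝ H z) :=
      fun L => (L.hasFDerivAt.comp z hHd).fderiv
    have h1 : fderiv ℝ F z v = 0 := by
      rw [show F = fun z => dotCLM c (H z) from funext hFH,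
        hL, ContinuousLinearMap.comp_apply, hv, map_zero]
    have h2 : fderiv ℝ G z v = 0 := by
      rw [show G = fun z => dotCLM d (H z) from funext hGH,
        hL, ContinuousLinearMap.comp_apply, hv, map_zero]
    have h3 := det_eq_zero_of_ker (h.fderiv_ne_zero z) h1 (h.map_Y z)
    have hpos : fderiv ℝ G z (Y z) ≠ 0 := (hδ.trans_le (hGY z)).ne'
    have h4 : v.1 • Y z = (Y z).1 • v := by
      ext <;> simp only [Prod.smul_fst, Prod.smul_snd, smul_eq_mul] <;> linarith
    have h5 : v.2 • Y z = (Y z).2 • v := by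
      ext <;> simp only [Prod.smul_fst, Prod.smul_snd, smul_eq_mul] <;> linarith
    have h6 := congrArg (fderiv ℝ G z) h4
    have h7 := congrArg (fderiv ℝ G z) h5
    rw [map_smul, map_smul, h2, smul_zero, smul_eq_mul] at h6 h7
    exact Prod.ext ((mul_eq_zero.1 h6).resolve_right hpos) ((mul_eq_zero.1 h7).resolve_right hpos)

end LevelFlow

/-- `Y` is the gradient of `F` turned by a right angle, and `Z` is the gradient divided by its
squared length. Periodicity makes both bounded and Lipschitz, so their flows are global. -/
theorem exists_levelFlow {F : ℝ × ℝ → ℝ} (hF : ContDiff ℝ ∞ F) {c : ℝ × ℝ}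
    (hper : ∀ z (m : ℤ × ℤ), F (z + lat m) = F z + (c.1 * m.1 + c.2 * m.2))
    (hne : ∀ z, fderiv ℝ F z ≠ 0) : ∃ Y Z φ ψ K M, LevelFlow F c Y Z φ ψ K M := by
  set A : ℝ × ℝ → ℝ := fun z => fderiv ℝ F z (1, 0) with hA
  set B : ℝ × ℝ → ℝ := fun z => fderiv ℝ F z (0, 1) with hB
  have hF' : ContDiff ℝ ∞ (fderiv ℝ F) := hF.fderiv_right (by simp)
  have hAs : ContDiff ℝ ∞ A := hF'.clm_apply contDiff_const
  have hBs : ContDiff ℝ ∞ B := hF'.clm_apply contDiff_const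
  have hF'per : ∀ z m, fderiv ℝ F (z + lat m) = fderiv ℝ F z := fun z m =>
    fderiv_periodic (fun z => hper z m) z
  have hN : ∀ z, 0 < A z * A z + B z * B z := by
    intro z
    refine sq_add_sq_pos (v := (A z, B z)) fun h0 => hne z ?_
    rw [Prod.mk_eq_zero] at h0
    ext
    · simpa using h0.1
    · simpa using h0.2
  set Y : ℝ × ℝ → ℝ × ℝ := fun z => (-B z, A z) with hY
  set Z : ℝ × ℝ → ℝ × ℝ := fun z => (A z * A z + B z * B z)⁻¹ • (A z, B z) with hZ
  have hYs : ContDiff ℝ ∞ Y := by fun_prop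
  have hZs : ContDiff ℝ ∞ Z := by
    refine ContDiff.smul (ContDiff.inv (by fun_prop) fun z => (hN z).ne') (by fun_prop)
  have hYper : ∀ z m, Y (z + lat m) = Y z := fun z m => by simp [hY, hA, hB, hF'per]
  have hZper : ∀ z m, Z (z + lat m) = Z z := fun z m => by simp [hZ, hA, hB, hF'per]
  obtain ⟨K₁, hK₁⟩ := exists_lipschitzWith_of_periodic (hYs.of_le (by simp)) hYper
  obtain ⟨K₂, hK₂⟩ := exists_lipschitzWith_of_periodic (hZs.of_le (by simp)) hZper
  obtain ⟨M₁, hM₁⟩ := exists_bound_of_periodic hYs.continuous hYper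
  obtain ⟨M₂, hM₂⟩ := exists_bound_of_periodic hZs.continuous hZper
  obtain ⟨φ, hφ⟩ := exists_isFlow hK₁ hM₁
  obtain ⟨ψ, hψ⟩ := exists_isFlow hK₂ hM₂
  refine ⟨Y, Z, φ, ψ, max K₁ K₂, max M₁ M₂, hF, hper, fun z => ?_, fun z => ?_, fun z h0 => ?_,
    hK₁.weaken (le_max_left _ _), hK₂.weaken (le_max_right _ _),
    fun z => (hM₁ z).trans (by simp), fun z => (hM₂ z).trans (by simp), hYper, hφ, hψ⟩
  · rw [clm_prod_apply]
    simp only [hY, smul_eq_mul]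
    change -B z * A z + A z * B z = 0
    ring
  · rw [hZ, map_smul, clm_prod_apply]
    simp only [smul_eq_mul]
    exact inv_mul_cancel₀ (hN z).ne'
  · have := hN z
    simp only [hY, Prod.mk_eq_zero, neg_eq_zero] at h0
    simp [h0.1, h0.2] at this

/-- A submersion of the plane with periodic differential is linear in suitable coordinates that
commute with the lattice translations. -/
theorem exists_isLatticeDiffeo_of_submersion {F : ℝ × ℝ → ℝ} (hF : ContDiff ℝ ∞ F) {c : ℝ × ℝ}
    (hper : ∀ z (m : ℤ × ℤ), F (z + lat m) = F z + (c.1 * m.1 + c.2 * m.2))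
    (hne : ∀ z, fderiv ℝ F z ≠ 0) :
    c ≠ 0 ∧ ∃ H, IsLatticeDiffeo H ∧ ∀ z, F z = dotCLM c (H z) := by
  obtain ⟨Y, Z, φ, ψ, K, M, h⟩ := exists_levelFlow hF hper hne
  exact ⟨h.period_ne_zero, h.exists_isLatticeDiffeo⟩

end TorusField

namespace TorusField

open Set Metric Filter MeasureTheory

/-! ### Fourier series of smooth periodic functions on the plane -/

/-- The phase `2π ⟨k, z⟩` of the character `k`, as a linear form. -/
def phase (k : ℤ × ℤ) : ℝ × ℝ →L[ℝ] ℝ := (2 * Real.pi) • dotCLM (lat k)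

theorem phase_apply (k : ℤ × ℤ) (z : ℝ × ℝ) :
    phase k z = 2 * Real.pi * (k.1 * z.1 + k.2 * z.2) := by
  simp [phase]

/-- The character `z ↦ exp (2πi ⟨k, z⟩)`. -/
def char (k : ℤ × ℤ) (z : ℝ × ℝ) : ℂ := Complex.exp (Complex.I * (phase k z : ℂ))

theorem norm_char (k : ℤ × ℤ) (z : ℝ × ℝ) : ‖char k z‖ = 1 := by
  rw [char, mul_comm]; exact Complex.norm_exp_ofReal_mul_I _

theorem char_periodic (k : ℤ × ℤ) (z : ℝ × ℝ) (m : ℤ × ℤ) : char k (z + lat m) = char k z := by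
  rw [char, char, map_add, phase_apply k (lat m), Complex.exp_eq_exp_iff_exists_int]
  exact ⟨k.1 * m.1 + k.2 * m.2, by push_cast [lat_fst, lat_snd]; ring⟩

theorem hasFDerivAt_char (k : ℤ × ℤ) (z : ℝ × ℝ) :
    HasFDerivAt (char k) ((phase k).smulRight (Complex.I * char k z)) z := by
  have h1 : HasDerivAt (fun t : ℝ => Complex.exp (Complex.I * (t : ℂ)))
      (Complex.exp (Complex.I * (phase k z : ℂ)) * (Complex.I * 1)) (phase k z) :=
    ((Complex.ofRealCLM.hasDerivAt (x := phase k z)).const_mul Complex.I).cexp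
  have h2 := h1.hasFDerivAt.comp z (phase k).hasFDerivAt
  refine h2.congr_fderiv ?_
  ext <;> simp [char, mul_comm, mul_left_comm]

theorem contDiff_char (k : ℤ × ℤ) : ContDiff ℝ ∞ (char k) := by
  unfold char
  exact (contDiff_const.mul (Complex.ofRealCLM.contDiff.comp (phase k).contDiff)).cexp

/-- A weight on the lattice controlling all polynomial growth. -/
def wt (k : ℤ × ℤ) : ℝ := (1 + (k.1 : ℝ) ^ 2) * (1 + (k.2 : ℝ) ^ 2)

theorem one_le_wt (k : ℤ × ℤ) : 1 ≤ wt k := by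
  unfold wt
  nlinarith [sq_nonneg (k.1 : ℝ), sq_nonneg (k.2 : ℝ),
    mul_nonneg (sq_nonneg (k.1 : ℝ)) (sq_nonneg (k.2 : ℝ))]

theorem sq_add_sq_le_wt (k : ℤ × ℤ) : 1 + (k.1 : ℝ) ^ 2 + (k.2 : ℝ) ^ 2 ≤ wt k := by
  unfold wt
  nlinarith [mul_nonneg (sq_nonneg (k.1 : ℝ)) (sq_nonneg (k.2 : ℝ))]

theorem norm_phase_le (k : ℤ × ℤ) : ‖phase k‖ ≤ 2 * Real.pi * wt k := by
  refine ContinuousLinearMap.opNorm_le_bound _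
    (by have := one_le_wt k; positivity) fun z => ?_
  have h0 := norm_add_le ((k.1 : ℝ) * z.1) ((k.2 : ℝ) * z.2)
  rw [norm_mul, norm_mul] at h0
  have h1 := norm_fst_le z
  have h2 := norm_snd_le z
  have h3 : ‖(k.1 : ℝ)‖ + ‖(k.2 : ℝ)‖ ≤ wt k := by
    refine le_trans ?_ (sq_add_sq_le_wt k)
    rw [← sq_abs (k.1 : ℝ), ← sq_abs (k.2 : ℝ), Real.norm_eq_abs, Real.norm_eq_abs]
    nlinarith [sq_nonneg (|(k.1 : ℝ)| - 1 / 2), sq_nonneg (|(k.2 : ℝ)| - 1 / 2)]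
  have h4 : ‖(k.1 : ℝ)‖ * ‖z.1‖ + ‖(k.2 : ℝ)‖ * ‖z.2‖ ≤ wt k * ‖z‖ :=
    calc ‖(k.1 : ℝ)‖ * ‖z.1‖ + ‖(k.2 : ℝ)‖ * ‖z.2‖
        ≤ ‖(k.1 : ℝ)‖ * ‖z‖ + ‖(k.2 : ℝ)‖ * ‖z‖ := by gcongr
      _ = (‖(k.1 : ℝ)‖ + ‖(k.2 : ℝ)‖) * ‖z‖ := by ring
      _ ≤ wt k * ‖z‖ := by gcongr
  rw [phase_apply, norm_mul, Real.norm_of_nonneg (by positivity), mul_assoc (2 * Real.pi)]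
  exact mul_le_mul_of_nonneg_left (h0.trans h4) (by positivity)

theorem norm_iteratedFDeriv_char_le (k : ℤ × ℤ) (n : ℕ) (z : ℝ × ℝ) :
    ‖iteratedFDeriv ℝ n (char k) z‖ ≤ (2 * Real.pi * wt k) ^ n := by
  have hf : ContDiff ℝ n fun t : ℝ => Complex.exp (Complex.I * (t : ℂ)) :=
    (contDiff_const.mul Complex.ofRealCLM.contDiff).cexp
  have hit : ∀ n : ℕ, iteratedDeriv n (fun t : ℝ => Complex.exp (Complex.I * (t : ℂ)))
      = fun t : ℝ => Complex.I ^ n * Complex.exp (Complex.I * (t : ℂ)) := by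
    intro n
    induction n with
    | zero => simp
    | succ n ih =>
      rw [iteratedDeriv_succ, ih]
      ext t
      have h1 : HasDerivAt (fun t : ℝ => Complex.exp (Complex.I * (t : ℂ)))
          (Complex.exp (Complex.I * (t : ℂ)) * (Complex.I * 1)) t :=
        ((Complex.ofRealCLM.hasDerivAt (x := t)).const_mul Complex.I).cexp
      rw [(h1.const_mul _).deriv]
      ring
  have heq : char k = (fun t : ℝ => Complex.exp (Complex.I * (t : ℂ))) ∘ phase k := rfl
  rw [heq, (phase k).iteratedFDeriv_comp_right hf z le_rfl]
  refine (ContinuousMultilinearMap.norm_compContinuousLinearMap_le _ _).trans ?_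
  rw [norm_iteratedFDeriv_eq_norm_iteratedDeriv, hit]
  have : ‖Complex.exp (Complex.I * ((phase k z : ℝ) : ℂ))‖ = 1 := norm_char k z
  simp only [norm_mul, norm_pow, Complex.norm_I, one_pow, this, one_mul, Finset.prod_const,
    Finset.card_univ, Fintype.card_fin]
  gcongr
  exact norm_phase_le k

theorem summable_wt_inv : Summable fun k : ℤ × ℤ => (wt k)⁻¹ := by
  have h1 : Summable fun n : ℤ => (1 + (n : ℝ) ^ 2)⁻¹ := by
    refine Summable.of_norm_bounded_eventually
      (Real.summable_one_div_int_pow.2 (one_lt_two : 1 < 2)) ?_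
    filter_upwards [(finite_singleton (0 : ℤ)).compl_mem_cofinite] with n hn
    have hn' : (0 : ℝ) < (n : ℝ) ^ 2 := by
      have : (n : ℝ) ≠ 0 := by exact_mod_cast hn
      positivity
    rw [Real.norm_of_nonneg (by positivity), one_div]
    gcongr
    linarith
  have h2 := h1.mul_of_nonneg h1 (fun _ => by positivity) (fun _ => by positivity)
  refine h2.congr fun k => ?_
  rw [wt, mul_inv]

/-- Trigonometric series with rapidly decreasing coefficients are smooth. -/
theorem contDiff_tsum_char {a : ℤ × ℤ → ℂ}
    (ha : ∀ N : ℕ, ∃ C : ℝ, ∀ k, wt k ^ N * ‖a k‖ ≤ C) :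
    ContDiff ℝ ∞ fun z => ∑' k, a k * char k z := by
  refine contDiff_tsum (v := fun n k => ‖a k‖ * (2 * Real.pi * wt k) ^ n)
    (fun k => contDiff_const.mul (contDiff_char k)) (fun n _ => ?_) (fun n k z _ => ?_)
  -- The `n`-th derivatives cost `wt k ^ n`; one further power buys summability.
  · obtain ⟨C, hC⟩ := ha (n + 1)
    refine Summable.of_norm_bounded (summable_wt_inv.mul_left ((2 * Real.pi) ^ n * C)) fun k => ?_
    have hw : 0 < wt k := zero_lt_one.trans_le (one_le_wt k)
    rw [Real.norm_of_nonneg (by positivity), mul_pow, mul_assoc, ← div_eq_mul_inv,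
      mul_left_comm]
    gcongr
    rw [le_div_iff₀ hw]
    refine le_trans (le_of_eq ?_) (hC k)
    ring
  · have h1 : (fun z => a k * char k z) = fun z => a k • char k z := rfl
    rw [h1, iteratedFDeriv_const_smul_apply'
      ((contDiff_char k).of_le (by exact_mod_cast le_top)).contDiffAt, norm_smul]
    gcongr
    exact norm_iteratedFDeriv_char_le k n z

/-! ### Fourier coefficients and their decay. -/

/-- The unit square. -/
def unitSquare : Set (ℝ × ℝ) := Ioc 0 1 ×ˢ Ioc 0 1

theorem volume_restrict_unitSquare : (volume.restrict unitSquare : Measure (ℝ × ℝ)) =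
    (volume.restrict (Ioc (0 : ℝ) 1)).prod (volume.restrict (Ioc (0 : ℝ) 1)) := by
  rw [Measure.prod_restrict]; rfl

theorem integrableOn_unitSquare {E : Type*} [NormedAddCommGroup E] {f : ℝ × ℝ → E}
    (hf : Continuous f) : IntegrableOn f unitSquare :=
  (hf.continuousOn.integrableOn_compact isCompact_box).mono_set
    (prod_mono Ioc_subset_Icc_self Ioc_subset_Icc_self)

theorem volume_real_unitSquare : (volume : Measure (ℝ × ℝ)).real unitSquare = 1 := by
  simp [unitSquare, Measure.real, Measure.volume_eq_prod, Measure.prod_prod]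

/-- The partial derivatives of a periodic function have mean zero. -/
theorem integral_fderiv_periodic {u : ℝ × ℝ → ℂ} (hu : ContDiff ℝ 1 u)
    (hper : ∀ z m, u (z + lat m) = u z) :
    ∫ z in unitSquare, fderiv ℝ u z (1, 0) = 0 ∧ ∫ z in unitSquare, fderiv ℝ u z (0, 1) = 0 := by
  have hd := hu.differentiable one_ne_zero
  have hc : ∀ v, Continuous fun z => fderiv ℝ u z v := fun v =>
    (hu.continuous_fderiv one_ne_zero).clm_apply continuous_const
  have hi : ∀ v, Integrable (fun z => fderiv ℝ u z v)
      ((volume.restrict (Ioc (0 : ℝ) 1)).prod (volume.restrict (Ioc (0 : ℝ) 1))) := fun v => by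
    rw [← volume_restrict_unitSquare]; exact integrableOn_unitSquare (hc v)
  rw [volume_restrict_unitSquare, integral_prod_symm _ (hi _), integral_prod _ (hi _)]
  constructor
  · refine (integral_congr_ae (.of_forall fun y => ?_)).trans (integral_zero _ _)
    have hder : ∀ x, HasDerivAt (fun x => u (x, y)) (fderiv ℝ u (x, y) (1, 0)) x := fun x =>
      (hd (x, y)).hasFDerivAt.comp_hasDerivAt x ((hasDerivAt_id x).prodMk (hasDerivAt_const x y))
    rw [← intervalIntegral.integral_of_le zero_le_one,
      intervalIntegral.integral_eq_sub_of_hasDerivAt (fun x _ => hder x)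
        (((hc _).comp (Continuous.prodMk_left y)).intervalIntegrable _ _), sub_eq_zero]
    have e : ((0, y) : ℝ × ℝ) + lat (1, 0) = (1, y) := by ext <;> simp
    rw [← e, hper]
  · refine (integral_congr_ae (.of_forall fun x => ?_)).trans (integral_zero _ _)
    have hder : ∀ y, HasDerivAt (fun y => u (x, y)) (fderiv ℝ u (x, y) (0, 1)) y := fun y =>
      (hd (x, y)).hasFDerivAt.comp_hasDerivAt y ((hasDerivAt_const y x).prodMk (hasDerivAt_id y))
    rw [← intervalIntegral.integral_of_le zero_le_one,
      intervalIntegral.integral_eq_sub_of_hasDerivAt (fun y _ => hder y)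
        (((hc _).comp (Continuous.prodMk_right x)).intervalIntegrable _ _), sub_eq_zero]
    have e : ((x, 0) : ℝ × ℝ) + lat (0, 1) = (x, 1) := by ext <;> simp
    rw [← e, hper]

/-- The Fourier coefficients of a periodic function. -/
def coef (h : ℝ × ℝ → ℂ) (k : ℤ × ℤ) : ℂ := ∫ z in unitSquare, char (-k) z * h z

theorem norm_coef_le {h : ℝ × ℝ → ℂ} {C : ℝ} (hC : ∀ z, ‖h z‖ ≤ C) (k : ℤ × ℤ) :
    ‖coef h k‖ ≤ C := by
  have := norm_setIntegral_le_of_norm_le_const (μ := volume) (s := unitSquare) (C := C)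
    (f := fun z => char (-k) z * h z)
    (by simp [unitSquare, Measure.volume_eq_prod, Measure.prod_prod])
    (fun z _ => by rw [norm_mul, norm_char, one_mul]; exact hC z)
  rwa [volume_real_unitSquare, mul_one] at this

/-- Integration by parts: the derivatives of `char (-k) * h` have mean zero, by periodicity. -/
theorem coef_fderiv {h : ℝ × ℝ → ℂ} (hh : ContDiff ℝ 1 h) (hper : ∀ z m, h (z + lat m) = h z)
    (k : ℤ × ℤ) :
    coef (fun z => fderiv ℝ h z (1, 0)) k = 2 * Real.pi * Complex.I * k.1 * coef h k ∧
    coef (fun z => fderiv ℝ h z (0, 1)) k = 2 * Real.pi * Complex.I * k.2 * coef h k := by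
  have hu : ContDiff ℝ 1 fun z => char (-k) z * h z :=
    ((contDiff_char _).of_le (by simp)).mul hh
  obtain ⟨h1, h2⟩ := integral_fderiv_periodic hu (fun z m => by rw [char_periodic, hper])
  have hder : ∀ z v, fderiv ℝ (fun z => char (-k) z * h z) z v =
      char (-k) z * fderiv ℝ h z v - (Complex.I * phase k v) * (char (-k) z * h z) := by
    intro z v
    rw [((hasFDerivAt_char (-k) z).fun_mul (hh.differentiable one_ne_zero z).hasFDerivAt).fderiv]
    have : phase (-k) v = -phase k v := by
      simp only [phase_apply, Prod.fst_neg, Prod.snd_neg]; push_cast; ring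
    simp [this]
    ring
  have hc1 : ∀ v, Continuous fun z => char (-k) z * fderiv ℝ h z v := fun v =>
    (contDiff_char _).continuous.mul
      ((hh.continuous_fderiv one_ne_zero).clm_apply continuous_const)
  have hc2 : ∀ v, Continuous fun z => (Complex.I * phase k v) * (char (-k) z * h z) := fun v =>
    continuous_const.mul ((contDiff_char _).continuous.mul hh.continuous)
  simp only [hder] at h1 h2
  rw [integral_sub (integrableOn_unitSquare (hc1 _)) (integrableOn_unitSquare (hc2 _)),
    integral_const_mul, sub_eq_zero] at h1 h2
  refine ⟨h1.trans ?_, h2.trans ?_⟩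
  · rw [phase_apply, ← coef]; push_cast; ring
  · rw [phase_apply, ← coef]; push_cast; ring

/-- The operator (1 - ∂ₓ²/4π²)(1 - ∂ᵧ²/4π²) acts on the `k`-th coefficient as multiplication by `wt
k`; the product form of the weight is chosen for this. -/
theorem exists_coef_weight {h : ℝ × ℝ → ℂ} (hh : ContDiff ℝ ∞ h)
    (hper : ∀ z m, h (z + lat m) = h z) :
    ∃ h' : ℝ × ℝ → ℂ, ContDiff ℝ ∞ h' ∧ (∀ z m, h' (z + lat m) = h' z) ∧
      ∀ k, coef h' k = wt k * coef h k := by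
  have key : ∀ v ∈ ({(1, 0), (0, 1)} : Set (ℝ × ℝ)), ∀ h : ℝ × ℝ → ℂ, ContDiff ℝ ∞ h →
      (∀ z m, h (z + lat m) = h z) → ∃ h' : ℝ × ℝ → ℂ, ContDiff ℝ ∞ h' ∧
      (∀ z m, h' (z + lat m) = h' z) ∧
      ∀ k, coef h' k = (1 + (v.1 * k.1 + v.2 * k.2) ^ 2) * coef h k := by
    intro v hv h hh hper
    have hds : ∀ f : ℝ × ℝ → ℂ, ContDiff ℝ ∞ f → ContDiff ℝ ∞ fun z => fderiv ℝ f z v :=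
      fun f hf => (hf.fderiv_right (by simp)).clm_apply contDiff_const
    have hdp : ∀ f : ℝ × ℝ → ℂ, (∀ z m, f (z + lat m) = f z) →
        ∀ z m, fderiv ℝ f (z + lat m) v = fderiv ℝ f z v := fun f hf z m => by
      rw [fderiv_periodic (v := 0) (fun z => by rw [hf, add_zero])]
    have hco : ∀ f : ℝ × ℝ → ℂ, ContDiff ℝ ∞ f → (∀ z m, f (z + lat m) = f z) →
        ∀ k : ℤ × ℤ, coef (fun z => fderiv ℝ f z v) k =
          2 * Real.pi * Complex.I * (v.1 * k.1 + v.2 * k.2) * coef f k := by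
      intro f hf hfp k
      have := coef_fderiv (hf.of_le (by simp)) hfp k
      rcases hv with rfl | rfl
      · simpa using this.1
      · simpa using this.2
    set d1 := fun z => fderiv ℝ h z v with hd1
    set d2 := fun z => fderiv ℝ d1 z v with hd2
    have s2 : ContDiff ℝ ∞ d2 := hds _ (hds _ hh)
    refine ⟨fun z => h z - (4 * Real.pi ^ 2 : ℂ)⁻¹ * d2 z, hh.sub (contDiff_const.mul s2),
      fun z m => ?_, fun k => ?_⟩
    · have := hdp d1 (hdp h hper) z m
      simp only [hper, d2, this]
    · have e : coef (fun z => h z - (4 * Real.pi ^ 2 : ℂ)⁻¹ * d2 z) k =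
          coef h k - (4 * Real.pi ^ 2 : ℂ)⁻¹ * coef d2 k := by
        have i1 : IntegrableOn (fun z => char (-k) z * h z) unitSquare :=
          integrableOn_unitSquare ((contDiff_char _).continuous.mul hh.continuous)
        have i2 : IntegrableOn (fun z => (4 * Real.pi ^ 2 : ℂ)⁻¹ * (char (-k) z * d2 z))
            unitSquare := integrableOn_unitSquare
          (continuous_const.mul ((contDiff_char _).continuous.mul s2.continuous))
        rw [coef, coef, coef, ← integral_const_mul, ← integral_sub i1 i2]
        congr 1
        ext z
        ring
      have hpi : (Real.pi : ℂ) ≠ 0 := by exact_mod_cast Real.pi_ne_zero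
      rw [e, hco d1 (hds _ hh) (hdp _ hper), hco h hh hper]
      field_simp
      linear_combination (-4 * (v.1 * k.1 + v.2 * k.2) ^ 2 * coef h k) * Complex.I_sq
  obtain ⟨h₁, s₁, p₁, c₁⟩ := key (1, 0) (by simp) h hh hper
  obtain ⟨h₂, s₂, p₂, c₂⟩ := key (0, 1) (by simp) h₁ s₁ p₁
  refine ⟨h₂, s₂, p₂, fun k => ?_⟩
  rw [c₂, c₁, wt]
  push_cast
  ring

theorem coef_rapidly_decreasing {h : ℝ × ℝ → ℂ} (hh : ContDiff ℝ ∞ h)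
    (hper : ∀ z m, h (z + lat m) = h z) (N : ℕ) : ∃ C : ℝ, ∀ k, wt k ^ N * ‖coef h k‖ ≤ C := by
  induction N generalizing h with
  | zero =>
    obtain ⟨C, hC⟩ := exists_bound_of_periodic hh.continuous hper
    exact ⟨C, fun k => by simpa using norm_coef_le hC k⟩
  | succ N ih =>
    obtain ⟨h', s, p, c⟩ := exists_coef_weight hh hper
    obtain ⟨C, hC⟩ := ih s p
    refine ⟨C, fun k => ?_⟩
    have := hC k
    rw [c, norm_mul, Complex.norm_real, Real.norm_of_nonneg (zero_le_one.trans (one_le_wt k)),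
      ← mul_assoc, ← pow_succ] at this
    exact this

theorem summable_of_rapidly_decreasing {a : ℤ × ℤ → ℂ}
    (ha : ∀ N : ℕ, ∃ C : ℝ, ∀ k, wt k ^ N * ‖a k‖ ≤ C) : Summable a := by
  obtain ⟨C, hC⟩ := ha 1
  refine Summable.of_norm_bounded (summable_wt_inv.mul_left C) fun k => ?_
  have hw : 0 < wt k := zero_lt_one.trans_le (one_le_wt k)
  rw [← div_eq_mul_inv, le_div_iff₀ hw, mul_comm]
  simpa using hC k

theorem mFourier_eq_char (n : Fin 2 → ℤ) (x : Fin 2 → ℝ) :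
    UnitAddTorus.mFourier n (fun i => (x i : UnitAddCircle)) = char (n 0, n 1) (x 0, x 1) := by
  simp only [UnitAddTorus.mFourier, ContinuousMap.coe_mk, Fin.prod_univ_two, fourier_coe_apply,
    char, phase_apply, ← Complex.exp_add]
  congr 1
  push_cast
  ring

/-- A smooth periodic function is the sum of its Fourier series. -/
theorem hasSum_coef_char {h : ℝ × ℝ → ℂ} (hh : ContDiff ℝ ∞ h)
    (hper : ∀ z m, h (z + lat m) = h z) (z : ℝ × ℝ) :
    HasSum (fun k => coef h k * char k z) (h z) := by
  -- The representative `r` in [0, 1) is not continuous; `f₀` is, because its pullback along the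
  -- open quotient map from the plane is `h`.
  let r : UnitAddCircle → ℝ := fun t => (AddCircle.equivIco 1 0 t : ℝ)
  let f₀ : UnitAddTorus (Fin 2) → ℂ := fun t => h (r (t 0), r (t 1))
  have hf₀ : ∀ x : Fin 2 → ℝ, f₀ (fun i => (x i : UnitAddCircle)) = h (x 0, x 1) := by
    intro x
    have : ∀ y : ℝ, ∃ n : ℤ, r (y : UnitAddCircle) = y + n := fun y => by
      refine ⟨-⌊y⌋, ?_⟩
      have := AddCircle.coe_equivIco_mk_apply (p := (1 : ℝ)) y
      rw [div_one, mul_one, Int.fract] at this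
      push_cast
      rw [← sub_eq_add_neg]
      exact this
    obtain ⟨n₀, h₀⟩ := this (x 0)
    obtain ⟨n₁, h₁⟩ := this (x 1)
    simp only [f₀, h₀, h₁]
    exact hper (x 0, x 1) (n₀, n₁)
  have hq : IsOpenQuotientMap
      (Pi.map (fun (_ : Fin 2) (y : ℝ) => (y : UnitAddCircle))) :=
    IsOpenQuotientMap.piMap fun _ => QuotientAddGroup.isOpenQuotientMap_mk
  have hcont : Continuous f₀ := by
    rw [hq.isQuotientMap.continuous_iff]
    have : f₀ ∘ Pi.map (fun (_ : Fin 2) (y : ℝ) => (y : UnitAddCircle)) =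
        fun x : Fin 2 → ℝ => h (x 0, x 1) := funext hf₀
    rw [this]
    exact hh.continuous.comp (by fun_prop)
  let f : C(UnitAddTorus (Fin 2), ℂ) := ⟨f₀, hcont⟩
  have hf : ∀ x : Fin 2 → ℝ, f (fun i => (x i : UnitAddCircle)) = h (x 0, x 1) := hf₀
  have hcoef : ∀ n, UnitAddTorus.mFourierCoeff f n = coef h (n 0, n 1) := by
    intro n
    rw [UnitAddTorus.mFourierCoeff_eq_integral f n 0, coef,
      ← (volume_preserving_finTwoArrow ℝ).setIntegral_preimage_emb
        (MeasurableEquiv.finTwoArrow).measurableEmbedding]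
    have hset : {x : Fin 2 → ℝ | ∀ i, x i ∈ Ioc ((0 : Fin 2 → ℝ) i) ((0 : Fin 2 → ℝ) i + 1)} =
        MeasurableEquiv.finTwoArrow ⁻¹' unitSquare := by
      ext x
      simp [unitSquare, Fin.forall_fin_two, MeasurableEquiv.finTwoArrow]
    rw [hset]
    refine integral_congr_ae (.of_forall fun x => ?_)
    simp only [smul_eq_mul, mFourier_eq_char, hf]
    rfl
  have hs : Summable (UnitAddTorus.mFourierCoeff f) := by
    have := summable_of_rapidly_decreasing (coef_rapidly_decreasing hh hper)
    rw [← (finTwoArrowEquiv ℤ).summable_iff] at this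
    exact this.congr fun n => (hcoef n).symm
  have := UnitAddTorus.hasSum_mFourier_series_apply_of_summable hs
    (fun i => ((![z.1, z.2] i : ℝ) : UnitAddCircle))
  rw [← (finTwoArrowEquiv ℤ).hasSum_iff]
  simp only [mFourier_eq_char, hcoef, hf] at this
  exact this


/-! ### The cohomological equation over a Diophantine direction -/

/-- For `k ≠ 0` the norm of `k` lies between 1 and `wt k`, so the exponent `τ` may be rounded up to
a natural number. -/
theorem exists_small_divisor_bound {e : ℝ × ℝ} (he : IsDiophantine e.1 e.2) :
    ∃ (C : ℝ) (N : ℕ), 0 < C ∧ ∀ k : ℤ × ℤ, k ≠ 0 → 1 ≤ C * wt k ^ N * |e.1 * k.1 + e.2 * k.2| := by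
  obtain ⟨γ, hγ, τ, hτ, h⟩ := he
  refine ⟨γ⁻¹, ⌈τ⌉₊, inv_pos.2 hγ, fun k hk => ?_⟩
  have h1 := h k.1 k.2 hk
  set s := Real.sqrt ((k.1 : ℝ) ^ 2 + (k.2 : ℝ) ^ 2) with hs
  have hk1 : (1 : ℝ) ≤ (k.1 : ℝ) ^ 2 + (k.2 : ℝ) ^ 2 := by
    have : 0 < k.1 ^ 2 + k.2 ^ 2 := by
      by_contra! hcon
      have h1 : k.1 = 0 := by nlinarith [sq_nonneg k.1, sq_nonneg k.2]
      have h2 : k.2 = 0 := by nlinarith [sq_nonneg k.1, sq_nonneg k.2]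
      exact hk (Prod.ext h1 h2)
    exact_mod_cast this
  have hs1 : 1 ≤ s := Real.one_le_sqrt.2 hk1
  have hsw : s ≤ wt k := by
    have : s ≤ s ^ 2 := by nlinarith
    rw [hs, Real.sq_sqrt (by linarith)] at this
    rw [hs]
    linarith [sq_add_sq_le_wt k]
  have h2 : s ^ τ ≤ wt k ^ ⌈τ⌉₊ := by
    calc s ^ τ ≤ s ^ (⌈τ⌉₊ : ℝ) := Real.rpow_le_rpow_of_exponent_le hs1 (Nat.le_ceil τ)
      _ = s ^ ⌈τ⌉₊ := Real.rpow_natCast _ _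
      _ ≤ wt k ^ ⌈τ⌉₊ := by gcongr
  have hsτ : 0 < s ^ τ := Real.rpow_pos_of_pos (by linarith) τ
  rw [Real.rpow_neg (by linarith), ← div_eq_mul_inv, div_le_iff₀ hsτ] at h1
  rw [mul_assoc, inv_mul_eq_div, le_div_iff₀ hγ, one_mul]
  refine h1.trans ?_
  rw [mul_comm]
  gcongr

/-- In Fourier coefficients the equation is division by `D k = 2πi e·k`. The zero mode is the only
obstruction, and it is removed by taking for `κ` the inverse of the mean `I` of `g`. The small
divisors cost a fixed power `N₀` of the weight, which rapid decay absorbs. -/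
theorem exists_cohomological_solution {g : ℝ × ℝ → ℝ} (hg : ContDiff ℝ ∞ g)
    (hper : ∀ z m, g (z + lat m) = g z) (hpos : ∀ z, 0 < g z) {e : ℝ × ℝ}
    (he : IsDiophantine e.1 e.2) :
    ∃ (κ : ℝ) (w : ℝ × ℝ → ℝ), 0 < κ ∧ ContDiff ℝ ∞ w ∧ (∀ z m, w (z + lat m) = w z) ∧
      ∀ z, fderiv ℝ w z e = κ * g z - 1 := by
  set h : ℝ × ℝ → ℂ := fun z => (g z : ℂ) with hh
  have hhs : ContDiff ℝ ∞ h := Complex.ofRealCLM.contDiff.comp hg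
  have hhp : ∀ z m, h (z + lat m) = h z := fun z m => by simp only [hh, hper]
  set I := ∫ z in unitSquare, g z with hI
  have hI0 : 0 < I := by
    obtain ⟨δ, hδ, hle⟩ := exists_pos_le_of_periodic hg.continuous hper hpos
    refine hδ.trans_le ?_
    have := setIntegral_mono (s := unitSquare) (μ := volume)
      (integrableOn_unitSquare (continuous_const (y := δ)))
      (integrableOn_unitSquare hg.continuous) hle
    rwa [setIntegral_const, volume_real_unitSquare, one_smul] at this
  have hc0 : coef h 0 = I := by
    have : ∀ z, char (-0) z * h z = (g z : ℂ) := fun z => by simp [char, hh, phase_apply]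
    simp only [coef, this]
    exact integral_ofReal
  set D : ℤ × ℤ → ℂ := fun k => 2 * Real.pi * Complex.I * (e.1 * k.1 + e.2 * k.2) with hD
  set a : ℤ × ℤ → ℂ := fun k => if k = 0 then 0 else (I : ℂ)⁻¹ * coef h k / D k with ha
  obtain ⟨C₀, N₀, hC₀, hsd⟩ := exists_small_divisor_bound he
  have hDn : ∀ k : ℤ × ℤ, ‖D k‖ = 2 * Real.pi * |e.1 * k.1 + e.2 * k.2| := fun k => by
    have : (e.1 * k.1 + e.2 * k.2 : ℂ) = ((e.1 * k.1 + e.2 * k.2 : ℝ) : ℂ) := by push_cast; rfl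
    rw [hD]
    simp only [this]
    rw [norm_mul, Complex.norm_real, Real.norm_eq_abs]
    simp [abs_of_pos Real.pi_pos]
  have hD0 : ∀ k : ℤ × ℤ, k ≠ 0 → D k ≠ 0 := fun k hk h0 => by
    have h1 := hDn k
    rw [h0, norm_zero] at h1
    have h2 := hsd k hk
    have h3 : |e.1 * k.1 + e.2 * k.2| = 0 := by
      have := Real.pi_pos
      rcases mul_eq_zero.1 h1.symm with h4 | h4
      · linarith
      · exact h4
    rw [h3, mul_zero] at h2
    linarith
  have haD : ∀ k, a k * D k = (I : ℂ)⁻¹ * coef h k - if k = 0 then 1 else 0 := by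
    intro k
    by_cases hk : k = 0
    · have : (I : ℂ) ≠ 0 := by exact_mod_cast hI0.ne'
      simp [ha, hk, hc0, this]
    · have := hD0 k hk
      simp only [ha, hk, if_false, sub_zero]
      field_simp
  have harap : ∀ N : ℕ, ∃ C : ℝ, ∀ k, wt k ^ N * ‖a k‖ ≤ C := by
    intro N
    obtain ⟨C, hC⟩ := coef_rapidly_decreasing hhs hhp (N + N₀)
    refine ⟨I⁻¹ * C₀ * C, fun k => ?_⟩
    have hw : 0 < wt k := zero_lt_one.trans_le (one_le_wt k)
    have hCk := hC k
    have hC0 : 0 ≤ C := le_trans (by positivity) hCk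
    by_cases hk : k = 0
    · simp only [ha, hk, if_true, norm_zero, mul_zero]
      positivity
    · have hp : 0 < ‖D k‖ := norm_pos_iff.2 (hD0 k hk)
      simp only [ha, hk, if_false, norm_div, norm_mul, norm_inv, Complex.norm_real,
        Real.norm_of_nonneg hI0.le]
      rw [mul_div_assoc', div_le_iff₀ hp]
      have h1 : 1 ≤ C₀ * wt k ^ N₀ * ‖D k‖ := by
        refine (hsd k hk).trans ?_
        rw [hDn]
        gcongr
        refine le_mul_of_one_le_left (abs_nonneg _) ?_
        linarith [Real.pi_gt_three]
      calc wt k ^ N * (I⁻¹ * ‖coef h k‖)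
          ≤ wt k ^ N * (I⁻¹ * ‖coef h k‖) * (C₀ * wt k ^ N₀ * ‖D k‖) :=
            le_mul_of_one_le_right (by positivity) h1
        _ = I⁻¹ * C₀ * (wt k ^ (N + N₀) * ‖coef h k‖) * ‖D k‖ := by ring
        _ ≤ I⁻¹ * C₀ * C * ‖D k‖ := by gcongr
  set W : ℝ × ℝ → ℂ := fun z => ∑' k, a k * char k z with hW
  have hWs : ContDiff ℝ ∞ W := contDiff_tsum_char harap
  have hWd : ∀ z, fderiv ℝ W z e = (I : ℂ)⁻¹ * h z - 1 := by
    intro z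
    obtain ⟨C, hC⟩ := harap 2
    have hderiv : HasFDerivAt W
        (∑' k, a k • (phase k).smulRight (Complex.I * char k z)) z := by
      refine hasFDerivAt_tsum (u := fun k => 2 * Real.pi * C * (wt k)⁻¹) (x₀ := z)
        (f := fun k z => a k * char k z)
        (f' := fun k z => a k • (phase k).smulRight (Complex.I * char k z))
        (summable_wt_inv.mul_left _) (fun k z => (hasFDerivAt_char k z).const_mul (a k))
        (fun k z => ?_) ?_ z
      · have hw : 0 < wt k := zero_lt_one.trans_le (one_le_wt k)
        rw [norm_smul, ContinuousLinearMap.norm_smulRight_apply, norm_mul, norm_char,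
          Complex.norm_I, mul_one, mul_one]
        calc ‖a k‖ * ‖phase k‖ ≤ ‖a k‖ * (2 * Real.pi * wt k) := by
              gcongr; exact norm_phase_le k
          _ = 2 * Real.pi * (wt k ^ 2 * ‖a k‖) * (wt k)⁻¹ := by field_simp
          _ ≤ 2 * Real.pi * C * (wt k)⁻¹ := by gcongr; exact hC k
      · refine Summable.of_norm ?_
        simpa [norm_mul, norm_char] using (summable_of_rapidly_decreasing harap).norm
    have hsummable : Summable fun k => a k • (phase k).smulRight (Complex.I * char k z) := by
      refine Summable.of_norm_bounded (summable_wt_inv.mul_left (2 * Real.pi * C)) fun k => ?_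
      have hw : 0 < wt k := zero_lt_one.trans_le (one_le_wt k)
      rw [norm_smul, ContinuousLinearMap.norm_smulRight_apply, norm_mul, norm_char,
        Complex.norm_I, mul_one, mul_one]
      calc ‖a k‖ * ‖phase k‖ ≤ ‖a k‖ * (2 * Real.pi * wt k) := by
            gcongr; exact norm_phase_le k
        _ = 2 * Real.pi * (wt k ^ 2 * ‖a k‖) * (wt k)⁻¹ := by field_simp
        _ ≤ 2 * Real.pi * C * (wt k)⁻¹ := by gcongr; exact hC k
    rw [hderiv.fderiv]
    have hev := (ContinuousLinearMap.apply ℝ ℂ e).hasSum hsummable.hasSum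
    simp only [ContinuousLinearMap.apply_apply] at hev
    have hsum : HasSum (fun k => a k * D k * char k z) ((I : ℂ)⁻¹ * h z - 1) := by
      have h1 := (hasSum_coef_char hhs hhp z).mul_left ((I : ℂ)⁻¹)
      have h2 : HasSum (fun k : ℤ × ℤ => if k = 0 then (1 : ℂ) else 0) 1 := hasSum_ite_eq 0 1
      have h3 : (fun k => a k * D k * char k z) =
          fun k => (I : ℂ)⁻¹ * (coef h k * char k z) - if k = 0 then 1 else 0 := by
        ext k
        rw [haD, sub_mul, mul_assoc]
        by_cases hk : k = 0 <;> simp [hk, char, phase_apply]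
      rw [h3]
      exact h1.sub h2
    have hterm : (fun k => (a k • (phase k).smulRight (Complex.I * char k z)) e) =
        fun k => a k * D k * char k z := by
      ext k
      simp only [_root_.smul_apply, ContinuousLinearMap.smulRight_apply, phase_apply,
        smul_eq_mul, Complex.real_smul, hD]
      push_cast
      ring
    rw [hterm] at hev
    exact hev.unique hsum
  -- The series is complex-valued; since `e` and the right-hand side are real, its real part is also
  -- a solution.
  refine ⟨I⁻¹, fun z => (W z).re, inv_pos.2 hI0, Complex.reCLM.contDiff.comp hWs, fun z m => ?_,
    fun z => ?_⟩
  · simp only [hW, char_periodic]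
  · have h1 : HasFDerivAt (fun z => (W z).re) (Complex.reCLM.comp (fderiv ℝ W z)) z :=
      Complex.reCLM.hasFDerivAt.comp z (hWs.differentiable (by simp) z).hasFDerivAt
    rw [h1.fderiv, ContinuousLinearMap.comp_apply, hWd]
    simp only [hh, Complex.reCLM_apply, Complex.sub_re, Complex.one_re, ← Complex.ofReal_inv,
      ← Complex.ofReal_mul, Complex.ofReal_re]

end TorusField

namespace TorusField

/-! ### Alternating forms on finite-dimensional spaces -/

section Alternating

variable {E : Type*} [NormedAddCommGroup E] [NormedSpace ℝ E]
  {E' : Type*} [NormedAddCommGroup E'] [NormedSpace ℝ E']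
  {G : Type*} [NormedAddCommGroup G] [NormedSpace ℝ G] {k : ℕ}

/-- A map into alternating forms is smooth if all its evaluations are. -/
theorem contDiffAt_of_forall_apply [FiniteDimensional ℝ E] {n : WithTop ℕ∞}
    {η : G → E [⋀^Fin k]→L[ℝ] ℝ} {y : G} (h : ∀ v, ContDiffAt ℝ n (fun x => η x v) y) :
    ContDiffAt ℝ n η y := by
  let b := Module.finBasis ℝ E
  let ev : (E [⋀^Fin k]→L[ℝ] ℝ) →ₗ[ℝ] ((Fin k → Fin (Module.finrank ℝ E)) → ℝ) :=
    { toFun := fun η s => η fun i => b (s i)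
      map_add' := fun _ _ => rfl
      map_smul' := fun _ _ => rfl }
  have hinj : LinearMap.ker ev = ⊥ := by
    rw [LinearMap.ker_eq_bot]
    intro η θ hηθ
    have : η.toAlternatingMap = θ.toAlternatingMap :=
      b.ext_alternating fun s _ => congrFun hηθ s
    ext v
    exact congrArg (fun m : E [⋀^Fin k]→ₗ[ℝ] ℝ => m v) this
  obtain ⟨r, hr⟩ := LinearMap.exists_leftInverse_of_injective ev hinj
  have hη : η = fun x => r.toContinuousLinearMap (ev (η x)) := by
    ext1 x
    exact (LinearMap.congr_fun hr (η x)).symm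
  rw [hη]
  exact r.toContinuousLinearMap.contDiff.contDiffAt.comp y
    (contDiffAt_pi.2 fun s => h fun i => b (s i))

theorem contDiffAt_alternating_apply [FiniteDimensional ℝ E] {n : WithTop ℕ∞}
    {η : G → E [⋀^Fin k]→L[ℝ] ℝ} {v : G → Fin k → E} {y : G} (hη : ContDiffAt ℝ n η y)
    (hv : ∀ i, ContDiffAt ℝ n (fun x => v x i) y) :
    ContDiffAt ℝ n (fun x => η x (v x)) y := by
  let b := Module.finBasis ℝ E
  have hexp : (fun x => η x (v x)) = fun x => ∑ s : Fin k → Fin (Module.finrank ℝ E),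
      (∏ i, b.repr (v x i) (s i)) * η x (fun i => b (s i)) := by
    ext1 x
    have h : v x = fun i => ∑ j, b.repr (v x i) j • b j := by
      ext1 i
      exact (b.sum_repr _).symm
    conv_lhs => rw [h]
    refine ((η x).toMultilinearMap.map_sum _).trans (Finset.sum_congr rfl fun s _ => ?_)
    exact (η x).toMultilinearMap.map_smul_univ _ _
  rw [hexp]
  refine ContDiffAt.sum fun s _ => ContDiffAt.mul (contDiffAt_prod fun i _ => ?_) ?_
  · exact (LinearMap.toContinuousLinearMap (b.coord (s i))).contDiff.contDiffAt.comp y (hv i)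
  · exact (ContinuousAlternatingMap.apply ℝ E ℝ fun i => b (s i)).contDiff.contDiffAt.comp y hη

theorem contDiffAt_compContinuousLinearMap [FiniteDimensional ℝ E] [FiniteDimensional ℝ E']
    {n : WithTop ℕ∞} {η : G → E [⋀^Fin k]→L[ℝ] ℝ} {A : G → E' →L[ℝ] E} {y : G}
    (hη : ContDiffAt ℝ n η y) (hA : ContDiffAt ℝ n A y) :
    ContDiffAt ℝ n (fun x => (η x).compContinuousLinearMap (A x)) y :=
  contDiffAt_of_forall_apply fun w =>
    contDiffAt_alternating_apply (v := fun x i => A x (w i)) hη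
      fun _ => hA.clm_apply contDiffAt_const

/-- The interior product of a vector field with a form. -/
def interior (X : G → E) (μ : G → E [⋀^Fin (k + 1)]→L[ℝ] ℝ) (y : G) : E [⋀^Fin k]→L[ℝ] ℝ :=
  (μ y).curryLeft (X y)

omit [NormedAddCommGroup G] [NormedSpace ℝ G] in
theorem interior_apply (X : G → E) (μ : G → E [⋀^Fin (k + 1)]→L[ℝ] ℝ) (y : G) (v : Fin k → E) :
    interior X μ y v = μ y (Matrix.vecCons (X y) v) := rfl

theorem contDiffAt_interior [FiniteDimensional ℝ E] {n : WithTop ℕ∞} {X : G → E}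
    {μ : G → E [⋀^Fin (k + 1)]→L[ℝ] ℝ} {y : G} (hX : ContDiffAt ℝ n X y)
    (hμ : ContDiffAt ℝ n μ y) : ContDiffAt ℝ n (interior X μ) y :=
  contDiffAt_of_forall_apply fun v =>
    contDiffAt_alternating_apply (v := fun x => Matrix.vecCons (X x) v) hμ fun i =>
      Fin.cases hX (fun _ => contDiffAt_const) i

theorem fderiv_interior_apply {X : G → E} {μ : G → E [⋀^Fin (k + 1)]→L[ℝ] ℝ} {y : G}
    (hX : DifferentiableAt ℝ X y) (hμ : DifferentiableAt ℝ μ y) (v : Fin k → E) (w : G) :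
    fderiv ℝ (fun x => interior X μ x v) y w =
      fderiv ℝ μ y w (Matrix.vecCons (X y) v) +
        μ y (Matrix.vecCons (fderiv ℝ X y w) v) := by
  have hg : ∀ i, DifferentiableAt ℝ (fun x => (Matrix.vecCons (X x) v : Fin (k + 1) → E) i) y :=
    fun i => Fin.cases hX (fun _ => differentiableAt_const _) i
  have h := fderiv_continuousAlternatingMap_apply_apply hμ hg w
  simp only [interior_apply]
  rw [h, Fin.sum_univ_succ]
  have h0 : ∀ i : Fin k, μ y (Function.update (fun j => (Matrix.vecCons (X y) v : Fin (k + 1) → E) j)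
      i.succ (fderiv ℝ (fun x => (Matrix.vecCons (X x) v : Fin (k + 1) → E) i.succ) y w)) = 0 := by
    intro i
    have : fderiv ℝ (fun x => (Matrix.vecCons (X x) v : Fin (k + 1) → E) i.succ) y w = 0 := by
      simp
    rw [this]
    exact (μ y).map_coord_zero i.succ (by simp)
  rw [Finset.sum_eq_zero fun i _ => h0 i, add_zero]
  congr 2
  ext i
  refine Fin.cases ?_ (fun j => ?_) i <;> simp

theorem extDeriv_one_apply {η : E → E [⋀^Fin 1]→L[ℝ] ℝ} {y : E} (hη : DifferentiableAt ℝ η y)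
    (v w : E) :
    extDeriv η y ![v, w] =
      fderiv ℝ (fun x => η x fun _ => w) y v - fderiv ℝ (fun x => η x fun _ => v) y w := by
  rw [extDeriv_apply hη, Fin.sum_univ_two]
  have h0 : Fin.removeNth 0 ![v, w] = fun _ => w := by
    ext i; fin_cases i; rfl
  have h1 : Fin.removeNth 1 ![v, w] = fun _ => v := by
    ext i; fin_cases i; rfl
  rw [h0, h1]
  simp [sub_eq_add_neg]

theorem extDeriv_two_apply {μ : E → E [⋀^Fin 2]→L[ℝ] ℝ} {y : E} (hμ : DifferentiableAt ℝ μ y)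
    (u v w : E) :
    extDeriv μ y ![u, v, w] =
      fderiv ℝ μ y u ![v, w] - fderiv ℝ μ y v ![u, w] + fderiv ℝ μ y w ![u, v] := by
  have key : ∀ a b : Fin 2 → E, ∀ z, a = b →
      fderiv ℝ (fun x => μ x a) y z = fderiv ℝ μ y z b := by
    rintro a _ z rfl
    have h : HasFDerivAt (fun x => μ x a) _ y :=
      (ContinuousAlternatingMap.apply ℝ E ℝ a).hasFDerivAt.comp y hμ.hasFDerivAt
    rw [h.fderiv]
    rfl
  rw [extDeriv_apply hμ, Fin.sum_univ_three,
    key _ ![v, w] _ (by ext i; fin_cases i <;> rfl), key _ ![u, w] _ (by ext i; fin_cases i <;> rfl),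
    key _ ![u, v] _ (by ext i; fin_cases i <;> rfl)]
  simp [sub_eq_add_neg]

theorem apply_pair_swap (μ : E [⋀^Fin 2]→L[ℝ] ℝ) (a b : E) : μ ![b, a] = -μ ![a, b] := by
  have h : ![b, a] = ![a, b] ∘ Equiv.swap 0 1 := by
    ext i; fin_cases i <;> rfl
  rw [h]
  exact μ.toAlternatingMap.map_swap _ (by decide)

/-- Cartan's formula for `2`-forms in dimension two, where every `2`-form is closed. -/
theorem extDeriv_interior (hE : Module.finrank ℝ E = 2) {X : E → E} {μ : E → E [⋀^Fin 2]→L[ℝ] ℝ}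
    {y : E} (hX1 : ContDiffAt ℝ 1 X y) (hμ1 : ContDiffAt ℝ 1 μ y) (v : Fin 2 → E) :
    extDeriv (interior X μ) y v = lieDerivFormWithin X μ Set.univ y v := by
  have hX := hX1.differentiableAt one_ne_zero
  have hμ := hμ1.differentiableAt one_ne_zero
  have : FiniteDimensional ℝ E := Module.finite_of_finrank_pos (by omega)
  obtain ⟨a, b, rfl⟩ : ∃ a b, v = ![a, b] := ⟨v 0, v 1, by ext i; fin_cases i <;> rfl⟩
  have hι : DifferentiableAt ℝ (interior X μ) y := by
    exact (contDiffAt_interior (n := 1) hX1 hμ1).differentiableAt one_ne_zero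
  -- Three vectors in dimension two are dependent. Expanded, this turns D_aμ(X, b) - D_bμ(X, a),
  -- which comes from d(ι_X μ), into the term D_Xμ(a, b) of the Lie derivative.
  have h3 : extDeriv μ y ![X y, a, b] = 0 := by
    refine AlternatingMap.map_linearDependent (extDeriv μ y).toAlternatingMap _ fun h => ?_
    have := h.fintype_card_le_finrank
    simp [hE] at this
  rw [extDeriv_two_apply hμ] at h3
  rw [extDeriv_one_apply hι, fderiv_interior_apply hX hμ, fderiv_interior_apply hX hμ,
    lieDerivFormWithin, Fin.sum_univ_two, fderivWithin_univ, fderivWithin_univ]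
  have c1 : ∀ p q : E, (Matrix.vecCons p fun _ : Fin 1 => q) = ![p, q] := fun p q => by
    ext i; fin_cases i <;> rfl
  have c2 : Function.update ![a, b] 0 (fderiv ℝ X y (![a, b] 0)) = ![fderiv ℝ X y a, b] := by
    ext i; fin_cases i <;> rfl
  have c3 : Function.update ![a, b] 1 (fderiv ℝ X y (![a, b] 1)) = ![a, fderiv ℝ X y b] := by
    ext i; fin_cases i <;> rfl
  have c4 : μ y ![fderiv ℝ X y b, a] = - μ y ![a, fderiv ℝ X y b] := by
    exact apply_pair_swap _ _ _
  simp only [c1, c2, c3, c4]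
  linarith

/-- Contracting a non-zero `2`-form with a non-zero vector does not give zero, in dimension two. -/
theorem exists_apply_pair_ne_zero (hE : Module.finrank ℝ E = 2) {μ : E [⋀^Fin 2]→L[ℝ] ℝ}
    (hμ : μ ≠ 0) {x : E} (hx : x ≠ 0) : ∃ v, μ ![x, v] ≠ 0 := by
  by_contra! h
  obtain ⟨v, hv⟩ : ∃ v, μ v ≠ 0 := by
    by_contra! h0
    exact hμ (ContinuousAlternatingMap.ext h0)
  -- A pair on which `μ` does not vanish is a basis; contracting `x` with its two members then
  -- isolates the two coordinates of `x`.
  have hli : LinearIndependent ℝ v := by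
    by_contra hli
    exact hv (AlternatingMap.map_linearDependent μ.toAlternatingMap v hli)
  let b := basisOfLinearIndependentOfCardEqFinrank hli (by simp [hE])
  have hb : ∀ i, b i = v i := fun i => by simp [b]
  have hxb := b.sum_repr x
  rw [Fin.sum_univ_two, hb, hb] at hxb
  have hvv : v = ![v 0, v 1] := by ext i; fin_cases i <;> rfl
  have e : ∀ w, b.repr x 0 * μ ![v 0, w] + b.repr x 1 * μ ![v 1, w] = 0 := fun w => by
    have := h w
    rw [← hxb] at this
    have h1 := (μ.toAlternatingMap.map_vecCons_add (![w] : Fin 1 → E)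
      (b.repr x 0 • v 0) (b.repr x 1 • v 1))
    rw [AlternatingMap.map_vecCons_smul, AlternatingMap.map_vecCons_smul] at h1
    exact h1.symm.trans this
  have hz : ∀ w, μ ![w, w] = 0 := fun w =>
    μ.map_eq_zero_of_eq _ (show ![w, w] 0 = ![w, w] 1 from rfl) (by decide)
  have hs : μ ![v 1, v 0] = - μ ![v 0, v 1] := by
    exact apply_pair_swap _ _ _
  rw [hvv] at hv
  have e0 := e (v 0)
  have e1 := e (v 1)
  rw [hz, hs] at e0
  rw [hz] at e1
  have h0 : b.repr x 0 = 0 := by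
    rcases mul_eq_zero.1 (by linarith : b.repr x 0 * μ ![v 0, v 1] = 0) with h | h
    · exact h
    · exact absurd h hv
  have h1 : b.repr x 1 = 0 := by
    rcases mul_eq_zero.1 (by linarith : b.repr x 1 * μ ![v 0, v 1] = 0) with h | h
    · exact h
    · exact absurd h hv
  rw [h0, h1] at hxb
  exact hx (by simpa using hxb.symm)

end Alternating

end TorusField

namespace TorusField

open Filter Function

/-! ### Covers of a surface by the plane -/

section Cover

variable {E : Type*} [NormedAddCommGroup E] [NormedSpace ℝ E]
  {H : Type*} [TopologicalSpace H] (I : ModelWithCorners ℝ E H)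
  {S : Type*} [TopologicalSpace S] [ChartedSpace H S]
  {E' : Type*} [NormedAddCommGroup E'] [NormedSpace ℝ E']
  {H' : Type*} [TopologicalSpace H'] {I' : ModelWithCorners ℝ E' H'}
  {S' : Type*} [TopologicalSpace S'] [ChartedSpace H' S']

/-- `p` identifies `S` with the quotient of the plane by the lattice `ℤ²`, as a manifold. -/
structure IsTorusCover (p : ℝ × ℝ → S) : Prop where
  smooth : ContMDiff 𝓘(ℝ, ℝ × ℝ) I ∞ p
  surjective : Surjective p
  eq_iff : ∀ u v, p u = p v ↔ ∃ m, v = u + lat m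
  exists_section : ∀ u, ∃ s : S → ℝ × ℝ, ContMDiffAt I 𝓘(ℝ, ℝ × ℝ) ∞ s (p u) ∧ s (p u) = u ∧
    (∀ᶠ x in 𝓝 (p u), p (s x) = x) ∧ ∀ᶠ v in 𝓝 u, s (p v) = v

/-- An injective endomorphism of the plane is invertible, so the inverse function theorem applies at
every point, and the global inverse agrees with the local ones. -/
theorem IsLatticeDiffeo.contDiff_inverse {D G : ℝ × ℝ → ℝ × ℝ} (hD : IsLatticeDiffeo D)
    (hGD : LeftInverse G D) : ContDiff ℝ ∞ G := by
  refine contDiff_iff_contDiffAt.2 fun z => ?_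
  obtain ⟨u, rfl⟩ := hD.bijective.surjective z
  let e : (ℝ × ℝ) ≃L[ℝ] ℝ × ℝ := (LinearEquiv.ofInjectiveEndo
    (fderiv ℝ D u : ℝ × ℝ →ₗ[ℝ] ℝ × ℝ) ((injective_iff_map_eq_zero _).2
      (hD.ker_fderiv u))).toContinuousLinearEquiv
  have he : (e : ℝ × ℝ →L[ℝ] ℝ × ℝ) = fderiv ℝ D u := by ext <;> rfl
  have hDu : HasFDerivAt D (e : ℝ × ℝ →L[ℝ] ℝ × ℝ) u := by
    rw [he]
    exact (hD.smooth.differentiable (by simp) u).hasFDerivAt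
  have hc : ContDiffAt ℝ ∞ D u := hD.smooth.contDiffAt
  refine (hc.to_localInverse hDu (by simp)).congr_of_eventuallyEq ?_
  have hs := hc.hasStrictFDerivAt' hDu (by simp)
  filter_upwards [hs.eventually_right_inverse] with y hy
  conv_lhs => rw [← hy]
  exact hGD _

/-- The section is a branch of the logarithm of `z / z₀`, with its cut opposite `z₀`. It is a right
inverse everywhere, but a left inverse only at distance less than 1/2 from `t`. -/
theorem exists_circle_section (t : ℝ) :
    ∃ s : Circle → ℝ, ContMDiffAt (𝓡 1) 𝓘(ℝ, ℝ) ∞ s (Circle.exp (2 * Real.pi * t)) ∧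
      s (Circle.exp (2 * Real.pi * t)) = t ∧ (∀ z, Circle.exp (2 * Real.pi * s z) = z) ∧
      ∀ᶠ v in 𝓝 t, s (Circle.exp (2 * Real.pi * v)) = v := by
  have hpi := Real.pi_pos
  set z₀ := Circle.exp (2 * Real.pi * t) with hz₀
  let s : Circle → ℝ := fun z => t + (Complex.log ((z : ℂ) / z₀)).im / (2 * Real.pi)
  have hs : ∀ z, s z = t + Complex.arg ((z / z₀ : Circle) : ℂ) / (2 * Real.pi) := fun z => by
    simp [s, Complex.log_im]
  have hloc : ∀ v, |v - t| < 1 / 2 → s (Circle.exp (2 * Real.pi * v)) = v := fun v hv => by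
    rw [abs_lt] at hv
    rw [hs, hz₀, ← Circle.exp_sub, Circle.arg_exp (by nlinarith) (by nlinarith)]
    field_simp
    ring
  refine ⟨s, ?_, hloc t (by simp), fun z => ?_, ?_⟩
  · have h1 : ContDiffAt ℝ ∞ (fun w : ℂ => t + (Complex.log (w / z₀)).im / (2 * Real.pi)) z₀ := by
      have h2 : ContDiffAt ℝ ∞ (fun w : ℂ => Complex.log (w / z₀)) z₀ := by
        have h3 : ContDiffAt ℝ ∞ Complex.log ((z₀ : ℂ) / z₀) :=
          (Complex.contDiffAt_log (by simp)).restrict_scalars ℝ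
        exact ContDiffAt.comp (z₀ : ℂ) (g := Complex.log) (f := fun w : ℂ => w / z₀) h3
          (contDiffAt_id.div_const _)
      exact contDiffAt_const.add ((Complex.imCLM.contDiff.contDiffAt.comp (z₀ : ℂ) h2).div_const _)
    have : Fact (Module.finrank ℝ ℂ = 1 + 1) := ⟨Complex.finrank_real_complex⟩
    have h4 : ContMDiff (𝓡 1) 𝓘(ℝ, ℂ) ∞ (fun z : Circle => (z : ℂ)) := contMDiff_coe_sphere
    exact h1.contMDiffAt.comp z₀ h4.contMDiffAt
  · rw [hs, mul_add, mul_div_cancel₀ _ (by positivity), Circle.exp_add, Circle.exp_arg, ← hz₀]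
    simp
  · filter_upwards [Metric.ball_mem_nhds t (show (0 : ℝ) < 1 / 2 by norm_num)] with v hv
    exact hloc v (by simpa [Real.dist_eq] using hv)

theorem isTorusCover_torusProj : IsTorusCover torusModel torusProj where
  smooth := by
    have h : ContMDiff 𝓘(ℝ, ℝ) (𝓡 1) ∞ fun t : ℝ => Circle.exp (2 * Real.pi * t) :=
      contMDiff_circleExp.comp (contDiff_const.mul contDiff_id).contMDiff
    exact (h.comp contDiff_fst.contMDiff).prodMk (h.comp contDiff_snd.contMDiff)
  surjective := by
    have hs : ∀ z : Circle, ∃ t : ℝ, Circle.exp (2 * Real.pi * t) = z := fun z => by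
      obtain ⟨s, -, -, h, -⟩ := exists_circle_section 0
      exact ⟨s z, h z⟩
    rintro ⟨z, w⟩
    obtain ⟨a, rfl⟩ := hs z
    obtain ⟨b, rfl⟩ := hs w
    exact ⟨(a, b), rfl⟩
  eq_iff u v := by
    have h : ∀ a b : ℝ, Circle.exp (2 * Real.pi * a) = Circle.exp (2 * Real.pi * b) ↔
        ∃ m : ℤ, b = a + m := fun a b => by
      rw [eq_comm, Circle.exp_eq_exp]
      refine exists_congr fun m => ?_
      have := Real.pi_pos.ne'
      constructor <;> intro h
      · have h2 : (2 * Real.pi) * (b - a - m) = 0 := by linear_combination h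
        rcases mul_eq_zero.1 h2 with h3 | h3
        · exact absurd h3 (by positivity)
        · linarith
      · rw [h]
        ring
    simp only [torusProj, h, Prod.ext_iff, Prod.fst_add, Prod.snd_add, lat_fst,
      lat_snd]
    exact ⟨fun ⟨⟨m, hm⟩, n, hn⟩ => ⟨(m, n), hm, hn⟩, fun ⟨m, h1, h2⟩ => ⟨⟨m.1, h1⟩, m.2, h2⟩⟩
  exists_section u := by
    obtain ⟨s, h1, h2, h3, h4⟩ := exists_circle_section u.1
    obtain ⟨s', h1', h2', h3', h4'⟩ := exists_circle_section u.2
    refine ⟨fun x => (s x.1, s' x.2), ?_, Prod.ext h2 h2', .of_forall fun x => ?_, ?_⟩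
    · exact ContMDiffAt.prodMk_space (ContMDiffAt.comp (torusProj u) (g := s) h1 contMDiffAt_fst)
        (ContMDiffAt.comp (torusProj u) (g := s') h1' contMDiffAt_snd)
    · exact Prod.ext (h3 x.1) (h3' x.2)
    · filter_upwards [continuous_fst.continuousAt.eventually h4,
        continuous_snd.continuousAt.eventually h4'] with v hv hv'
      exact Prod.ext hv hv'

namespace IsTorusCover

variable {I} {p : ℝ × ℝ → S}

theorem comp_diffeomorph (hp : IsTorusCover I p) (Φ : S ≃ₘ⟮I, I'⟯ S') :
    IsTorusCover I' (Φ ∘ p) where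
  smooth := Φ.contMDiff.comp hp.smooth
  surjective := Φ.surjective.comp hp.surjective
  eq_iff u v := by simp [hp.eq_iff]
  exists_section u := by
    obtain ⟨s, h1, h2, h3, h4⟩ := hp.exists_section u
    have hΦ : Φ.symm (Φ (p u)) = p u := Φ.symm_apply_apply _
    refine ⟨s ∘ Φ.symm, ?_, by simpa using h2, ?_, by simpa using h4⟩
    · refine ContMDiffAt.comp _ (g := s) (I' := I) ?_ Φ.symm.contMDiff.contMDiffAt
      rw [comp_apply, hΦ]
      exact h1
    · have : Tendsto Φ.symm (𝓝 (Φ (p u))) (𝓝 (p u)) := by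
        have := Φ.symm.continuous.tendsto (Φ (p u))
        rwa [hΦ] at this
      filter_upwards [this.eventually h3] with x hx
      simp [hx]

/-- A change of coordinates is encoded as the new cover `p ∘ D⁻¹`; it has the same deck group
because `D` commutes with the lattice. -/
theorem comp_latticeDiffeo_inv (hp : IsTorusCover I p) {D : ℝ × ℝ → ℝ × ℝ}
    (hD : IsLatticeDiffeo D) : ∃ q, IsTorusCover I q ∧ ∀ u, q (D u) = p u := by
  obtain ⟨G, hGD, hDG⟩ := bijective_iff_has_inverse.1 hD.bijective
  have hG : ContDiff ℝ ∞ G := hD.contDiff_inverse hGD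
  have hGlat : ∀ z m, G (z + lat m) = G z + lat m := fun z m => by
    rw [← hGD (G z + lat m), hD.map_add, hDG]
  refine ⟨p ∘ G, ⟨hp.smooth.comp hG.contMDiff, hp.surjective.comp hGD.surjective, fun u v => ?_,
    fun u => ?_⟩, fun u => by simp [hGD u]⟩
  · rw [comp_apply, comp_apply, hp.eq_iff]
    refine exists_congr fun m => ?_
    rw [← hGlat]
    exact hDG.injective.eq_iff
  · obtain ⟨s, h1, h2, h3, h4⟩ := hp.exists_section (G u)
    refine ⟨D ∘ s, hD.smooth.contMDiff.contMDiffAt.comp _ h1, ?_, ?_, ?_⟩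
    · simp only [comp_apply, h2, hDG u]
    · filter_upwards [h3] with x hx
      simp only [comp_apply, hGD (s x), hx]
    · filter_upwards [hG.continuous.continuousAt.eventually h4] with v hv
      simp only [comp_apply, hv, hDG v]

/-- A smooth function on the plane, invariant under the lattice, is the lift of a smooth function. -/
theorem exists_descend (hp : IsTorusCover I p) {f : ℝ × ℝ → S'}
    (hf : ContMDiff 𝓘(ℝ, ℝ × ℝ) I' ∞ f) (hper : ∀ z m, f (z + lat m) = f z) :
    ∃ g : S → S', ContMDiff I I' ∞ g ∧ ∀ u, g (p u) = f u := by
  have key : ∀ u, f (surjInv hp.surjective (p u)) = f u := fun u => by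
    obtain ⟨m, hm⟩ := (hp.eq_iff _ _).1 (surjInv_eq hp.surjective (p u))
    rw [← hper _ m, ← hm]
  refine ⟨fun x => f (surjInv hp.surjective x), fun x => ?_, key⟩
  obtain ⟨u, rfl⟩ := hp.surjective x
  obtain ⟨s, h1, h2, h3, -⟩ := hp.exists_section u
  -- The chosen preimages have no regularity, but by invariance they may be replaced near `p u` by
  -- the smooth local section.
  refine ContMDiffAt.congr_of_eventuallyEq (f := f ∘ s) ?_ ?_
  · exact hf.contMDiffAt.comp _ h1
  · filter_upwards [h3] with x hx
    rw [comp_apply, ← key (s x), hx]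

theorem map_add_lat (hp : IsTorusCover I p) (z : ℝ × ℝ) (m : ℤ × ℤ) : p (z + lat m) = p z :=
  ((hp.eq_iff _ _).2 ⟨m, rfl⟩).symm

/-- Two covers are related by a diffeomorphism. -/
theorem exists_diffeomorph (hp : IsTorusCover I p) {q : ℝ × ℝ → S'} (hq : IsTorusCover I' q) :
    ∃ Φ : S ≃ₘ⟮I, I'⟯ S', ∀ u, Φ (p u) = q u := by
  obtain ⟨f, hf, hfp⟩ := hp.exists_descend hq.smooth hq.map_add_lat
  obtain ⟨g, hg, hgq⟩ := hq.exists_descend hp.smooth hp.map_add_lat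
  refine ⟨⟨⟨f, g, fun x => ?_, fun x => ?_⟩, hf, hg⟩, hfp⟩
  · obtain ⟨u, rfl⟩ := hp.surjective x
    rw [hfp, hgq]
  · obtain ⟨u, rfl⟩ := hq.surjective x
    rw [hgq, hfp]

end IsTorusCover

end Cover

end TorusField

namespace TorusField

open Filter Function

/-! ### Fields and forms on a surface, lifted to the plane -/

section Lift

variable {E : Type*} [NormedAddCommGroup E] [NormedSpace ℝ E]
  {H : Type*} [TopologicalSpace H] {I : ModelWithCorners ℝ E H}
  {S : Type*} [TopologicalSpace S] [ChartedSpace H S] {k : ℕ}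

theorem two_le_infty : (2 : WithTop ℕ∞) ≤ ∞ := 
  WithTop.coe_le_coe.2 (le_top : (2 : ℕ∞) ≤ ⊤)

theorem field_congr (X : (x : S) → TangentSpace I x) {x y : S} (h : x = y) :
    (X x : E) = (X y : E) := by subst h; rfl

theorem form_congr (α : (x : S) → TangentSpace I x [⋀^Fin k]→L[ℝ] ℝ) {x y : S} (h : x = y)
    {v : Fin k → TangentSpace I x} {w : Fin k → TangentSpace I y}
    (hvw : ∀ i, (v i : E) = (w i : E)) : α x v = α y w := by
  subst h
  exact congrArg (α x) (funext hvw)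

variable (I) in
/-- The pullback of a form to the plane. -/
def pullForm (p : ℝ × ℝ → S) (α : (x : S) → TangentSpace I x [⋀^Fin k]→L[ℝ] ℝ) (u : ℝ × ℝ) :
    (ℝ × ℝ) [⋀^Fin k]→L[ℝ] ℝ :=
  (α (p u)).compContinuousLinearMap (mfderiv 𝓘(ℝ, ℝ × ℝ) I p u)

variable (I) in
/-- The pullback of a vector field to the plane. -/
def pullField (p : ℝ × ℝ → S) (X : (x : S) → TangentSpace I x) (u : ℝ × ℝ) : ℝ × ℝ :=
  VectorField.mpullback 𝓘(ℝ, ℝ × ℝ) I p X u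

namespace IsTorusCover

variable {p : ℝ × ℝ → S} (hp : IsTorusCover I p)
include hp

theorem mdifferentiableAt (u : ℝ × ℝ) : MDifferentiableAt 𝓘(ℝ, ℝ × ℝ) I p u :=
  hp.smooth.mdifferentiableAt (by simp)

/-- The derivative of a local section is a two-sided inverse: differentiate s ∘ p = id near `u` and
p ∘ s = id near `p u`. -/
theorem isInvertible_mfderiv (u : ℝ × ℝ) : (mfderiv 𝓘(ℝ, ℝ × ℝ) I p u).IsInvertible := by
  obtain ⟨s, h1, h2, h3, h4⟩ := hp.exists_section u
  have hs : MDifferentiableAt I 𝓘(ℝ, ℝ × ℝ) s (p u) := h1.mdifferentiableAt (by simp)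
  have hpu := hp.mdifferentiableAt u
  have hpu' : MDifferentiableAt 𝓘(ℝ, ℝ × ℝ) I p (s (p u)) := by rw [h2]; exact hpu
  have e1 := mfderiv_comp u hs hpu
  have e1' : mfderiv 𝓘(ℝ, ℝ × ℝ) 𝓘(ℝ, ℝ × ℝ) (s ∘ p) u = ContinuousLinearMap.id ℝ (ℝ × ℝ) := by
    have h : s ∘ p =ᶠ[𝓝 u] id := h4
    exact h.mfderiv_eq.trans mfderiv_id
  have e2 := mfderiv_comp (p u) hpu' hs
  have e2' : (mfderiv I I (p ∘ s) (p u) : E →L[ℝ] E) = ContinuousLinearMap.id ℝ E := by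
    have h : p ∘ s =ᶠ[𝓝 (p u)] id := h3
    exact h.mfderiv_eq.trans mfderiv_id
  have e3 : ∀ v w, v = w → (mfderiv 𝓘(ℝ, ℝ × ℝ) I p v : ℝ × ℝ →L[ℝ] E) =
      mfderiv 𝓘(ℝ, ℝ × ℝ) I p w := by
    rintro v _ rfl
    rfl
  refine ⟨ContinuousLinearEquiv.equivOfInverse (mfderiv 𝓘(ℝ, ℝ × ℝ) I p u)
    (mfderiv I 𝓘(ℝ, ℝ × ℝ) s (p u)) (fun v => ?_) (fun w => ?_), rfl⟩
  · exact DFunLike.congr_fun (e1.symm.trans e1') v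
  · have := DFunLike.congr_fun (e2.symm.trans e2') w
    refine Eq.trans ?_ this
    exact (DFunLike.congr_fun (e3 (s (p u)) u h2) _).symm

theorem mfderiv_injective (u : ℝ × ℝ) : Injective (mfderiv 𝓘(ℝ, ℝ × ℝ) I p u) := by
  obtain ⟨e, he⟩ := hp.isInvertible_mfderiv u
  rw [← he]
  exact e.injective

theorem mfderiv_surjective (u : ℝ × ℝ) : Surjective (mfderiv 𝓘(ℝ, ℝ × ℝ) I p u) := by
  obtain ⟨e, he⟩ := hp.isInvertible_mfderiv u
  rw [← he]
  exact e.surjective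

theorem mfderiv_add_lat (u : ℝ × ℝ) (m : ℤ × ℤ) (v : ℝ × ℝ) :
    (mfderiv 𝓘(ℝ, ℝ × ℝ) I p (u + lat m) v : E) = mfderiv 𝓘(ℝ, ℝ × ℝ) I p u v := by
  have h1 : HasMFDerivAt 𝓘(ℝ, ℝ × ℝ) 𝓘(ℝ, ℝ × ℝ) (fun z : ℝ × ℝ => z + lat m) u
      (ContinuousLinearMap.id ℝ (ℝ × ℝ)) := ((hasFDerivAt_id u).add_const (lat m)).hasMFDerivAt
  have h2 := (hp.mdifferentiableAt (u + lat m)).hasMFDerivAt.comp u h1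
  have h3 : p ∘ (fun z : ℝ × ℝ => z + lat m) = p := funext fun z => hp.map_add_lat z m
  have h4 : (mfderiv 𝓘(ℝ, ℝ × ℝ) I (p ∘ fun z : ℝ × ℝ => z + lat m) u : ℝ × ℝ →L[ℝ] E) =
      mfderiv 𝓘(ℝ, ℝ × ℝ) I p u := by
    rw [h3]
  exact (DFunLike.congr_fun h2.mfderiv v).symm.trans (DFunLike.congr_fun h4 v)

theorem mfderiv_pullField (X : (x : S) → TangentSpace I x) (u : ℝ × ℝ) :
    mfderiv 𝓘(ℝ, ℝ × ℝ) I p u (pullField I p X u) = X (p u) := by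
  obtain ⟨e, he⟩ := hp.isInvertible_mfderiv u
  rw [pullField, VectorField.mpullback_apply, ← he, ContinuousLinearMap.inverse_equiv]
  exact e.apply_symm_apply _

theorem pullField_add_lat (X : (x : S) → TangentSpace I x) (u : ℝ × ℝ) (m : ℤ × ℤ) :
    pullField I p X (u + lat m) = pullField I p X u := by
  apply hp.mfderiv_injective u
  rw [hp.mfderiv_pullField]
  exact ((hp.mfderiv_add_lat u m _).symm.trans (hp.mfderiv_pullField X _)).trans
    (field_congr X (hp.map_add_lat u m))

theorem contDiff_pullField [IsManifold I ∞ S] [CompleteSpace E] {X : (x : S) → TangentSpace I x}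
    (hX : IsSmoothField I X) : ContDiff ℝ ∞ (pullField I p X) :=
  contMDiff_vectorSpace_iff_contDiff.1
    (ContMDiff.mpullback_vectorField hX hp.smooth hp.isInvertible_mfderiv (by simp))

theorem pullForm_add_lat (α : (x : S) → TangentSpace I x [⋀^Fin k]→L[ℝ] ℝ) (u : ℝ × ℝ)
    (m : ℤ × ℤ) : pullForm I p α (u + lat m) = pullForm I p α u := by
  ext v
  exact form_congr α (hp.map_add_lat u m) fun i => hp.mfderiv_add_lat u m (v i)

/-- A form on the plane, invariant under the lattice, is the pullback of a form. -/
theorem exists_form {β : ℝ × ℝ → (ℝ × ℝ) [⋀^Fin k]→L[ℝ] ℝ}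
    (hβ : ∀ u m, β (u + lat m) = β u) :
    ∃ α : (x : S) → TangentSpace I x [⋀^Fin k]→L[ℝ] ℝ, ∀ u, pullForm I p α u = β u := by
  -- The form is defined by transporting `β` from a chosen preimage; lattice invariance of `β` and
  -- of the derivative of `p` makes the choice immaterial.
  let σ := surjInv hp.surjective
  have hσ : ∀ x, p (σ x) = x := surjInv_eq hp.surjective
  let A : (x : S) → TangentSpace I x →L[ℝ] ℝ × ℝ := fun x =>
    (mfderiv 𝓘(ℝ, ℝ × ℝ) I p (σ x) : ℝ × ℝ →L[ℝ] E).inverse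
  refine ⟨fun x => (β (σ x)).compContinuousLinearMap (A x), fun u => ?_⟩
  obtain ⟨m, hm⟩ := (hp.eq_iff _ _).1 (hσ (p u)).symm
  ext v
  change β (σ (p u)) (fun i => A (p u) (mfderiv 𝓘(ℝ, ℝ × ℝ) I p u (v i))) = β u v
  rw [hm, hβ]
  congr 1
  ext1 i
  obtain ⟨e, he⟩ : ∃ e : (ℝ × ℝ) ≃L[ℝ] E, (e : ℝ × ℝ →L[ℝ] E) =
      mfderiv 𝓘(ℝ, ℝ × ℝ) I p (σ (p u)) := hp.isInvertible_mfderiv (σ (p u))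
  have h1 : A (p u) = (e.symm : E →L[ℝ] ℝ × ℝ) := by
    change ContinuousLinearMap.inverse _ = _
    rw [← he]
    exact ContinuousLinearMap.inverse_equiv e
  rw [h1]
  refine (ContinuousLinearEquiv.symm_apply_eq e).2 ?_
  refine Eq.trans ?_ (DFunLike.congr_fun he (v i)).symm
  rw [← hp.mfderiv_add_lat u m, ← hm]
  rfl

/-! ### Smoothness and closedness of forms, read on the cover. -/

section Charts

variable [I.Boundaryless] [IsManifold I ∞ S]

/-- Here `h` is a local section of `p` written in the chart. Smoothness and closedness of the lifted
form thus pass to the charts, since `extDeriv` commutes with pullback. -/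
theorem exists_chartForm_eventuallyEq (x₀ : S) {y₀ : E} (hy₀ : y₀ ∈ (extChartAt I x₀).target)
    {u : ℝ × ℝ} (hu : p u = (extChartAt I x₀).symm y₀) :
    ∃ h : E → ℝ × ℝ, h y₀ = u ∧ ContDiffAt ℝ ∞ h y₀ ∧
      ∀ {k : ℕ} (α : (x : S) → TangentSpace I x [⋀^Fin k]→L[ℝ] ℝ),
        chartForm I α x₀ =ᶠ[𝓝 y₀]
          fun y => (pullForm I p α (h y)).compContinuousLinearMap (fderiv ℝ h y) := by
  obtain ⟨s, h1, h2, h3, -⟩ := hp.exists_section u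
  rw [hu] at h1 h2 h3
  have hopen := isOpen_extChartAt_target (I := I) x₀
  have hsymm : ContMDiffAt 𝓘(ℝ, E) I ∞ (extChartAt I x₀).symm y₀ :=
    (contMDiffOn_extChartAt_symm x₀).contMDiffAt (hopen.mem_nhds hy₀)
  have hh : ContDiffAt ℝ ∞ (s ∘ (extChartAt I x₀).symm) y₀ :=
    (h1.comp y₀ hsymm).contDiffAt
  have heq : (extChartAt I x₀).symm =ᶠ[𝓝 y₀] p ∘ s ∘ (extChartAt I x₀).symm := by
    filter_upwards [hsymm.continuousAt.eventually h3] with y hy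
    exact hy.symm
  refine ⟨s ∘ (extChartAt I x₀).symm, h2, hh, fun α => ?_⟩
  filter_upwards [eventually_eventuallyEq_nhds.2 heq,
    (hh.of_le (m := 1) (by simp)).eventually (by simp)] with y hy hhy
  have hd : MDifferentiableAt 𝓘(ℝ, E) 𝓘(ℝ, ℝ × ℝ) (s ∘ (extChartAt I x₀).symm) y :=
    (hhy.differentiableAt one_ne_zero).mdifferentiableAt
  have e1 := mfderiv_comp y (hp.mdifferentiableAt _) hd
  have e2 : (mfderivWithin 𝓘(ℝ, E) I (extChartAt I x₀).symm (Set.range I) y : E →L[ℝ] E) =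
      mfderiv 𝓘(ℝ, E) I (p ∘ s ∘ (extChartAt I x₀).symm) y := by
    rw [I.range_eq_univ, mfderivWithin_univ]
    exact hy.mfderiv_eq
  ext v
  refine form_congr α hy.eq_of_nhds fun i => ?_
  refine (DFunLike.congr_fun (e2.trans e1) (v i)).trans ?_
  rw [mfderiv_eq_fderiv]
  rfl

/-- The converse passage, from charts to the plane, by pullback along the chart composed with `p`.
-/
theorem pullForm_eventuallyEq (u : ℝ × ℝ) :
    ContDiffAt ℝ ∞ (extChartAt I (p u) ∘ p) u ∧
      ∀ {k : ℕ} (α : (x : S) → TangentSpace I x [⋀^Fin k]→L[ℝ] ℝ),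
        pullForm I p α =ᶠ[𝓝 u] fun v => (chartForm I α (p u)
          (extChartAt I (p u) (p v))).compContinuousLinearMap
            (fderiv ℝ (extChartAt I (p u) ∘ p) v) := by
  have hsrc := extChartAt_source_mem_nhds (I := I) (p u)
  have hg : ContDiffAt ℝ ∞ (extChartAt I (p u) ∘ p) u :=
    ((contMDiffAt_extChartAt (I := I)).comp u hp.smooth.contMDiffAt).contDiffAt
  have hpu := (hp.smooth.continuous.tendsto u).eventually hsrc
  have heq : p =ᶠ[𝓝 u] (extChartAt I (p u)).symm ∘ extChartAt I (p u) ∘ p := by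
    filter_upwards [hpu] with v hv
    exact ((extChartAt I (p u)).left_inv hv).symm
  refine ⟨hg, fun α => ?_⟩
  filter_upwards [eventually_eventuallyEq_nhds.2 heq, hpu,
    (hg.of_le (m := 1) (by simp)).eventually (by simp)] with v hv hsv hgv
  have hd : MDifferentiableAt 𝓘(ℝ, ℝ × ℝ) 𝓘(ℝ, E) (extChartAt I (p u) ∘ p) v :=
    (hgv.differentiableAt one_ne_zero).mdifferentiableAt
  have hs : MDifferentiableAt 𝓘(ℝ, E) I (extChartAt I (p u)).symm
      ((extChartAt I (p u) ∘ p) v) :=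
    ((contMDiffOn_extChartAt_symm (n := ∞) (p u)).contMDiffAt
      ((isOpen_extChartAt_target (I := I) (p u)).mem_nhds
        ((extChartAt I (p u)).map_source hsv))).mdifferentiableAt (by simp)
  have e1 := mfderiv_comp v hs hd
  have e2 : (mfderiv 𝓘(ℝ, ℝ × ℝ) I p v : ℝ × ℝ →L[ℝ] E) =
      mfderiv 𝓘(ℝ, ℝ × ℝ) I ((extChartAt I (p u)).symm ∘ extChartAt I (p u) ∘ p) v :=
    hv.mfderiv_eq
  ext w
  refine form_congr α hv.eq_of_nhds fun i => ?_
  refine (DFunLike.congr_fun (e2.trans e1) (w i)).trans ?_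
  rw [mfderiv_eq_fderiv, I.range_eq_univ, mfderivWithin_univ]
  rfl

variable [FiniteDimensional ℝ E] {α : (x : S) → TangentSpace I x [⋀^Fin k]→L[ℝ] ℝ}

theorem contDiff_pullForm (hα : IsSmoothForm I α) : ContDiff ℝ ∞ (pullForm I p α) := by
  refine contDiff_iff_contDiffAt.2 fun u => ?_
  obtain ⟨hg, h⟩ := hp.pullForm_eventuallyEq u
  have hmem : (extChartAt I (p u) ∘ p) u ∈ (extChartAt I (p u)).target :=
    mem_extChartAt_target (p u)
  refine ContDiffAt.congr_of_eventuallyEq ?_ (h α)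
  refine contDiffAt_compContinuousLinearMap ?_ (hg.fderiv_right (by simp))
  exact ((hα (p u)).contDiffAt ((isOpen_extChartAt_target (I := I) (p u)).mem_nhds hmem)).comp u hg

theorem isSmoothForm_of_pullForm (hα : ContDiff ℝ ∞ (pullForm I p α)) : IsSmoothForm I α := by
  intro x₀ y hy
  obtain ⟨u, hu⟩ := hp.surjective ((extChartAt I x₀).symm y)
  obtain ⟨h, -, h2, h3⟩ := hp.exists_chartForm_eventuallyEq x₀ hy hu
  refine (ContDiffAt.congr_of_eventuallyEq ?_ (h3 α)).contDiffWithinAt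
  exact contDiffAt_compContinuousLinearMap (hα.contDiffAt.comp y h2) (h2.fderiv_right (by simp))

omit [FiniteDimensional ℝ E] in
theorem extDeriv_pullForm (hα : IsSmoothForm I α) (hc : IsClosedForm I α) (u : ℝ × ℝ) :
    extDeriv (pullForm I p α) u = 0 := by
  obtain ⟨hg, h⟩ := hp.pullForm_eventuallyEq u
  have hmem : (extChartAt I (p u) ∘ p) u ∈ (extChartAt I (p u)).target :=
    mem_extChartAt_target (p u)
  have hd := ((hα (p u)).contDiffAt ((isOpen_extChartAt_target (I := I) (p u)).mem_nhds
    hmem)).differentiableAt (by simp)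
  have hcl := hc (p u) _ hmem
  rw [I.range_eq_univ, extDerivWithin_univ] at hcl
  rw [(h α).extDeriv_eq]
  refine (extDeriv_pullback hd hg (by simpa using two_le_infty)).trans ?_
  rw [hcl]
  ext v
  rfl

omit [FiniteDimensional ℝ E] in
theorem isClosedForm_of_pullForm (hα : ContDiff ℝ ∞ (pullForm I p α))
    (hc : ∀ u, extDeriv (pullForm I p α) u = 0) : IsClosedForm I α := by
  intro x₀ y hy
  obtain ⟨u, hu⟩ := hp.surjective ((extChartAt I x₀).symm y)
  obtain ⟨h, -, h2, h3⟩ := hp.exists_chartForm_eventuallyEq x₀ hy hu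
  rw [I.range_eq_univ, extDerivWithin_univ, (h3 α).extDeriv_eq]
  refine (extDeriv_pullback (hα.differentiable (by simp) _) h2
    (by simpa using two_le_infty)).trans ?_
  rw [hc]
  ext v
  rfl

end Charts

end IsTorusCover

end Lift

end TorusField

namespace TorusField

open Filter Function

/-! ### Area forms and closed forms -/

section Interior

variable {E : Type*} [NormedAddCommGroup E] [NormedSpace ℝ E]
  {H : Type*} [TopologicalSpace H] {I : ModelWithCorners ℝ E H}
  {S : Type*} [TopologicalSpace S] [ChartedSpace H S] {k : ℕ}

/-- The interior product of a vector field on a manifold with a form. -/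
def interiorForm (X : (x : S) → TangentSpace I x)
    (μ : (x : S) → TangentSpace I x [⋀^Fin (k + 1)]→L[ℝ] ℝ) (x : S) :
    TangentSpace I x [⋀^Fin k]→L[ℝ] ℝ :=
  ContinuousAlternatingMap.curryLeft (E := E) (μ x) (X x)

theorem interiorForm_apply (X : (x : S) → TangentSpace I x)
    (μ : (x : S) → TangentSpace I x [⋀^Fin (k + 1)]→L[ℝ] ℝ) (x : S)
    (v : Fin k → TangentSpace I x) : interiorForm X μ x v = μ x (Matrix.vecCons (X x) v) := rfl

theorem chartForm_interiorForm [IsManifold I ∞ S] (X : (x : S) → TangentSpace I x)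
    (μ : (x : S) → TangentSpace I x [⋀^Fin (k + 1)]→L[ℝ] ℝ) (x₀ : S) {y : E}
    (hy : y ∈ (extChartAt I x₀).target) :
    chartForm I (interiorForm X μ) x₀ y = interior (chartField I X x₀) (chartForm I μ x₀) y := by
  have : IsManifold I 1 S := IsManifold.of_le (n := ∞) (by simp)
  obtain ⟨e, he⟩ := isInvertible_mfderivWithin_extChartAt_symm hy
  ext v
  refine congrArg (μ ((extChartAt I x₀).symm y)) (funext fun i => ?_)
  refine Fin.cases ?_ (fun j => rfl) i
  change X ((extChartAt I x₀).symm y) = mfderivWithin 𝓘(ℝ, E) I (extChartAt I x₀).symm (Set.range I) y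
    (chartField I X x₀ y : E)
  rw [chartField, VectorField.mpullbackWithin_apply, ← he, ContinuousLinearMap.inverse_equiv]
  exact (e.apply_symm_apply _).symm

variable [I.Boundaryless] [IsManifold I ∞ S] [FiniteDimensional ℝ E]
  {X : (x : S) → TangentSpace I x}

theorem contDiffAt_chartField (hX : IsSmoothField I X) (x₀ : S) {y : E}
    (hy : y ∈ (extChartAt I x₀).target) : ContDiffAt ℝ ∞ (chartField I X x₀) y := by
  have : IsManifold I 1 S := IsManifold.of_le (n := ∞) (by simp)
  have hinv := isInvertible_mfderivWithin_extChartAt_symm hy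
  rw [I.range_eq_univ, mfderivWithin_univ] at hinv
  rw [chartField, I.range_eq_univ, VectorField.mpullbackWithin_univ]
  exact contMDiffAt_vectorSpace_iff_contDiffAt.1
    (ContMDiffAt.mpullback_vectorField_preimage (hX _)
      ((contMDiffOn_extChartAt_symm (n := ∞) x₀).contMDiffAt
        ((isOpen_extChartAt_target (I := I) x₀).mem_nhds hy)) hinv (by simp))

theorem isSmoothForm_interiorForm {μ : (x : S) → TangentSpace I x [⋀^Fin (k + 1)]→L[ℝ] ℝ}
    (hX : IsSmoothField I X) (hμ : IsSmoothForm I μ) : IsSmoothForm I (interiorForm X μ) := by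
  intro x₀ y hy
  have hn := (isOpen_extChartAt_target (I := I) x₀).mem_nhds hy
  refine (ContDiffAt.congr_of_eventuallyEq
    (contDiffAt_interior (contDiffAt_chartField hX x₀ hy) ((hμ x₀).contDiffAt hn))
    ?_).contDiffWithinAt
  filter_upwards [hn] with z hz
  exact chartForm_interiorForm X μ x₀ hz

/-- On a surface, a field preserves a `2`-form exactly if its interior product with the form is
closed. -/
theorem preserves_iff_isClosedForm (hE : Module.finrank ℝ E = 2)
    {μ : (x : S) → TangentSpace I x [⋀^Fin 2]→L[ℝ] ℝ} (hX : IsSmoothField I X)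
    (hμ : IsSmoothForm I μ) : Preserves I X μ ↔ IsClosedForm I (interiorForm X μ) := by
  refine forall_congr' fun x₀ => forall₂_congr fun y hy => ?_
  have hn := (isOpen_extChartAt_target (I := I) x₀).mem_nhds hy
  have heq : chartForm I (interiorForm X μ) x₀ =ᶠ[𝓝 y]
      interior (chartField I X x₀) (chartForm I μ x₀) := by
    filter_upwards [hn] with z hz
    exact chartForm_interiorForm X μ x₀ hz
  rw [I.range_eq_univ, extDerivWithin_univ, heq.extDeriv_eq, ContinuousAlternatingMap.ext_iff]
  refine forall_congr' fun v => ?_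
  rw [extDeriv_interior hE ((contDiffAt_chartField hX x₀ hy).of_le (by simp))
    (((hμ x₀).contDiffAt hn).of_le (by simp))]
  rfl

/-- The form is ι_X μ: closed by Cartan's formula, nowhere zero because a non-zero 2-form on a plane
is non-degenerate, and zero on `X` by antisymmetry. -/
theorem PreservesAreaForm.isWinding (hE : Module.finrank ℝ E = 2) (hX : IsSmoothField I X)
    (hX0 : ∀ x, X x ≠ 0) (h : PreservesAreaForm I X) : IsWinding I X := by
  obtain ⟨μ, h1, h2, h3⟩ := h
  refine ⟨by simp [hX0], interiorForm X μ, isSmoothForm_interiorForm hX h1,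
    (preserves_iff_isClosedForm hE hX h1).1 h3, fun x h0 => ?_, fun x => ?_⟩
  · obtain ⟨v, hv⟩ := exists_apply_pair_ne_zero (E := E) hE (h2 x) (hX0 x)
    refine hv ?_
    exact DFunLike.congr_fun h0 ![v]
  · rw [interiorForm_apply]
    exact (μ x).map_eq_zero_of_eq _ (show Matrix.vecCons (X x) (fun _ : Fin 1 => X x) 0 =
      Matrix.vecCons (X x) (fun _ : Fin 1 => X x) 1 from rfl) (by decide)

end Interior

/-! ### Linearisability in terms of covers -/

section Linear

variable {E : Type*} [NormedAddCommGroup E] [NormedSpace ℝ E]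
  {H : Type*} [TopologicalSpace H] {I : ModelWithCorners ℝ E H}
  {S : Type*} [TopologicalSpace S] [ChartedSpace H S] {X : (x : S) → TangentSpace I x}

/-- A linearisation amounts to a cover on which `X` is constant: any two covers have the same deck
group, so a diffeomorphism carries `q` to `torusProj`. -/
theorem IsTorusCover.isLinearisable {q : ℝ × ℝ → S} (hq : IsTorusCover I q) {e : ℝ × ℝ}
    (he : ∀ u, mfderiv 𝓘(ℝ, ℝ × ℝ) I q u e = X (q u)) : IsLinearisable I X := by
  obtain ⟨Φ, hΦ⟩ := hq.exists_diffeomorph isTorusCover_torusProj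
  refine ⟨e.1, e.2, Φ, fun x u hxu => ?_⟩
  obtain rfl : x = q u := by
    rw [← hΦ] at hxu
    exact Φ.injective hxu
  have h1 := mfderiv_comp u (Φ.contMDiff.mdifferentiableAt (by simp)) (hq.mdifferentiableAt u)
  have h2 : (mfderiv 𝓘(ℝ, ℝ × ℝ) torusModel (Φ ∘ q) u :
      ℝ × ℝ →L[ℝ] EuclideanSpace ℝ (Fin 1) × EuclideanSpace ℝ (Fin 1)) =
      mfderiv 𝓘(ℝ, ℝ × ℝ) torusModel torusProj u := by
    rw [show Φ ∘ q = torusProj from funext hΦ]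
  rw [← he u]
  exact (DFunLike.congr_fun h1 e).symm.trans (DFunLike.congr_fun h2 e)

theorem IsLinearisable.exists_cover (h : IsLinearisable I X) :
    ∃ q, IsTorusCover I q ∧ ∃ e : ℝ × ℝ, ∀ u, mfderiv 𝓘(ℝ, ℝ × ℝ) I q u e = X (q u) := by
  obtain ⟨a, b, Φ, hΦ⟩ := h
  have hq := isTorusCover_torusProj.comp_diffeomorph Φ.symm
  refine ⟨_, hq, (a, b), fun u => ?_⟩
  have hqu : ∀ v, Φ ((Φ.symm ∘ torusProj) v) = torusProj v := fun v => Φ.apply_symm_apply _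
  have h0 := hΦ _ u (hqu u)
  have h1 := mfderiv_comp u (Φ.contMDiff.mdifferentiableAt (by simp)) (hq.mdifferentiableAt u)
  have h2 : (mfderiv 𝓘(ℝ, ℝ × ℝ) torusModel (Φ ∘ Φ.symm ∘ torusProj) u :
      ℝ × ℝ →L[ℝ] EuclideanSpace ℝ (Fin 1) × EuclideanSpace ℝ (Fin 1)) =
      mfderiv 𝓘(ℝ, ℝ × ℝ) torusModel torusProj u := by
    rw [show Φ ∘ Φ.symm ∘ torusProj = torusProj from funext hqu]
  have hinj : Injective (mfderiv I torusModel Φ ((Φ.symm ∘ torusProj) u)) :=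
    (Φ.mfderivToContinuousLinearEquiv (by simp) _).injective
  apply hinj
  exact ((DFunLike.congr_fun h1 (a, b)).symm.trans (DFunLike.congr_fun h2 (a, b))).trans h0.symm

end Linear

end TorusField

namespace TorusField

open Filter Function

/-! ### Primitives on the plane -/

/-- A closed `1`-form on the plane has a primitive. -/
theorem exists_primitive {β : ℝ × ℝ → (ℝ × ℝ) [⋀^Fin 1]→L[ℝ] ℝ} (hβ : ContDiff ℝ ∞ β)
    (hc : ∀ u, extDeriv β u = 0) :
    ∃ F : ℝ × ℝ → ℝ, ContDiff ℝ ∞ F ∧ ∀ u v, fderiv ℝ F u v = β u fun _ => v := by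
  let A : ℝ × ℝ → ℝ × ℝ →L[ℝ] ℝ := fun u => (ContinuousAlternatingMap.ofSubsingleton ℝ (ℝ × ℝ) ℝ
    (0 : Fin 1)).symm (β u)
  have hA : ∀ u v, A u v = β u fun _ => v := fun u v => rfl
  have hAs : ContDiff ℝ ∞ A := contDiff_clm_apply_iff.2 fun v => contDiff_iff_contDiffAt.2 fun u =>
    contDiffAt_alternating_apply (v := fun _ _ => v) hβ.contDiffAt fun _ => contDiffAt_const
  have hAd := hAs.differentiable (by simp)
  -- Closedness of the form is symmetry of the derivative of `A`, which is the hypothesis of the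
  -- Poincaré lemma on a convex set.
  have hsymm : ∀ u v w, fderiv ℝ A u v w = fderiv ℝ A u w v := fun u v w => by
    have h := DFunLike.congr_fun (hc u) ![v, w]
    rw [extDeriv_one_apply (hβ.differentiable (by simp) u)] at h
    have e : ∀ a b, fderiv ℝ (fun x => β x fun _ => a) u b = fderiv ℝ A u b a := fun a b => by
      have := ((hAd u).hasFDerivAt.clm_apply (hasFDerivAt_const a u)).fderiv
      simp only [hA] at this
      rw [this]
      simp
    rw [e, e] at h
    exact sub_eq_zero.1 h
  obtain ⟨F, hF⟩ := convex_univ.exists_forall_hasFDerivAt_of_fderiv_symmetric isOpen_univ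
    hAd.differentiableOn fun u _ v w => hsymm u v w
  have hF' : ∀ u, fderiv ℝ F u = A u := fun u => (hF u trivial).fderiv
  refine ⟨F, ?_, fun u v => by rw [hF', hA]⟩
  rw [contDiff_infty_iff_fderiv]
  exact ⟨fun u => (hF u trivial).differentiableAt, by rwa [funext hF']⟩

/-- A function with periodic differential is periodic up to a linear function. -/
theorem exists_period {F : ℝ × ℝ → ℝ} (hF : Differentiable ℝ F)
    (hper : ∀ u m, fderiv ℝ F (u + lat m) = fderiv ℝ F u) :
    ∃ c : ℝ × ℝ, ∀ u (m : ℤ × ℤ), F (u + lat m) = F u + (c.1 * m.1 + c.2 * m.2) := by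
  have hconst : ∀ m u, F (u + lat m) - F u = F (0 + lat m) - F 0 := fun m u => by
    have hd : Differentiable ℝ fun u => F (u + lat m) :=
      hF.comp (differentiable_id.add_const _)
    refine is_const_of_fderiv_eq_zero (f := fun u => F (u + lat m) - F u) (hd.sub hF)
      (fun x => ?_) u 0
    rw [fderiv_fun_sub (hd x) (hF x), fderiv_comp_add_right, hper, sub_self]
  -- As the increment F(u + m) - F(u) does not depend on `u`, it is additive in `m`.
  let C : ℤ × ℤ →+ ℝ :=
    { toFun := fun m => F (0 + lat m) - F 0
      map_zero' := by simp
      map_add' := fun m n => by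
        have := hconst n (0 + lat m)
        rw [map_add, ← add_assoc]
        linarith }
  refine ⟨(C (1, 0), C (0, 1)), fun u m => ?_⟩
  have h1 : C m = m.1 • C (1, 0) + m.2 • C (0, 1) := by
    rw [← map_zsmul, ← map_zsmul, ← map_add]
    congr 1
    ext <;> simp
  have h2 := hconst m u
  change _ = C m at h2
  rw [h1] at h2
  simp only [zsmul_eq_mul] at h2
  linarith

/-- The standard area form of the plane. -/
def areaForm : (ℝ × ℝ) [⋀^Fin 2]→L[ℝ] ℝ :=
  { (Module.Basis.finTwoProd ℝ).det with
    cont := by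
      have h : ∀ v : Fin 2 → ℝ × ℝ, (Module.Basis.finTwoProd ℝ).det v =
          (v 0).1 * (v 1).2 - (v 1).1 * (v 0).2 := fun v => by
        simp [Module.Basis.det_apply, Matrix.det_fin_two, Module.Basis.toMatrix_apply]
      change Continuous fun v => (Module.Basis.finTwoProd ℝ).det v
      simp only [h]
      fun_prop }

theorem areaForm_ne_zero : areaForm ≠ 0 := fun h => by
  have h1 := DFunLike.congr_fun h (fun i => Module.Basis.finTwoProd ℝ i)
  exact one_ne_zero ((Module.Basis.finTwoProd ℝ).det_self.symm.trans h1)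

/-! ### The implications between the three conditions. -/

section Equivalence

variable {E : Type*} [NormedAddCommGroup E] [NormedSpace ℝ E]
  {H : Type*} [TopologicalSpace H] {I : ModelWithCorners ℝ E H}
  {S : Type*} [TopologicalSpace S] [ChartedSpace H S] {X : (x : S) → TangentSpace I x}
  {p : ℝ × ℝ → S}

theorem IsTorusCover.isLinearisable_of_latticeDiffeo (hp : IsTorusCover I p) {D : ℝ × ℝ → ℝ × ℝ}
    (hD : IsLatticeDiffeo D) {e : ℝ × ℝ} (he : ∀ u, fderiv ℝ D u (pullField I p X u) = e) :
    IsLinearisable I X := by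
  obtain ⟨q, hq, hqD⟩ := hp.comp_latticeDiffeo_inv hD
  refine hq.isLinearisable (e := e) fun u => ?_
  obtain ⟨u, rfl⟩ := hD.bijective.surjective u
  have h1 := mfderiv_comp u (hq.mdifferentiableAt (D u))
    (hD.smooth.differentiable (by simp) u).mdifferentiableAt
  have h2 : (mfderiv 𝓘(ℝ, ℝ × ℝ) I (q ∘ D) u : ℝ × ℝ →L[ℝ] E) = mfderiv 𝓘(ℝ, ℝ × ℝ) I p u := by
    rw [show q ∘ D = p from funext hqD]
  have h3 := (DFunLike.congr_fun h1 (pullField I p X u)).symm.trans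
    (DFunLike.congr_fun h2 (pullField I p X u))
  rw [mfderiv_eq_fderiv] at h3
  have h4 := (h3.trans (hp.mfderiv_pullField X u)).trans (field_congr X (hqD u).symm)
  refine Eq.trans ?_ h4
  rw [← he u]
  rfl

theorem IsTorusCover.pullForm_apply_pullField (hp : IsTorusCover I p)
    (α : (x : S) → TangentSpace I x [⋀^Fin 1]→L[ℝ] ℝ) (u : ℝ × ℝ) :
    pullForm I p α u (fun _ => pullField I p X u) = α (p u) fun _ => X (p u) := by
  rw [← hp.mfderiv_pullField X u]
  rfl

theorem IsTorusCover.pullField_smul (hp : IsTorusCover I p) (f : S → ℝ) (u : ℝ × ℝ) :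
    pullField I p (fun x => f x • X x) u = f (p u) • pullField I p X u := by
  apply hp.mfderiv_injective u
  rw [hp.mfderiv_pullField]
  refine Eq.trans ?_ (ContinuousLinearMap.map_smul _ _ _).symm
  rw [hp.mfderiv_pullField]

/-- A semi-linearisable field is a positive multiple of a constant field, on a suitable cover. -/
theorem IsSemiLinearisable.exists_cover (h : IsSemiLinearisable I X) :
    ∃ q, IsTorusCover I q ∧ ∃ (e : ℝ × ℝ) (f : S → ℝ), ContMDiff I 𝓘(ℝ, ℝ) ∞ f ∧ (∀ x, 0 < f x) ∧
      ∀ u, pullField I q X u = f (q u) • e := by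
  obtain ⟨f, hf, hpos, hl⟩ := h
  obtain ⟨q, hq, e, he⟩ := hl.exists_cover
  refine ⟨q, hq, e, f, hf, hpos, fun u => hq.mfderiv_injective u ?_⟩
  rw [hq.mfderiv_pullField]
  refine Eq.trans ?_ (ContinuousLinearMap.map_smul _ _ _).symm
  rw [he, smul_smul, mul_inv_cancel₀ (hpos _).ne', one_smul]

variable [FiniteDimensional ℝ E] [I.Boundaryless] [IsManifold I ∞ S]

theorem IsTorusCover.exists_primitive (hp : IsTorusCover I p)
    {α : (x : S) → TangentSpace I x [⋀^Fin 1]→L[ℝ] ℝ} (hα : IsSmoothForm I α)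
    (hc : IsClosedForm I α) :
    ∃ F : ℝ × ℝ → ℝ, ContDiff ℝ ∞ F ∧ (∀ u v, fderiv ℝ F u v = pullForm I p α u fun _ => v) ∧
      ∃ c : ℝ × ℝ, ∀ u (m : ℤ × ℤ), F (u + lat m) = F u + (c.1 * m.1 + c.2 * m.2) := by
  obtain ⟨F, hF, hFα⟩ := TorusField.exists_primitive (hp.contDiff_pullForm hα)
    (hp.extDeriv_pullForm hα hc)
  refine ⟨F, hF, hFα, exists_period (hF.differentiable (by simp)) fun u m => ?_⟩
  refine ContinuousLinearMap.ext fun v => ?_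
  rw [hFα, hFα, hp.pullForm_add_lat]

/-- In the coordinates `D` the lifted form is the constant covector `c`. The field becomes `W` with
c·W = 0, so it is a multiple `g` of a fixed vector, and `g` descends to the required factor `f`. -/
theorem IsWinding.isSemiLinearisable (hp : IsTorusCover I p) (hX : IsSmoothField I X)
    (hX0 : ∀ x, X x ≠ 0) (h : IsWinding I X) : IsSemiLinearisable I X := by
  obtain ⟨-, α, h1, h2, h3, h4⟩ := h
  obtain ⟨F, hF, hFα, c, hc⟩ := hp.exists_primitive h1 h2
  have hne : ∀ u, fderiv ℝ F u ≠ 0 := fun u h0 => by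
    refine h3 (p u) ?_
    ext v
    obtain ⟨w, hw⟩ := hp.mfderiv_surjective u (v 0)
    have h5 := hFα u w
    rw [h0] at h5
    have h6 : v = fun _ => mfderiv 𝓘(ℝ, ℝ × ℝ) I p u w := by
      ext1 i
      rw [Subsingleton.elim i 0, hw]
    rw [h6]
    exact h5.symm
  obtain ⟨hc0, D, hD, hFD⟩ := exists_isLatticeDiffeo_of_submersion hF hc hne
  let W : ℝ × ℝ → ℝ × ℝ := fun u => fderiv ℝ D u (pullField I p X u)
  have hWs : ContDiff ℝ ∞ W :=
    (hD.smooth.fderiv_right (m := ∞) (by simp)).clm_apply (hp.contDiff_pullField hX)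
  have hWper : ∀ u m, W (u + lat m) = W u := fun u m => by
    simp only [W, hp.pullField_add_lat]
    rw [fderiv_periodic fun z => hD.map_add z m]
  have hW0 : ∀ u, W u ≠ 0 := fun u h0 => by
    have h5 := hD.ker_fderiv u _ h0
    have h6 := hp.mfderiv_pullField X u
    rw [h5] at h6
    exact hX0 (p u) (h6.symm.trans (ContinuousLinearMap.map_zero _))
  have hcW : ∀ u, dotCLM c (W u) = 0 := fun u => by
    have h5 : fderiv ℝ F u = (dotCLM c).comp (fderiv ℝ D u) := by
      rw [show F = dotCLM c ∘ D from funext hFD]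
      exact ((dotCLM c).hasFDerivAt.comp u
        (hD.smooth.differentiable (by simp) u).hasFDerivAt).fderiv
    have h6 := hFα u (pullField I p X u)
    rw [hp.pullForm_apply_pullField, h4, h5] at h6
    exact h6
  set N := c.1 * c.1 + c.2 * c.2 with hN
  have hN0 : 0 < N := sq_add_sq_pos hc0
  have key : ∃ (e : ℝ × ℝ) (g : ℝ × ℝ → ℝ), ContDiff ℝ ∞ g ∧ (∀ u m, g (u + lat m) = g u) ∧
      (∀ u, 0 < g u) ∧ ∀ u, W u = g u • e := by
    let e : ℝ × ℝ := (-c.2, c.1)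
    let g : ℝ × ℝ → ℝ := fun u => dotCLM e (W u) / N
    have hg : ContDiff ℝ ∞ g := ((dotCLM e).contDiff.comp hWs).div_const _
    have hgper : ∀ u m, g (u + lat m) = g u := fun u m => by simp only [g, hWper]
    have hgW : ∀ u, W u = g u • e := fun u => by
      have h5 := hcW u
      rw [dotCLM_apply] at h5
      ext
      · simp only [g, e, dotCLM_apply, Prod.smul_fst, smul_eq_mul]
        field_simp
        rw [hN]
        linear_combination c.1 * h5
      · simp only [g, e, dotCLM_apply, Prod.smul_snd, smul_eq_mul]
        field_simp
        rw [hN]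
        linear_combination c.2 * h5
    have hg0 : ∀ u, g u ≠ 0 := fun u h0 => hW0 u (by rw [hgW, h0, zero_smul])
    -- `g` vanishes nowhere on the connected plane, so it has constant sign; if it is negative, the
    -- sign is moved to `e`.
    by_cases hpos : ∀ u, 0 < g u
    · exact ⟨e, g, hg, hgper, hpos, hgW⟩
    · push Not at hpos
      obtain ⟨a, ha⟩ := hpos
      refine ⟨-e, fun u => -g u, hg.neg, fun u m => congrArg _ (hgper u m), fun u => ?_,
        fun u => by rw [hgW]; simp⟩
      by_contra hu
      obtain ⟨b, hb⟩ := mem_range_of_exists_le_of_exists_ge hg.continuous ⟨a, ha⟩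
        ⟨u, by linarith⟩
      exact hg0 b hb
  obtain ⟨e, g, hg, hgper, hgpos, hgW⟩ := key
  obtain ⟨f, hf, hfp⟩ := hp.exists_descend (I' := 𝓘(ℝ, ℝ)) hg.contMDiff hgper
  refine ⟨f, hf, fun x => ?_, hp.isLinearisable_of_latticeDiffeo hD (e := e) fun u => ?_⟩
  · obtain ⟨u, rfl⟩ := hp.surjective x
    rw [hfp]
    exact hgpos u
  · rw [hp.pullField_smul (fun x => (f x)⁻¹), hfp, map_smul]
    change (g u)⁻¹ • W u = e
    rw [hgW, smul_smul, inv_mul_cancel₀ (hgpos u).ne', one_smul]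

/-- Where X = f e on the cover, the factors cancel in the contraction of `X` with f⁻¹ dx∧dy, leaving
a constant form. -/
theorem IsSemiLinearisable.preservesAreaForm (hE : Module.finrank ℝ E = 2)
    (hX : IsSmoothField I X) (h : IsSemiLinearisable I X) : PreservesAreaForm I X := by
  obtain ⟨q, hq, e, f, hf, hpos, hqX⟩ := h.exists_cover
  obtain ⟨μ, hμ⟩ := hq.exists_form (β := fun u => (f (q u))⁻¹ • areaForm)
    fun u m => by rw [hq.map_add_lat]
  have hfq : ContDiff ℝ ∞ fun u => f (q u) := (hf.comp hq.smooth).contDiff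
  have hμs : IsSmoothForm I μ := hq.isSmoothForm_of_pullForm <| by
    rw [funext hμ]
    exact (hfq.inv fun u => (hpos _).ne').smul contDiff_const
  have hι : pullForm I q (interiorForm X μ) = fun _ => areaForm.curryLeft e := by
    ext u v
    have h1 : pullForm I q (interiorForm X μ) u v =
        pullForm I q μ u (Matrix.vecCons (pullField I q X u) v) := by
      refine congrArg (μ (q u)) (funext fun i => ?_)
      refine Fin.cases ?_ (fun j => rfl) i
      exact (hq.mfderiv_pullField X u).symm
    rw [h1, hμ, hqX]
    change (f (q u))⁻¹ • areaForm.toAlternatingMap _ = areaForm.toAlternatingMap _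
    rw [AlternatingMap.map_vecCons_smul, smul_smul, inv_mul_cancel₀ (hpos _).ne', one_smul]
    rfl
  refine ⟨μ, hμs, fun x h0 => ?_, (preserves_iff_isClosedForm hE hX hμs).2
    (hq.isClosedForm_of_pullForm (by rw [hι]; exact contDiff_const) fun u => ?_)⟩
  · obtain ⟨u, rfl⟩ := hq.surjective x
    have h1 : pullForm I q μ u = 0 := by
      ext v
      exact DFunLike.congr_fun h0 _
    rw [hμ] at h1
    exact (smul_ne_zero (inv_ne_zero (hpos _).ne') areaForm_ne_zero) h1
  · rw [hι]
    ext v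
    rw [show v = ![v 0, v 1] by ext i <;> fin_cases i <;> rfl,
      extDeriv_one_apply (differentiableAt_const _)]
    simp

end Equivalence

end TorusField

namespace TorusField

open Filter Function Set

/-! ### Loops on the torus, lifted to the plane -/

section Loops

variable {E : Type*} [NormedAddCommGroup E] [NormedSpace ℝ E]
  {H : Type*} [TopologicalSpace H] {I : ModelWithCorners ℝ E H}
  {S : Type*} [TopologicalSpace S] [ChartedSpace H S] {q : ℝ × ℝ → S}

theorem lat_injective : Injective lat := fun m n h => by
  have h1 := congrArg Prod.fst h
  have h2 := congrArg Prod.snd h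
  simp only [lat_fst, lat_snd, Int.cast_inj] at h1 h2
  exact Prod.ext h1 h2

namespace IsTorusCover

variable (hq : IsTorusCover I q)
include hq

theorem isOpenMap : IsOpenMap q := by
  refine IsOpenMap.of_nhds_le fun u V hV => ?_
  obtain ⟨s, h1, h2, h3, -⟩ := hq.exists_section u
  have hs : Tendsto s (𝓝 (q u)) (𝓝 u) := by
    have := h1.continuousAt.tendsto
    rwa [h2] at this
  filter_upwards [hs hV, h3] with x hx hx'
  rw [← hx']
  exact hx

theorem isAddQuotientCoveringMap : IsAddQuotientCoveringMap q lat.range where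
  toIsQuotientMap := hq.isOpenMap.isQuotientMap hq.smooth.continuous hq.surjective
  continuous_const_vadd g := continuous_const.add continuous_id
  apply_eq_iff_mem_orbit {a b} := by
    rw [eq_comm, hq.eq_iff]
    constructor
    · rintro ⟨m, rfl⟩
      exact ⟨⟨lat m, m, rfl⟩, add_comm _ _⟩
    · rintro ⟨⟨_, m, rfl⟩, rfl⟩
      exact ⟨m, add_comm _ _⟩
  disjoint u := by
    obtain ⟨s, -, -, -, h4⟩ := hq.exists_section u
    refine ⟨_, h4, ?_⟩
    rintro ⟨_, m, rfl⟩ ⟨_, ⟨v, hv, rfl⟩, hw⟩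
    have h5 : lat m + v = v := by
      change s (q (lat m + v)) = lat m + v at hw
      rw [← hw, add_comm, hq.map_add_lat]
      exact hv
    exact Subtype.ext (add_eq_right.1 h5)

/-- Every loop is lifted to a path in the plane, whose displacement is given by a homomorphism from
the fundamental group onto the lattice. -/
theorem exists_displacement (u : ℝ × ℝ) :
    ∃ ρ : FundamentalGroup S (q u) →* Multiplicative (ℝ × ℝ),
      (∀ m, ∃ γ, ρ γ = Multiplicative.ofAdd (lat m)) ∧
      ∀ c : Path (q u) (q u), ∃ Γ : C(unitInterval, ℝ × ℝ), q ∘ Γ = c ∧ Γ 0 = u ∧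
        ∃ m, ρ (FundamentalGroup.fromPath (Path.Homotopic.Quotient.mk c)) =
          Multiplicative.ofAdd (lat m) ∧ Γ 1 = u + lat m := by
  have hcov := hq.isAddQuotientCoveringMap
  let e : q ⁻¹' {q u} := ⟨u, rfl⟩
  -- Monodromy takes values in the opposite of the deck group, which is harmless as the lattice is
  -- commutative. Commutativity of the target also lets `ρ` factor through homology later.
  let τ : (Multiplicative lat.range)ᵐᵒᵖ →* Multiplicative (ℝ × ℝ) :=
    { toFun := fun g => Multiplicative.ofAdd ((Multiplicative.toAdd g.unop : lat.range) : ℝ × ℝ)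
      map_one' := rfl
      map_mul' := fun g h => congrArg Multiplicative.ofAdd (add_comm _ _) }
  refine ⟨τ.comp (hcov.fundamentalGroupToMulOpposite e), fun m => ?_, fun c => ?_⟩
  · obtain ⟨γ, hγ⟩ := hcov.fundamentalGroupToMulOpposite_surjective e
      (MulOpposite.op (Multiplicative.ofAdd ⟨lat m, m, rfl⟩))
    exact ⟨γ, by rw [MonoidHom.comp_apply, hγ]; rfl⟩
  · refine ⟨hcov.isCoveringMap.liftPath c u c.source, hcov.isCoveringMap.liftPath_lifts _ _ _,
      hcov.isCoveringMap.liftPath_zero _ _ _, ?_⟩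
    have h := hcov.unop_fundamentalGroupToMulOpposite_smul (e := e)
      (γ := FundamentalGroup.fromPath (Path.Homotopic.Quotient.mk c))
    obtain ⟨m, hm⟩ := (Multiplicative.toAdd (hcov.fundamentalGroupToMulOpposite e
      (FundamentalGroup.fromPath (Path.Homotopic.Quotient.mk c))).unop).2
    refine ⟨m, congrArg Multiplicative.ofAdd hm.symm, ?_⟩
    rw [hm, add_comm]
    exact h.symm

theorem contDiffOn_lift {c : ℝ → S} {Γ : ℝ → ℝ × ℝ} {s : Set ℝ} (hΓ : Continuous Γ)
    (hqΓ : ∀ t, q (Γ t) = c t) (hc : ContMDiffOn 𝓘(ℝ, ℝ) I ∞ c s) : ContDiffOn ℝ ∞ Γ s := by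
  intro t ht
  obtain ⟨σ, h1, -, -, h4⟩ := hq.exists_section (Γ t)
  rw [hqΓ] at h1
  have h5 : ContMDiffWithinAt 𝓘(ℝ, ℝ) 𝓘(ℝ, ℝ × ℝ) ∞ (σ ∘ c) s t :=
    h1.comp_contMDiffWithinAt t (hc t ht)
  have h6 : ∀ᶠ t' in 𝓝 t, Γ t' = (σ ∘ c) t' := by
    filter_upwards [hΓ.continuousAt.eventually h4] with t' ht'
    rw [comp_apply, ← hqΓ]
    exact ht'.symm
  exact h5.contDiffWithinAt.congr_of_eventuallyEq (h6.filter_mono nhdsWithin_le_nhds)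
    h6.self_of_nhds

/-- Along the lifted loop the integrand is the derivative of `F`, so the fundamental theorem of
calculus applies. -/
theorem loopIntegral_eq {α : (x : S) → TangentSpace I x [⋀^Fin 1]→L[ℝ] ℝ} {F : ℝ × ℝ → ℝ}
    (hF : ContDiff ℝ ∞ F) (hFα : ∀ u v, fderiv ℝ F u v = pullForm I q α u fun _ => v) {x : S}
    {c : Path x x} (hc : IsSmoothLoop I c) {Γ : C(unitInterval, ℝ × ℝ)} (hΓ : q ∘ Γ = c) :
    loopIntegral I α c = F (Γ 1) - F (Γ 0) := by
  let G : ℝ → ℝ × ℝ := IccExtend zero_le_one Γ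
  have hG : Continuous G := Γ.continuous.Icc_extend'
  have hqG : q ∘ G = c.extend := by
    ext t
    exact congrFun hΓ (projIcc 0 1 zero_le_one t)
  have hGs : ContDiffOn ℝ ∞ G (Icc 0 1) := hq.contDiffOn_lift hG (congrFun hqG) hc
  have hGd : ∀ t ∈ Icc (0 : ℝ) 1, DifferentiableWithinAt ℝ G (Icc 0 1) t :=
    hGs.differentiableOn (by simp)
  have huniq := uniqueDiffOn_Icc_zero_one
  have hint := intervalIntegral.integral_derivWithin_Icc_of_contDiffOn_Icc (f := F ∘ G) (a := 0) (b := 1)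
    ((hF.comp_contDiffOn hGs).of_le (by simp)) zero_le_one
  have h0 : G 0 = Γ 0 := IccExtend_left _ _
  have h1 : G 1 = Γ 1 := IccExtend_right _ _
  rw [comp_apply, comp_apply, h0, h1] at hint
  rw [loopIntegral, ← hint]
  refine intervalIntegral.integral_congr fun t ht => ?_
  rw [uIcc_of_le zero_le_one] at ht
  have hmd : MDifferentiableWithinAt 𝓘(ℝ, ℝ) 𝓘(ℝ, ℝ × ℝ) G (Icc 0 1) t :=
    (hGd t ht).mdifferentiableWithinAt
  have e1 := mfderiv_comp_mfderivWithin t (hq.mdifferentiableAt (G t)) hmd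
    (huniq t ht).uniqueMDiffWithinAt
  have e2 : (mfderivWithin 𝓘(ℝ, ℝ) I c.extend (Icc 0 1) t : ℝ →L[ℝ] E) =
      mfderivWithin 𝓘(ℝ, ℝ) I (q ∘ G) (Icc 0 1) t := by
    rw [hqG]
  have e3 : derivWithin (F ∘ G) (Icc 0 1) t = fderiv ℝ F (G t) (derivWithin G (Icc 0 1) t) :=
    ((hF.differentiable (by simp) _).hasFDerivAt.comp_hasDerivWithinAt t
      (hGd t ht).hasDerivWithinAt).derivWithin (huniq t ht)
  rw [e3, hFα]
  refine form_congr α (congrFun hqG t).symm fun i => ?_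
  refine (DFunLike.congr_fun (e2.trans e1) 1).trans ?_
  rw [mfderivWithin_eq_fderivWithin]
  rfl

end IsTorusCover

/-- Loops generating the homology of the torus have displacements generating the lattice, and their
integrals are linear in the displacement. -/
theorem IsTorusCover.exists_generators (hq : IsTorusCover I q) {x : S} {c₁ c₂ : Path x x}
    (h1 : IsSmoothLoop I c₁) (h2 : IsSmoothLoop I c₂) (hgen : GenerateHomology c₁ c₂)
    {α : (x : S) → TangentSpace I x [⋀^Fin 1]→L[ℝ] ℝ} {F : ℝ × ℝ → ℝ} {c : ℝ × ℝ}
    (hF : ContDiff ℝ ∞ F) (hFα : ∀ u v, fderiv ℝ F u v = pullForm I q α u fun _ => v)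
    (hc : ∀ u (m : ℤ × ℤ), F (u + lat m) = F u + (c.1 * m.1 + c.2 * m.2)) :
    ∃ m₁ m₂ : ℤ × ℤ, loopIntegral I α c₁ = c.1 * m₁.1 + c.2 * m₁.2 ∧
      loopIntegral I α c₂ = c.1 * m₂.1 + c.2 * m₂.2 ∧ ∀ n, ∃ a b : ℤ, n = a • m₁ + b • m₂ := by
  obtain ⟨u, rfl⟩ := hq.surjective x
  obtain ⟨ρ, hsurj, hρ⟩ := hq.exists_displacement u
  obtain ⟨Γ₁, hΓ₁, h10, m₁, hm₁, h11⟩ := hρ c₁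
  obtain ⟨Γ₂, hΓ₂, h20, m₂, hm₂, h21⟩ := hρ c₂
  refine ⟨m₁, m₂, ?_, ?_, fun n => ?_⟩
  · rw [hq.loopIntegral_eq hF hFα h1 hΓ₁, h10, h11, hc]
    ring
  · rw [hq.loopIntegral_eq hF hFα h2 hΓ₂, h20, h21, hc]
    ring
  · obtain ⟨γ, hγ⟩ := hsurj n
    have hmem : Abelianization.of γ ∈ Subgroup.closure {homologyClass c₁, homologyClass c₂} := by
      rw [show Subgroup.closure {homologyClass c₁, homologyClass c₂} = ⊤ from hgen]
      trivial
    obtain ⟨a, b, hab⟩ := Subgroup.mem_closure_pair.1 hmem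
    have h := congrArg (Abelianization.lift ρ) hab
    rw [map_mul, map_zpow, map_zpow, homologyClass, homologyClass, Abelianization.lift_apply_of,
      Abelianization.lift_apply_of, Abelianization.lift_apply_of, hm₁, hm₂, hγ] at h
    refine ⟨a, b, lat_injective ?_⟩
    rw [map_add, map_zsmul, map_zsmul]
    exact (congrArg Multiplicative.toAdd h).symm

end Loops

end TorusField

namespace TorusField

open Filter Function Set

/-! ### Diophantine winding numbers -/

theorem hasDerivAt_comp_line {F : ℝ × ℝ → ℝ} (hF : Differentiable ℝ F) (z e : ℝ × ℝ) (t : ℝ) :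
    HasDerivAt (fun t => F (z + t • e)) (fderiv ℝ F (z + t • e) e) t := by
  have h1 : HasDerivAt (fun t : ℝ => z + t • e) e t := by
    simpa using ((hasDerivAt_id t).smul_const e).const_add z
  exact (hF _).hasFDerivAt.comp_hasDerivAt t h1

/-- The direction of constancy of a function is orthogonal to its period. -/
theorem dotCLM_eq_zero_of_fderiv_eq_zero {F : ℝ × ℝ → ℝ} (hF : ContDiff ℝ ∞ F) {c e : ℝ × ℝ}
    (hc : ∀ u (m : ℤ × ℤ), F (u + lat m) = F u + (c.1 * m.1 + c.2 * m.2))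
    (he : ∀ u, fderiv ℝ F u e = 0) : dotCLM c e = 0 := by
  have hd := hF.differentiable (by simp)
  obtain ⟨C, hC⟩ := exists_bound_of_periodic (f := fun u => F u - dotCLM c u)
    (hF.continuous.sub (dotCLM c).continuous)
    (fun z m => by simp only [hc, map_add, dotCLM_apply, lat_fst, lat_snd]; ring)
  have hconst : ∀ t : ℝ, F (0 + t • e) = F (0 + (0 : ℝ) • e) := fun t => by
    refine is_const_of_deriv_eq_zero (f := fun t : ℝ => F (0 + t • e))
      (fun t => (hasDerivAt_comp_line hd 0 e t).differentiableAt) (fun t => ?_) t 0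
    rw [(hasDerivAt_comp_line hd 0 e t).deriv, he]
  by_contra h0
  -- `F` is constant along the line of direction `e`, whereas `F - c·u` is bounded. Were c·e
  -- non-zero, c·u would reach |F 0| + C + 1 on this line and break the bound.
  have h1 := hC (0 + ((|F 0| + C + 1) / dotCLM c e) • e)
  rw [hconst, zero_smul, zero_add, zero_add, map_smul, smul_eq_mul, div_mul_cancel₀ _ h0,
    Real.norm_eq_abs, abs_le] at h1
  have := le_abs_self (F 0)
  linarith [h1.1]

/-- Orthogonality gives e = r(-c₂, c₁), so e·(k, l) = r c·(l, -k). Writing (l, -k) = y m₁ - x m₂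
with integers `x`, `y` turns this into r times the given form at (x, y). The passage from (k, l) to
(x, y) is linear and injective, so only the constant changes, not the exponent. -/
theorem IsDiophantine.of_generators {c e : ℝ × ℝ} {m₁ m₂ : ℤ × ℤ}
    (h : IsDiophantine (-(c.1 * m₂.1 + c.2 * m₂.2)) (c.1 * m₁.1 + c.2 * m₁.2))
    (hgen : ∀ n : ℤ × ℤ, ∃ a b : ℤ, n = a • m₁ + b • m₂) (hc : c ≠ 0) (he : e ≠ 0)
    (hce : dotCLM c e = 0) : IsDiophantine e.1 e.2 := by
  obtain ⟨γ, hγ, τ, hτ, h⟩ := h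
  obtain ⟨A, B, hAB⟩ := hgen (1, 0)
  obtain ⟨C, D, hCD⟩ := hgen (0, 1)
  rw [Prod.ext_iff] at hAB hCD
  simp only [Prod.fst_add, Prod.snd_add, Prod.smul_fst, Prod.smul_snd, smul_eq_mul] at hAB hCD
  rw [dotCLM_apply] at hce
  have hN : 0 < c.1 * c.1 + c.2 * c.2 := sq_add_sq_pos hc
  set N := c.1 * c.1 + c.2 * c.2 with hNdef
  set r := (c.1 * e.2 - c.2 * e.1) / N with hr
  have he1 : e.1 = -(r * c.2) := by
    rw [hr]
    field_simp
    linear_combination e.1 * hNdef + c.1 * hce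
  have he2 : e.2 = r * c.1 := by
    rw [hr]
    field_simp
    linear_combination e.2 * hNdef + c.2 * hce
  have hr0 : r ≠ 0 := fun h0 => he (Prod.ext (by simp [he1, h0]) (by simp [he2, h0]))
  -- `M` bounds the norm of the change of variables, by Cauchy–Schwarz; the `+ 1` makes its
  -- positivity immediate.
  set M : ℝ := Real.sqrt ((A : ℝ) ^ 2 + B ^ 2 + C ^ 2 + D ^ 2 + 1) with hM
  have hM0 : 0 < M := Real.sqrt_pos.2 (by positivity)
  refine ⟨|r| * (γ * M ^ (-τ)), by positivity, τ, hτ, fun k l hkl => ?_⟩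
  have hgen1 : ∀ k l : ℤ, l = (l * A - k * C) * m₁.1 + (l * B - k * D) * m₂.1 := fun k l => by
    linear_combination l * hAB.1 - k * hCD.1
  have hgen2 : ∀ k l : ℤ, -k = (l * A - k * C) * m₁.2 + (l * B - k * D) * m₂.2 := fun k l => by
    linear_combination l * hAB.2 - k * hCD.2
  have hne : (-(l * B - k * D), l * A - k * C) ≠ ((0, 0) : ℤ × ℤ) := fun h0 => by
    obtain ⟨h01, h02⟩ := Prod.mk.inj h0
    have h1 := hgen1 k l
    have h2 := hgen2 k l
    rw [h02, neg_eq_zero.1 h01] at h1 h2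
    simp only [zero_mul, add_zero, neg_eq_zero] at h1 h2
    exact hkl (by rw [h1, h2])
  have h1 := h _ _ hne
  have hkl0 : 0 < Real.sqrt ((k : ℝ) ^ 2 + (l : ℝ) ^ 2) := by
    refine Real.sqrt_pos.2 ?_
    by_contra hle
    have hk : (k : ℝ) = 0 := by nlinarith [sq_nonneg (k : ℝ), sq_nonneg (l : ℝ)]
    have hl : (l : ℝ) = 0 := by nlinarith [sq_nonneg (k : ℝ), sq_nonneg (l : ℝ)]
    exact hkl (by rw [Int.cast_eq_zero.1 hk, Int.cast_eq_zero.1 hl])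
  set x : ℤ := -(l * B - k * D) with hx
  set y : ℤ := l * A - k * C with hy
  have hxy0 : 0 < Real.sqrt ((x : ℝ) ^ 2 + (y : ℝ) ^ 2) := by
    refine Real.sqrt_pos.2 ?_
    by_contra hle
    have hk : (x : ℝ) = 0 := by nlinarith [sq_nonneg (x : ℝ), sq_nonneg (y : ℝ)]
    have hl : (y : ℝ) = 0 := by nlinarith [sq_nonneg (x : ℝ), sq_nonneg (y : ℝ)]
    exact hne (by rw [Int.cast_eq_zero.1 hk, Int.cast_eq_zero.1 hl])
  have hxr : (x : ℝ) = k * D - l * B := by rw [hx]; push_cast; ring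
  have hyr : (y : ℝ) = l * A - k * C := by rw [hy]; push_cast; ring
  have hle : Real.sqrt ((x : ℝ) ^ 2 + (y : ℝ) ^ 2) ≤ M * Real.sqrt ((k : ℝ) ^ 2 + (l : ℝ) ^ 2) := by
    rw [hM, ← Real.sqrt_mul (by positivity)]
    refine Real.sqrt_le_sqrt ?_
    rw [hxr, hyr]
    nlinarith [sq_nonneg ((k : ℝ) * B + l * D), sq_nonneg ((k : ℝ) * A + l * C),
      sq_nonneg (k : ℝ), sq_nonneg (l : ℝ)]
  have h2 := Real.rpow_le_rpow_of_nonpos hxy0 hle (show -τ ≤ 0 by linarith)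
  rw [Real.mul_rpow hM0.le hkl0.le] at h2
  have h3 : e.1 * k + e.2 * l = r * (-(c.1 * m₂.1 + c.2 * m₂.2) * x +
      (c.1 * m₁.1 + c.2 * m₁.2) * y) := by
    have g1 : (l : ℝ) = y * m₁.1 - x * m₂.1 := by
      have : l = y * m₁.1 - x * m₂.1 := by rw [hx, hy]; linear_combination hgen1 k l
      exact_mod_cast this
    have g2 : -(k : ℝ) = y * m₁.2 - x * m₂.2 := by
      have : -k = y * m₁.2 - x * m₂.2 := by rw [hx, hy]; linear_combination hgen2 k l
      exact_mod_cast this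
    rw [he1, he2]
    linear_combination r * c.2 * g2 + r * c.1 * g1
  rw [h3, abs_mul]
  calc |r| * (γ * M ^ (-τ)) * Real.sqrt ((k : ℝ) ^ 2 + (l : ℝ) ^ 2) ^ (-τ)
      = |r| * (γ * (M ^ (-τ) * Real.sqrt ((k : ℝ) ^ 2 + (l : ℝ) ^ 2) ^ (-τ))) := by ring
    _ ≤ |r| * (γ * Real.sqrt ((x : ℝ) ^ 2 + (y : ℝ) ^ 2) ^ (-τ)) := by gcongr
    _ ≤ _ := by gcongr

/-- A reparametrisation of the plane along the lines of direction `e`. -/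
theorem isLatticeDiffeo_add_smul {w : ℝ × ℝ → ℝ} {e : ℝ × ℝ} (hw : ContDiff ℝ ∞ w)
    (hper : ∀ z m, w (z + lat m) = w z) (hpos : ∀ z, -1 < fderiv ℝ w z e) :
    IsLatticeDiffeo fun z => z + w z • e := by
  have hd := hw.differentiable (by simp)
  have hder : ∀ z t, HasDerivAt (fun t => t + w (z + t • e)) (1 + fderiv ℝ w (z + t • e) e) t :=
    fun z t => (hasDerivAt_id t).add (hasDerivAt_comp_line hd z e t)
  -- Points move only along lines of direction `e`, so bijectivity reduces to that of t ↦ t + w(z +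
  -- t e) on each line.
  have hmono : ∀ z, StrictMono fun t => t + w (z + t • e) := fun z =>
    strictMono_of_deriv_pos fun t => by
      rw [(hder z t).deriv]
      linarith [hpos (z + t • e)]
  refine ⟨contDiff_id.add (hw.smul contDiff_const), ⟨fun a b hab => ?_, fun y => ?_⟩,
    fun z m => by simp only [hper]; abel, fun z v hv => ?_⟩
  · have h1 : b = a + (w a - w b) • e := by
      simp only at hab
      rw [sub_smul, ← sub_eq_zero, ← sub_eq_zero.2 hab.symm]
      abel
    have h2 : (w a - w b) + w (a + (w a - w b) • e) = 0 + w (a + (0 : ℝ) • e) := by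
      rw [← h1, zero_smul, add_zero]
      ring
    rw [(hmono a).injective h2, zero_smul, add_zero] at h1
    exact h1.symm
  · obtain ⟨C, hC⟩ := exists_bound_of_periodic hw.continuous hper
    have hcont : Continuous fun t => t + w (y + t • e) :=
      continuous_iff_continuousAt.2 fun t => (hder y t).continuousAt
    obtain ⟨t, ht⟩ := mem_range_of_exists_le_of_exists_ge hcont (c := 0)
      ⟨-C, by linarith [(abs_le.1 (hC (y + (-(C : ℝ)) • e))).2]⟩
      ⟨C, by linarith [(abs_le.1 (hC (y + (C : ℝ) • e))).1]⟩
    refine ⟨y + t • e, ?_⟩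
    simp only at ht ⊢
    rw [add_assoc, ← add_smul, ht, zero_smul, add_zero]
  · have h1 : HasFDerivAt (fun z => z + w z • e)
        (ContinuousLinearMap.id ℝ (ℝ × ℝ) + (fderiv ℝ w z).smulRight e) z :=
      (hasFDerivAt_id z).add ((hd z).hasFDerivAt.smul_const e)
    rw [h1.fderiv] at hv
    have h2 : v = (-fderiv ℝ w z v) • e := by
      rw [neg_smul]
      exact eq_neg_of_add_eq_zero_left hv
    have h3 : fderiv ℝ w z v = -fderiv ℝ w z v * fderiv ℝ w z e := by
      conv_lhs => rw [h2, map_smul, smul_eq_mul]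
    have h4 : fderiv ℝ w z v * (1 + fderiv ℝ w z e) = 0 := by linarith
    rcases mul_eq_zero.1 h4 with h5 | h5
    · rw [h2, h5, neg_zero, zero_smul]
    · linarith [hpos z]

section Conclusion

variable {E : Type*} [NormedAddCommGroup E] [NormedSpace ℝ E]
  {H : Type*} [TopologicalSpace H] {I : ModelWithCorners ℝ E H}
  {S : Type*} [TopologicalSpace S] [ChartedSpace H S] {X : (x : S) → TangentSpace I x}
  {q : ℝ × ℝ → S}

/-- A positive multiple of a constant Diophantine field is linearisable. -/
theorem IsTorusCover.isLinearisable_of_isDiophantine (hq : IsTorusCover I q) {e : ℝ × ℝ}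
    (hdio : IsDiophantine e.1 e.2) {f : S → ℝ} (hf : ContMDiff I 𝓘(ℝ, ℝ) ∞ f) (hpos : ∀ x, 0 < f x) (hX : ∀ u, pullField I q X u = f (q u) • e) : IsLinearisable I X := by
  have hfq : ContDiff ℝ ∞ fun u => f (q u) := (hf.comp hq.smooth).contDiff
  -- With g = 1/f, the map z ↦ z + w(z) e sends f e to f(1 + ∂_e w) e = κ e. Positivity of `κ` and
  -- `f` gives ∂_e w > -1, which makes it a diffeomorphism.
  obtain ⟨κ, w, hκ, hw, hwper, hwe⟩ := exists_cohomological_solution (g := fun u => (f (q u))⁻¹)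
    (hfq.inv fun u => (hpos _).ne') (fun z m => by rw [hq.map_add_lat])
    (fun u => inv_pos.2 (hpos _)) hdio
  have hD := isLatticeDiffeo_add_smul hw hwper fun z => by
    rw [hwe]
    have := inv_pos.2 (hpos (q z))
    nlinarith
  refine hq.isLinearisable_of_latticeDiffeo hD (e := κ • e) fun u => ?_
  have h1 : HasFDerivAt (fun z => z + w z • e)
      (ContinuousLinearMap.id ℝ (ℝ × ℝ) + (fderiv ℝ w u).smulRight e) u :=
    (hasFDerivAt_id u).add ((hw.differentiable (by simp) u).hasFDerivAt.smul_const e)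
  have h2 : (ContinuousLinearMap.id ℝ (ℝ × ℝ) + (fderiv ℝ w u).smulRight e) e =
      (κ * (f (q u))⁻¹) • e := by
    change e + fderiv ℝ w u e • e = _
    rw [hwe, sub_smul, one_smul, add_sub_cancel]
  rw [h1.fderiv, hX, map_smul, h2, smul_smul, mul_left_comm, mul_inv_cancel₀ (hpos _).ne', mul_one]

variable [FiniteDimensional ℝ E] [I.Boundaryless] [IsManifold I ∞ S]

theorem HasDiophantineWindingNumber.isLinearisable (h : HasDiophantineWindingNumber I X)
    (hX0 : ∀ x, X x ≠ 0) (hX : IsSemiLinearisable I X) : IsLinearisable I X := by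
  obtain ⟨-, x, c₁, c₂, α, h1, h2, hgen, hα, hcl, hex, hαX, hdio⟩ := h
  obtain ⟨q, hq, e, f, hf, hpos, hqX⟩ := hX.exists_cover
  obtain ⟨F, hF, hFα, c, hc⟩ := hq.exists_primitive hα hcl
  have he : e ≠ 0 := fun h0 => by
    have h3 := hq.mfderiv_pullField X 0
    rw [hqX, h0, smul_zero] at h3
    exact hX0 (q 0) (h3.symm.trans (ContinuousLinearMap.map_zero _))
  have hFe : ∀ u, fderiv ℝ F u e = 0 := fun u => by
    have h3 := hFα u (pullField I q X u)
    rw [hq.pullForm_apply_pullField, hαX, hqX, map_smul, smul_eq_mul] at h3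
    exact (mul_eq_zero.1 h3).resolve_left (hpos _).ne'
  -- With zero period, `F` would descend to a primitive of `α` on `S`, contradicting non-exactness.
  have hc0 : c ≠ 0 := fun h0 => hex <| by
    obtain ⟨g, hg, hgF⟩ := hq.exists_descend (I' := 𝓘(ℝ, ℝ)) hF.contMDiff fun z m => by
      rw [hc, h0]
      simp
    refine ⟨g, hg, fun y v => ?_⟩
    obtain ⟨u, rfl⟩ := hq.surjective y
    obtain ⟨v, rfl⟩ := hq.mfderiv_surjective u v
    have e1 := mfderiv_comp u (hg.mdifferentiableAt (by simp)) (hq.mdifferentiableAt u)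
    have e2 : (mfderiv 𝓘(ℝ, ℝ × ℝ) 𝓘(ℝ, ℝ) (g ∘ q) u : ℝ × ℝ →L[ℝ] ℝ) = fderiv ℝ F u := by
      rw [show g ∘ q = F from funext hgF]
      exact mfderiv_eq_fderiv
    exact (hFα u v).symm.trans ((DFunLike.congr_fun e2 v).symm.trans (DFunLike.congr_fun e1 v))
  obtain ⟨m₁, m₂, hm₁, hm₂, hm⟩ := hq.exists_generators h1 h2 hgen hF hFα hc
  rw [hm₁, hm₂] at hdio
  exact hq.isLinearisable_of_isDiophantine
    (hdio.of_generators hm hc0 he (dotCLM_eq_zero_of_fderiv_eq_zero hF hc hFe)) hf hpos hqX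

end Conclusion

end TorusField

end

/-! ### The main theorem. -/

theorem theorem4 {S : Type*} [TopologicalSpace S]
    [ChartedSpace (EuclideanSpace ℝ (Fin 2)) S] [IsManifold (𝓡 2) ∞ S]
    (hS : TorusField.IsTwoTorus (𝓡 2) S)
    (X : (x : S) → TangentSpace (𝓡 2) x)
    (hX : TorusField.IsSmoothField (𝓡 2) X)
    (hX0 : ∀ x, X x ≠ 0) :
    List.TFAE
      [TorusField.PreservesAreaForm (𝓡 2) X,
       TorusField.IsWinding (𝓡 2) X,
       TorusField.IsSemiLinearisable (𝓡 2) X] ∧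
    (TorusField.HasDiophantineWindingNumber (𝓡 2) X → TorusField.IsLinearisable (𝓡 2) X) := by
  have hE : Module.finrank ℝ (EuclideanSpace ℝ (Fin 2)) = 2 := finrank_euclideanSpace_fin
  obtain ⟨Φ⟩ := hS
  have hp := TorusField.isTorusCover_torusProj.comp_diffeomorph Φ.symm
  have h23 : TorusField.IsWinding (𝓡 2) X → TorusField.IsSemiLinearisable (𝓡 2) X :=
    fun h => h.isSemiLinearisable hp hX hX0
  refine ⟨?_, fun h => h.isLinearisable hX0 (h23 h.1)⟩
  tfae_have 1 → 2 := fun h => h.isWinding hE hX hX0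
  tfae_have 2 → 3 := h23
  tfae_have 3 → 1 := fun h => h.preservesAreaForm hE hX
  tfae_finish
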